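/- Let $G=(V,E)$ be a finite simple graph with $n=|V|\ge 1$ vertices and $m=|E|$ edges, and let $f:V\to\mathbb N$ be a threshold function. In the $f$-reversible process on $G$ started by $S\subseteq V$, the vertices of $S$ have label $1$ and all others label $0$ at time $0$, and at every discrete time step, synchronously, a vertex $v$ changes its label if and only if at least $f(v)$ of its neighbours have the opposite label. The process converges at time $t$ if all vertices have label $1$ at every time $t'\ge t$ and some vertex has label $0$ at every time $t'<t$. The set $S$ is an $f$-critical set if the process started by $S$ converges at some time $t\le 1$. The critical set number $r^c_f(G)$ is the minimum size of an $f$-critical set ($\infty$ if there is none). The $f$-Critical Set problem asks, given $G$, $f$ and an integer $k>0$, whether $r^c_f(G)\le k$. Theorem. There is an algorithm that decides $f$-Critical Set in $O(n\cdot k^{\Theta(k^3)})$ time; that is, there are a function $g:\mathbb N\to\mathbb N$ with $g(k)=\Theta(k^3)$ and a constant $C$ such that the algorithm answers correctly after at most $C\cdot n\cdot k^{g(k)}$ steps on every instance $(G,f,k)$. In particular, the problem is fixed-parameter tractable when parameterized by $k$: the same algorithm runs in at most $h(k)\cdot(n+m)^c$ steps for some computable function $h:\mathbb N\to\mathbb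 N$ and some constant $c$. Here the graph is given by adjacency lists (in arbitrary order, with random access), and time is measured in steps of a word RAM with unit-cost addition, subtraction, comparison, copying and indirect addressing, whose words hold the input numbers and all numbers up to some fixed power of the respective time bound. -/

import Mathlib

open Filter Asymptotics

namespace CriticalSet

/-! ### Reversible processes and critical sets

Labels are Booleans: `true` is the label 1 and `false` is the label 0. -/

section Dynamics

variable {V : Type*} [Fintype V] [DecidableEq V] (G : SimpleGraph V) [DecidableRel G.Adj]
  (f : V → ℕ)

/-- One synchronous update: `v` changes its label iff at least `f v` of its neighbours
have the opposite label. -/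
def step (c : V → Bool) : V → Bool := fun v =>
  if f v ≤ ((G.neighborFinset v).filter (fun u => c u ≠ c v)).card then !(c v) else c v

/-- The labeling at time `t` of the `f`-reversible process on `G` started by `S`, that is,
with the vertices of `S` labeled 1 at time 0 and all other vertices labeled 0. -/
def process (S : Finset V) (t : ℕ) : V → Bool :=
  (step G f)^[t] (fun v => decide (v ∈ S))

/-- The process started by `S` converges at time `t`: every vertex has label 1 at every time
`t' ≥ t`, and at every time `t' < t` some vertex has label 0. -/
def ConvergesAt (S : Finset V) (t : ℕ) : Prop :=
  (∀ t', t ≤ t' → ∀ v, process G f S t' v = true) ∧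
    ∀ t', t' < t → ∃ v, process G f S t' v = false

/-- `S` is an `f`-critical set: the process started by `S` converges at some time `t ≤ 1`. -/
def IsCriticalSet (S : Finset V) : Prop :=
  ∃ t, t ≤ 1 ∧ ConvergesAt G f S t

/-- The critical set number, the minimum size of an `f`-critical set. It is `⊤` if there is
no `f`-critical set. -/
noncomputable def criticalSetNumber : ℕ∞ :=
  ⨅ S : Finset V, ⨅ _ : IsCriticalSet G f S, (S.card : ℕ∞)

end Dynamics

/-! ### Random access machine

A structured word RAM: finitely many scalar registers and arrays can be named by a program,
array cells are addressed indirectly through registers, and the arithmetic is addition and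
truncated subtraction of words. Every elementary instruction and every test takes one step. -/

/-- Memory contents: scalar registers, and arrays (array name, then index). -/
structure State where
  reg : ℕ → ℕ
  arr : ℕ → ℕ → ℕ

/-- Comparisons of two registers. -/
inductive Test where
  | lt (x y : ℕ)
  | le (x y : ℕ)
  | eq (x y : ℕ)
  | ne (x y : ℕ)

/-- Truth of a test in a state. -/
def Test.Holds (s : State) : Test → Prop
  | .lt x y => s.reg x < s.reg y
  | .le x y => s.reg x ≤ s.reg y
  | .eq x y => s.reg x = s.reg y
  | .ne x y => s.reg x ≠ s.reg y

/-- Programs. All arguments `x y z` are names of registers, `a` is the name of an array. -/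
inductive Program where
  /-- do nothing -/
  | skip
  /-- `x := c` -/
  | const (x c : ℕ)
  /-- `x := y` -/
  | copy (x y : ℕ)
  /-- `x := y + z` -/
  | add (x y z : ℕ)
  /-- `x := max (y - z) 0` -/
  | sub (x y z : ℕ)
  /-- `x := a[y]` -/
  | load (x a y : ℕ)
  /-- `a[x] := y` -/
  | store (a x y : ℕ)
  /-- run `p`, then `q` -/
  | seq (p q : Program)
  /-- if `b` then `p` else `q` -/
  | ite (b : Test) (p q : Program)
  /-- while `b` do `p` -/
  | loop (b : Test) (p : Program)

/-- Write `w` into the register `x`. -/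
def State.setReg (s : State) (x w : ℕ) : State :=
  { s with reg := Function.update s.reg x w }

/-- Write `w` into the cell `i` of the array `a`. -/
def State.setArr (s : State) (a i w : ℕ) : State :=
  { s with arr := Function.update s.arr a (Function.update (s.arr a) i w) }

/-- `Run W p s s' t`: on a machine whose words hold the numbers `0, …, W`, the program `p`
started in the state `s` halts in the state `s'` after exactly `t` steps, and no instruction
produces a number larger than `W`. (A computation that overflows has no run.) -/
inductive Run (W : ℕ) : Program → State → State → ℕ → Prop where
  | skip (s : State) : Run W .skip s s 1
  | const (s : State) (x c : ℕ) (h : c ≤ W) : Run W (.const x c) s (s.setReg x c) 1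
  | copy (s : State) (x y : ℕ) : Run W (.copy x y) s (s.setReg x (s.reg y)) 1
  | add (s : State) (x y z : ℕ) (h : s.reg y + s.reg z ≤ W) :
      Run W (.add x y z) s (s.setReg x (s.reg y + s.reg z)) 1
  | sub (s : State) (x y z : ℕ) :
      Run W (.sub x y z) s (s.setReg x (s.reg y - s.reg z)) 1
  | load (s : State) (x a y : ℕ) :
      Run W (.load x a y) s (s.setReg x (s.arr a (s.reg y))) 1
  | store (s : State) (a x y : ℕ) :
      Run W (.store a x y) s (s.setArr a (s.reg x) (s.reg y)) 1
  | seq {p q : Program} {s s₁ s₂ : State} {t₁ t₂ : ℕ}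
      (hp : Run W p s s₁ t₁) (hq : Run W q s₁ s₂ t₂) : Run W (.seq p q) s s₂ (t₁ + t₂)
  | iteTrue {b : Test} {p q : Program} {s s₁ : State} {t : ℕ}
      (hb : b.Holds s) (hp : Run W p s s₁ t) : Run W (.ite b p q) s s₁ (t + 1)
  | iteFalse {b : Test} {p q : Program} {s s₁ : State} {t : ℕ}
      (hb : ¬ b.Holds s) (hq : Run W q s s₁ t) : Run W (.ite b p q) s s₁ (t + 1)
  | loopTrue {b : Test} {p : Program} {s s₁ s₂ : State} {t₁ t₂ : ℕ}
      (hb : b.Holds s) (hp : Run W p s s₁ t₁) (hl : Run W (.loop b p) s₁ s₂ t₂) :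
      Run W (.loop b p) s s₂ (t₁ + t₂ + 1)
  | loopFalse {b : Test} {p : Program} {s : State}
      (hb : ¬ b.Holds s) : Run W (.loop b p) s s 1

/-- The machine is deterministic: final state and number of steps are determined. -/
theorem Run.deterministic {W : ℕ} {p : Program} {s s₁ s₂ : State} {t₁ t₂ : ℕ}
    (h₁ : Run W p s s₁ t₁) (h₂ : Run W p s s₂ t₂) : s₁ = s₂ ∧ t₁ = t₂ := by
  induction h₁ generalizing s₂ t₂ with
  | seq _ _ ihp ihq =>
    cases h₂ with
    | seq hp hq =>
      obtain ⟨rfl, rfl⟩ := ihp hp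
      obtain ⟨rfl, rfl⟩ := ihq hq
      exact ⟨rfl, rfl⟩
  | iteTrue hb _ ih =>
    cases h₂ with
    | iteTrue _ hp => obtain ⟨rfl, rfl⟩ := ih hp; exact ⟨rfl, rfl⟩
    | iteFalse hb' _ => exact absurd hb hb'
  | iteFalse hb _ ih =>
    cases h₂ with
    | iteTrue hb' _ => exact absurd hb' hb
    | iteFalse _ hp => obtain ⟨rfl, rfl⟩ := ih hp; exact ⟨rfl, rfl⟩
  | loopTrue hb _ _ ihp ihl =>
    cases h₂ with
    | loopTrue _ hp hl =>
      obtain ⟨rfl, rfl⟩ := ihp hp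
      obtain ⟨rfl, rfl⟩ := ihl hl
      exact ⟨rfl, rfl⟩
    | loopFalse hb' => exact absurd hb hb'
  | loopFalse hb =>
    cases h₂ with
    | loopTrue hb' _ _ => exact absurd hb' hb
    | loopFalse _ => exact ⟨rfl, rfl⟩
  | _ => cases h₂; exact ⟨rfl, rfl⟩

/-! ### Inputs and running time -/

/-- The initial memory `s` holds the instance `(G, f, k)`. Register 0 holds the number `n` of
vertices, register 1 holds `k`; array 0 holds the thresholds; arrays 1 and 2 hold the adjacency
lists: the neighbours of `v`, in an arbitrary order, are the entries of array 2 at the positions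
`arr 1 v ≤ i < arr 1 (v + 1)`. (There are `deg v` such positions and every neighbour
occurs, so each neighbour occurs once and nothing else occurs.) All other cells hold 0. -/
structure IsInput (s : State) {n : ℕ} (G : SimpleGraph (Fin n)) [DecidableRel G.Adj]
    (f : Fin n → ℕ) (k : ℕ) : Prop where
  vertices : s.reg 0 = n
  parameter : s.reg 1 = k
  threshold : ∀ v : Fin n, s.arr 0 v = f v
  offset_zero : s.arr 1 0 = 0
  offset_succ : ∀ v : Fin n, s.arr 1 (v + 1) = s.arr 1 v + G.degree v
  adjacency : ∀ v u : Fin n,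
    G.Adj v u ↔ ∃ i, s.arr 1 v ≤ i ∧ i < s.arr 1 (v + 1) ∧ s.arr 2 i = u
  reg_zero : ∀ x, 2 ≤ x → s.reg x = 0
  threshold_zero : ∀ i, n ≤ i → s.arr 0 i = 0
  offset_end : ∀ i, n < i → s.arr 1 i = 0
  adjacency_end : ∀ i, s.arr 1 n ≤ i → s.arr 2 i = 0
  arr_zero : ∀ a, 3 ≤ a → ∀ i, s.arr a i = 0

/-- The program `P` decides the `f`-Critical Set problem in time `T n m k`, where `n` is the
number of vertices and `m` the number of edges: on every instance `(G, f, k)` with `n, k > 0`,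
`P` halts after at most `T n m k` steps with 1 in register 0 if the critical set number is at
most `k`, and with 0 in register 0 otherwise. The word length is logarithmic: it suffices that
words hold the input numbers and the numbers up to a fixed power of the time bound. -/
def DecidesCriticalSetInTime (P : Program) (T : ℕ → ℕ → ℕ → ℕ) : Prop :=
  ∃ q : ℕ, ∀ (n k : ℕ), 0 < n → 0 < k →
    ∀ (G : SimpleGraph (Fin n)) [DecidableRel G.Adj] (f : Fin n → ℕ) (s : State),
      IsInput s G f k →
      ∀ W : ℕ, T n G.edgeFinset.card k ^ q ≤ W →
        (∀ x, s.reg x ≤ W) → (∀ a i, s.arr a i ≤ W) →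
        ∃ (s' : State) (t : ℕ), Run W P s s' t ∧ t ≤ T n G.edgeFinset.card k ∧
          (criticalSetNumber G f ≤ k → s'.reg 0 = 1) ∧
          (¬ criticalSetNumber G f ≤ k → s'.reg 0 = 0)

end CriticalSet

namespace CriticalSet

/-! ### Program logic -/

/-! Two steps of the process give a local criterion: `S` is critical iff each vertex of `S` has
fewer than `f v` neighbours outside `S`, each vertex outside `S` has at least `f v` neighbours in
`S`, and `f` is positive everywhere (`isCriticalSet_iff`). Let `S` be critical of size at most `k`.
Vertices with threshold above `k` (heavy) are forced into `S`. Every other member has threshold at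
most `k` and, since it has at most `k` neighbours in `S`, degree at most `2k` (`Crit.low`). A vertex
outside `S` whose demand the heavy vertices do not meet is adjacent to a non-heavy member. Hence the
heavy vertices and those not served by them form a zone of at most `2k(k+1)` vertices
(`Crit.card_zone`).

The non-heavy part of `S` splits into connected components. These are not adjacent to each other and
matter to the rest of the graph only through the zone. So a component may be exchanged for any
connected low-degree set that is disjoint from `S`, meets the demands of its own members together
with the heavy vertices, and has the same size, the same trace on the zone and the same neighbour
counts there (`Crit.exchange`). These data are the digits of one number in base `2k+2`, so there are
only `(2k)^O(k^2)` codes (`sum_vertexCode`, `weight_sum_inj`).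

A connected set of at most `k` low-degree vertices around a given vertex is described by a short
digit sequence (`gen`, `GenInv.exists_gen`). Thus the pieces that meet a fixed set of size `k` have
at most `k^2 * rootSeqs k` roots. If one more root than that is kept for each code, then a component
with an unkept root can always be exchanged for a piece that avoids `S` and has a kept root
(`exists_root_disjoint`). Repeating this (`Crit.exists_stray_lt`) gives a critical set all of whose
components contain kept roots. There are `(2k)^O(k^2)` kept roots. Choosing at most `k` vertices in
turn, each a root or a neighbour of an earlier choice, gives `(2k)^O(k^3)` sets to try
(`exists_crit_iff`).

The running time is linear in `n`, not in the number of edges. Degrees are differences of offsets.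
Testing one digit sequence at one root reads only lists of length at most `2k` and undoes its own
writes, so its cost depends on `k` alone. A full test reads only the lists of the at most `k`
members and then scans the vertices once. Multiplication by repeated addition and division by
repeated subtraction cost no more than a polynomial in the number of sets tried, which the exponent
absorbs. -/

@[simp] theorem State.setReg_reg (s : State) (x w y : ℕ) :
    (s.setReg x w).reg y = if y = x then w else s.reg y := by
  simp [State.setReg, Function.update_apply]

@[simp] theorem State.setReg_arr (s : State) (x w : ℕ) : (s.setReg x w).arr = s.arr := rfl

@[simp] theorem State.setArr_reg (s : State) (a i w : ℕ) : (s.setArr a i w).reg = s.reg := rfl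

@[simp] theorem State.setArr_arr (s : State) (a i w b : ℕ) :
    (s.setArr a i w).arr b = if b = a then Function.update (s.arr a) i w else s.arr b := by
  simp only [State.setArr, Function.update_apply]

/-- `p` halts from `s`, and its final state and running time satisfy `Q`. -/
def WP (W : ℕ) (p : Program) (s : State) (Q : State → ℕ → Prop) : Prop :=
  ∃ s' t, Run W p s s' t ∧ Q s' t

/-! ### Weakest preconditions with running times. -/

section Rules

variable {W : ℕ} {s : State} {Q : State → ℕ → Prop}

@[simp] theorem WP.skip_iff : WP W .skip s Q ↔ Q s 1 :=
  ⟨by rintro ⟨_, _, h, hQ⟩; cases h; exact hQ, fun h => ⟨_, _, .skip s, h⟩⟩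

@[simp] theorem WP.const_iff {x c : ℕ} :
    WP W (.const x c) s Q ↔ c ≤ W ∧ Q (s.setReg x c) 1 :=
  ⟨by rintro ⟨_, _, h, hQ⟩; cases h; exact ⟨‹_›, hQ⟩, fun h => ⟨_, _, .const s x c h.1, h.2⟩⟩

@[simp] theorem WP.copy_iff {x y : ℕ} :
    WP W (.copy x y) s Q ↔ Q (s.setReg x (s.reg y)) 1 :=
  ⟨by rintro ⟨_, _, h, hQ⟩; cases h; exact hQ, fun h => ⟨_, _, .copy s x y, h⟩⟩

@[simp] theorem WP.add_iff {x y z : ℕ} :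
    WP W (.add x y z) s Q ↔
      s.reg y + s.reg z ≤ W ∧ Q (s.setReg x (s.reg y + s.reg z)) 1 :=
  ⟨by rintro ⟨_, _, h, hQ⟩; cases h; exact ⟨‹_›, hQ⟩, fun h => ⟨_, _, .add s x y z h.1, h.2⟩⟩

@[simp] theorem WP.sub_iff {x y z : ℕ} :
    WP W (.sub x y z) s Q ↔ Q (s.setReg x (s.reg y - s.reg z)) 1 :=
  ⟨by rintro ⟨_, _, h, hQ⟩; cases h; exact hQ, fun h => ⟨_, _, .sub s x y z, h⟩⟩

@[simp] theorem WP.load_iff {x a y : ℕ} :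
    WP W (.load x a y) s Q ↔ Q (s.setReg x (s.arr a (s.reg y))) 1 :=
  ⟨by rintro ⟨_, _, h, hQ⟩; cases h; exact hQ, fun h => ⟨_, _, .load s x a y, h⟩⟩

@[simp] theorem WP.store_iff {a x y : ℕ} :
    WP W (.store a x y) s Q ↔ Q (s.setArr a (s.reg x) (s.reg y)) 1 :=
  ⟨by rintro ⟨_, _, h, hQ⟩; cases h; exact hQ, fun h => ⟨_, _, .store s a x y, h⟩⟩

@[simp] theorem WP.seq_iff {p q : Program} :
    WP W (.seq p q) s Q ↔
      WP W p s fun s₁ t₁ => WP W q s₁ fun s₂ t₂ => Q s₂ (t₁ + t₂) := by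
  constructor
  · rintro ⟨_, _, h, hQ⟩
    cases h with
    | seq hp hq => exact ⟨_, _, hp, _, _, hq, hQ⟩
  · rintro ⟨_, _, hp, _, _, hq, hQ⟩
    exact ⟨_, _, .seq hp hq, hQ⟩

@[simp] theorem WP.ite_iff {b : Test} {p q : Program} :
    WP W (.ite b p q) s Q ↔
      (b.Holds s → WP W p s fun s₁ t => Q s₁ (t + 1)) ∧
      (¬ b.Holds s → WP W q s fun s₁ t => Q s₁ (t + 1)) := by
  constructor
  · rintro ⟨_, _, h, hQ⟩
    cases h with
    | iteTrue hb hp => exact ⟨fun _ => ⟨_, _, hp, hQ⟩, fun h => absurd hb h⟩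
    | iteFalse hb hp => exact ⟨fun h => absurd h hb, fun _ => ⟨_, _, hp, hQ⟩⟩
  · rintro ⟨h₁, h₂⟩
    by_cases hb : b.Holds s
    · obtain ⟨_, _, hp, hQ⟩ := h₁ hb
      exact ⟨_, _, .iteTrue hb hp, hQ⟩
    · obtain ⟨_, _, hp, hQ⟩ := h₂ hb
      exact ⟨_, _, .iteFalse hb hp, hQ⟩

@[simp] theorem Test.holds_lt {x y : ℕ} : (Test.lt x y).Holds s ↔ s.reg x < s.reg y := Iff.rfl
@[simp] theorem Test.holds_le {x y : ℕ} : (Test.le x y).Holds s ↔ s.reg x ≤ s.reg y := Iff.rfl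
@[simp] theorem Test.holds_eq {x y : ℕ} : (Test.eq x y).Holds s ↔ s.reg x = s.reg y := Iff.rfl
end Rules

/-- `p` contains an instruction that writes into the register `x`. -/
def Program.writesReg (x : ℕ) : Program → Bool
  | .skip => false
  | .const y _ => y == x
  | .copy y _ => y == x
  | .add y _ _ => y == x
  | .sub y _ _ => y == x
  | .load y _ _ => y == x
  | .store _ _ _ => false
  | .seq p q => p.writesReg x || q.writesReg x
  | .ite _ p q => p.writesReg x || q.writesReg x
  | .loop _ p => p.writesReg x

/-- `p` contains an instruction that writes into the array `a`. -/
def Program.writesArr (a : ℕ) : Program → Bool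
  | .store b _ _ => b == a
  | .seq p q => p.writesArr a || q.writesArr a
  | .ite _ p q => p.writesArr a || q.writesArr a
  | .loop _ p => p.writesArr a
  | _ => false

/-- The registers a program can change are read off its text. Most frame conditions below therefore
reduce to evaluating a Boolean, by `rfl` or `decide`. -/
theorem Run.reg_eq {W x t : ℕ} {p : Program} {s s' : State} (h : Run W p s s' t)
    (hx : p.writesReg x = false) : s'.reg x = s.reg x := by
  induction h with
  | seq _ _ ih₁ ih₂ =>
    simp only [Program.writesReg, Bool.or_eq_false_iff] at hx
    rw [ih₂ hx.2, ih₁ hx.1]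
  | iteTrue _ _ ih => simp only [Program.writesReg, Bool.or_eq_false_iff] at hx; exact ih hx.1
  | iteFalse _ _ ih => simp only [Program.writesReg, Bool.or_eq_false_iff] at hx; exact ih hx.2
  | loopTrue _ _ _ ih₁ ih₂ => rw [ih₂ hx, ih₁ hx]
  | _ =>
    first
    | rfl
    | (simp only [Program.writesReg, beq_eq_false_iff_ne] at hx; simp [hx.symm])

theorem Run.arr_eq {W a t : ℕ} {p : Program} {s s' : State} (h : Run W p s s' t)
    (ha : p.writesArr a = false) : s'.arr a = s.arr a := by
  induction h with
  | seq _ _ ih₁ ih₂ =>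
    simp only [Program.writesArr, Bool.or_eq_false_iff] at ha
    rw [ih₂ ha.2, ih₁ ha.1]
  | iteTrue _ _ ih => simp only [Program.writesArr, Bool.or_eq_false_iff] at ha; exact ih ha.1
  | iteFalse _ _ ih => simp only [Program.writesArr, Bool.or_eq_false_iff] at ha; exact ih ha.2
  | loopTrue _ _ _ ih₁ ih₂ => rw [ih₂ ha, ih₁ ha]
  | store s b x y =>
    simp only [Program.writesArr, beq_eq_false_iff_ne] at ha
    simp [ha.symm]
  | _ => rfl

/-- Use of a specification `Q'` of `p`. Besides `Q'`, the final state agrees with the initial one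
on everything that `p` does not write. -/
theorem WP.call {W : ℕ} {p : Program} {s : State} {Q Q' : State → ℕ → Prop}
    (h : WP W p s Q')
    (hQ : ∀ s' t, Q' s' t → (∀ x, p.writesReg x = false → s'.reg x = s.reg x) →
      (∀ a, p.writesArr a = false → s'.arr a = s.arr a) → Q s' t) : WP W p s Q := by
  obtain ⟨s', t, hr, h'⟩ := h
  exact ⟨s', t, hr, hQ s' t h' (fun _ => hr.reg_eq) (fun _ => hr.arr_eq)⟩

/-- `for i := lo, …, lim - 1 do body`, where register 2 holds 1. -/
def forLoop (i lo lim : ℕ) (body : Program) : Program :=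
  .seq (.copy i lo) (.loop (.lt i lim) (.seq body (.add i i 2)))

/-- The body may assume that everything it never writes still has its value from before the loop, so
invariants mention only what changes. The loop itself increments the counter, which is why the
invariant is demanded after `setReg`. -/
theorem forLoop_spec {W i lo lim b : ℕ} {body : Program} {s : State} (I : ℕ → State → Prop)
    (hw : body.writesReg i = false ∧ body.writesReg lim = false ∧ body.writesReg 2 = false ∧
      i ≠ lim ∧ i ≠ 2)
    (h2 : s.reg 2 = 1) (hle : s.reg lo ≤ s.reg lim) (hW : s.reg lim ≤ W)
    (h0 : I (s.reg lo) (s.setReg i (s.reg lo)))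
    (hb : ∀ j s₁, s.reg lo ≤ j → j < s.reg lim → s₁.reg i = j →
      (∀ x, body.writesReg x = false → x ≠ i → s₁.reg x = s.reg x) →
      (∀ a, body.writesArr a = false → s₁.arr a = s.arr a) → I j s₁ →
      WP W body s₁ fun s₂ t => t ≤ b ∧ I (j + 1) (s₂.setReg i (j + 1))) :
    WP W (forLoop i lo lim body) s fun s' t =>
      t ≤ (s.reg lim - s.reg lo) * (b + 2) + 2 ∧ I (s.reg lim) s' := by
  obtain ⟨w₁, w₂, w₃, hil, hi2⟩ := hw
  have key : ∀ d j s₁, j + d = s.reg lim → s.reg lo ≤ j → s₁.reg i = j →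
      (∀ x, body.writesReg x = false → x ≠ i → s₁.reg x = s.reg x) →
      (∀ a, body.writesArr a = false → s₁.arr a = s.arr a) → I j s₁ →
      WP W (.loop (.lt i lim) (.seq body (.add i i 2))) s₁ fun s' t =>
        t ≤ d * (b + 2) + 1 ∧ I (s.reg lim) s' := by
    intro d
    induction d with
    | zero =>
      intro j s₁ hj _ hi hr _ hI
      have hl := hr lim w₂ hil.symm
      refine ⟨s₁, 1, .loopFalse ?_, by simp, ?_⟩
      · simp only [Test.holds_lt]; omega
      · rw [add_zero] at hj; exact hj ▸ hI
    | succ d ih =>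
      intro j s₁ hj hlo hi hr ha hI
      have hl := hr lim w₂ hil.symm
      have h2' := hr 2 w₃ hi2.symm
      obtain ⟨s₂, t, hrun, ht, hI₂⟩ := hb j s₁ hlo (by omega) hi hr ha hI
      obtain ⟨s₃, t', hrun', ht', hI₃⟩ := ih (j + 1) (s₂.setReg i (j + 1)) (by omega) (by omega)
        (by simp) (fun x hx hxi => by simp [hxi, hrun.reg_eq hx, hr x hx hxi])
        (fun a hx => by simp [hrun.arr_eq hx, ha a hx]) hI₂
      have hadd : Run W (.add i i 2) s₂ (s₂.setReg i (j + 1)) 1 := by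
        have e₁ := hrun.reg_eq w₁
        have e₃ := hrun.reg_eq w₃
        have := Run.add (W := W) s₂ i i 2 (by omega)
        rwa [e₁, e₃, hi, h2', h2] at this
      refine ⟨s₃, _, .loopTrue (by simp only [Test.holds_lt]; omega) (.seq hrun hadd) hrun', ?_,
        hI₃⟩
      calc t + 1 + t' + 1 ≤ b + 1 + (d * (b + 2) + 1) + 1 := by omega
        _ = (d + 1) * (b + 2) + 1 := by ring
  obtain ⟨s', t, hr, ht, hI⟩ := key (s.reg lim - s.reg lo) (s.reg lo) (s.setReg i (s.reg lo))
    (by omega) le_rfl (by simp) (fun x _ hx => by simp [hx]) (fun _ _ => rfl) h0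
  exact ⟨s', _, .seq (.copy s i lo) hr, by omega, hI⟩

@[simp] theorem writesReg_forLoop (x i lo lim : ℕ) (body : Program) :
    (forLoop i lo lim body).writesReg x = (i == x || body.writesReg x) := by
  simp only [forLoop, Program.writesReg]
  cases (i == x) <;> simp

@[simp] theorem writesArr_forLoop (a i lo lim : ℕ) (body : Program) :
    (forLoop i lo lim body).writesArr a = body.writesArr a := by
  simp [forLoop, Program.writesArr]

/-! ### Combinatorics of critical sets, over adjacency lists of natural numbers -/

/-- `N` lists the neighbours in a symmetric relation on `{0, …, n - 1}`. -/
structure IsNet (n : ℕ) (N : ℕ → List ℕ) : Prop where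
  nodup : ∀ v < n, (N v).Nodup
  lt : ∀ v < n, ∀ u ∈ N v, u < n
  symm : ∀ u < n, ∀ v < n, u ∈ N v → v ∈ N u

/-- The number of neighbours of `v` in `S`. -/
def cnt (N : ℕ → List ℕ) (S : Finset ℕ) (v : ℕ) : ℕ := ((N v).toFinset ∩ S).card

/-- The local description of critical sets. -/
def Crit (n : ℕ) (N : ℕ → List ℕ) (F : ℕ → ℕ) (S : Finset ℕ) : Prop :=
  ∀ v < n, (v ∈ S → (N v).length - cnt N S v < F v) ∧ (v ∉ S → 1 ≤ F v ∧ F v ≤ cnt N S v)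

/-- The vertices that belong to every critical set of size at most `k`. -/
def heavy (n k : ℕ) (F : ℕ → ℕ) : List ℕ := (List.range n).filter fun v => k < F v

/-- The vertices that can belong to a critical set of size at most `k` without being heavy. -/
def Low (k : ℕ) (N : ℕ → List ℕ) (F : ℕ → ℕ) (c : ℕ) : Prop := F c ≤ k ∧ (N c).length ≤ 2 * k

/-- Reachability within `B`. -/
def Reach (N : ℕ → List ℕ) (B : Finset ℕ) : ℕ → ℕ → Prop :=
  Relation.ReflTransGen fun u v => v ∈ N u ∧ u ∈ B ∧ v ∈ B

section

variable {n k : ℕ} {N : ℕ → List ℕ} {F : ℕ → ℕ}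

theorem cnt_mono {S T : Finset ℕ} (h : S ⊆ T) (v : ℕ) : cnt N S v ≤ cnt N T v :=
  Finset.card_le_card (Finset.inter_subset_inter_left h)

theorem cnt_le_card (S : Finset ℕ) (v : ℕ) : cnt N S v ≤ S.card :=
  Finset.card_le_card Finset.inter_subset_right

theorem cnt_union {S T : Finset ℕ} (h : Disjoint S T) (v : ℕ) :
    cnt N (S ∪ T) v = cnt N S v + cnt N T v := by
  rw [cnt, Finset.inter_union_distrib_left, Finset.card_union_of_disjoint]
  · rfl
  · exact h.mono Finset.inter_subset_right Finset.inter_subset_right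

theorem mem_heavy {v : ℕ} : v ∈ heavy n k F ↔ v < n ∧ k < F v := by
  simp [heavy]

theorem nodup_heavy : (heavy n k F).Nodup := List.nodup_range.filter _

theorem Reach.mono {B B' : Finset ℕ} (h : B ⊆ B') {u v : ℕ} (huv : Reach N B u v) :
    Reach N B' u v :=
  huv.lift id fun _ _ hab => ⟨hab.1, h hab.2.1, h hab.2.2⟩

theorem Reach.symm (hN : IsNet n N) {B : Finset ℕ} (hB : ∀ v ∈ B, v < n) {u v : ℕ}
    (h : Reach N B u v) : Reach N B v u := by
  induction h with
  | refl => exact .refl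
  | tail _ hab ih =>
    exact Relation.ReflTransGen.head
      ⟨hN.symm _ (hB _ hab.2.2) _ (hB _ hab.2.1) hab.1, hab.2.2, hab.2.1⟩ ih

theorem Reach.trans {B : Finset ℕ} {u v w : ℕ} (h : Reach N B u v) (h' : Reach N B v w) :
    Reach N B u w := Relation.ReflTransGen.trans h h'

/-! #### Structure of small critical sets -/

theorem Crit.one_le {S : Finset ℕ} (h : Crit n N F S) {v : ℕ} (hv : v < n) : 1 ≤ F v := by
  by_cases hs : v ∈ S
  · have := (h v hv).1 hs; omega
  · exact ((h v hv).2 hs).1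

/-- A vertex outside `S` has at most `|S| ≤ k` neighbours in `S`, too few for a threshold above `k`.
-/
theorem Crit.heavy_subset {S : Finset ℕ} (h : Crit n N F S) (hk : S.card ≤ k) :
    (heavy n k F).toFinset ⊆ S := by
  intro v hv
  obtain ⟨hn, hf⟩ := mem_heavy.1 (List.mem_toFinset.1 hv)
  by_contra hs
  have := ((h v hn).2 hs).2
  have := cnt_le_card (N := N) S v
  omega

/-- The degree is less than the threshold plus the number of neighbours in `S`, and both are at most
`k`. -/
theorem Crit.low {S : Finset ℕ} (h : Crit n N F S) (hk : S.card ≤ k) {v : ℕ} (hn : v < n)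
    (hv : v ∈ S) (hA : v ∉ heavy n k F) : Low k N F v := by
  rw [mem_heavy] at hA
  have := (h v hn).1 hv
  have := cnt_le_card (N := N) S v
  constructor <;> omega

/-- The vertices whose demand is not met by the heavy vertices, together with the latter. -/
def critZone (n k : ℕ) (N : ℕ → List ℕ) (F : ℕ → ℕ) : Finset ℕ :=
  (Finset.range n).filter fun v =>
    v ∈ heavy n k F ∨ cnt N (heavy n k F).toFinset v < F v

/-- A zone vertex outside `S` is served by `S` but not by the heavy vertices alone, so it is
adjacent to a non-heavy member. There are at most `k` of those, each of degree at most `2k`. The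
members of `S` add at most `k`. -/
theorem Crit.card_zone {S : Finset ℕ} (hN : IsNet n N) (h : Crit n N F S) (hk : S.card ≤ k)
    (hn : ∀ v ∈ S, v < n) : (critZone n k N F).card ≤ 2 * k * (k + 1) := by
  have hA := h.heavy_subset hk
  set A := (heavy n k F).toFinset with hAdef
  have hsub : critZone n k N F ⊆ S ∪ (S \ A).biUnion fun u => (N u).toFinset := by
    intro v hv
    simp only [critZone, Finset.mem_filter, Finset.mem_range] at hv
    obtain ⟨hvn, hv⟩ := hv
    by_cases hs : v ∈ S
    · simp [hs]
    · have hvA : v ∉ heavy n k F := fun h' => hs (hA (List.mem_toFinset.2 h'))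
      have h₁ := hv.resolve_left hvA
      rw [← hAdef] at h₁
      have h₂ := ((h v hvn).2 hs).2
      have h₃ : cnt N A v < cnt N S v := by omega
      obtain ⟨u, hu, hu'⟩ : ∃ u ∈ (N v).toFinset ∩ S, u ∉ (N v).toFinset ∩ A := by
        by_contra! hcon
        exact absurd (Finset.card_le_card hcon) (not_le.2 h₃)
      rw [Finset.mem_inter] at hu hu'
      refine Finset.mem_union_right _ (Finset.mem_biUnion.2 ⟨u, ?_, ?_⟩)
      · exact Finset.mem_sdiff.2 ⟨hu.2, fun h' => hu' ⟨hu.1, h'⟩⟩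
      · exact List.mem_toFinset.2 (hN.symm _ (hn u hu.2) _ hvn (List.mem_toFinset.1 hu.1))
  calc (critZone n k N F).card ≤ S.card + (S \ A).card * (2 * k) := by
        refine (Finset.card_le_card hsub).trans ((Finset.card_union_le _ _).trans ?_)
        gcongr
        refine Finset.card_biUnion_le_card_mul _ _ _ fun u hu => ?_
        rw [Finset.mem_sdiff] at hu
        refine (List.toFinset_card_le _).trans
          (h.low hk (hn u hu.1) hu.1 fun h' => hu.2 (List.mem_toFinset.2 h')).2
    _ ≤ k + k * (2 * k) := by
        gcongr
        exact (Finset.card_le_card Finset.sdiff_subset).trans hk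
    _ ≤ 2 * k * (k + 1) := by nlinarith

/-! #### Generating sets from digit sequences -/

/-- Add the candidate `c` to the set under construction, and its neighbours to the candidates. -/
def push (k : ℕ) (N : ℕ → List ℕ) (F : ℕ → ℕ) (c : ℕ) (st : List ℕ × List ℕ) :
    List ℕ × List ℕ :=
  if c ∉ st.1 ∧ F c ≤ k ∧ st.1.length < k ∧ (N c).length ≤ 2 * k then
    (st.1 ++ [c], st.2 ++ N c) else st

/-- Add the candidate number `d`. -/
def pushDigit (k : ℕ) (N : ℕ → List ℕ) (F : ℕ → ℕ) (d : ℕ) (st : List ℕ × List ℕ) :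
    List ℕ × List ℕ :=
  if h : d < st.2.length then push k N F st.2[d] st else st

/-- Add the candidates given by the lowest `i` digits of `x` in base `B`. -/
def gen (k : ℕ) (N : ℕ → List ℕ) (F : ℕ → ℕ) (B : ℕ) :
    ℕ → ℕ → List ℕ × List ℕ → List ℕ × List ℕ
  | 0, _, st => st
  | i + 1, x, st => gen k N F B i (x / B) (pushDigit k N F (x % B) st)

/-- The invariant of `gen`, started with the set `A` and the candidates `R`. -/
structure GenInv (n k : ℕ) (N : ℕ → List ℕ) (F : ℕ → ℕ) (A R : List ℕ)
    (st : List ℕ × List ℕ) : Prop where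
  nodup : st.1.Nodup
  pre : A <+: st.1
  len : st.1.length ≤ k
  lt : ∀ c ∈ st.1, c < n
  cand_lt : ∀ c ∈ st.2, c < n
  low : ∀ c ∈ st.1, c ∉ A → Low k N F c
  cand_pre : R <+: st.2
  cand_len : st.2.length + 2 * k * A.length ≤ R.length + 2 * k * st.1.length
  nbr : ∀ c ∈ st.1, c ∉ A → ∀ u ∈ N c, u ∈ st.2
  conn : ∀ c ∈ st.1, c ∉ A → ∃ r ∈ R, r ∈ st.1.toFinset \ A.toFinset ∧
    Reach N (st.1.toFinset \ A.toFinset) r c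
  cand_conn : ∀ u ∈ st.2, u ∈ R ∨ ∃ c ∈ st.1, c ∉ A ∧ u ∈ N c

variable {A R : List ℕ} {st : List ℕ × List ℕ}

theorem GenInv.init (hA : A.Nodup) (hAk : A.length ≤ k) (hAn : ∀ c ∈ A, c < n)
    (hR : ∀ c ∈ R, c < n) : GenInv n k N F A R (A, R) where
  nodup := hA
  pre := List.prefix_rfl
  len := hAk
  lt := hAn
  cand_lt := hR
  low := fun _ h h' => absurd h h'
  cand_pre := List.prefix_rfl
  cand_len := le_rfl
  nbr := fun _ h h' => absurd h h'
  conn := fun _ h h' => absurd h h'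
  cand_conn := fun _ h => .inl h

/-- Low degree is what keeps the candidate list short: each accepted vertex adds at most `2k`
entries, which is the increment in `cand_len`. -/
theorem GenInv.push (hN : IsNet n N) (h : GenInv n k N F A R st) {c : ℕ} (hc : c ∈ st.2) :
    GenInv n k N F A R (push k N F c st) := by
  unfold CriticalSet.push
  split_ifs with hcond
  · obtain ⟨hcs, hF, hlen, hdeg⟩ := hcond
    have hcn := h.cand_lt c hc
    have hcA : c ∉ A := fun h' => hcs (h.pre.subset h')
    have hsub : st.1.toFinset \ A.toFinset ⊆ (st.1 ++ [c]).toFinset \ A.toFinset := by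
      intro x; simp only [Finset.mem_sdiff, List.mem_toFinset, List.mem_append]; tauto
    have hcmem : c ∈ (st.1 ++ [c]).toFinset \ A.toFinset := by simp [hcA]
    refine ⟨?_, ?_, ?_, ?_, ?_, ?_, ?_, ?_, ?_, ?_, ?_⟩
    · exact List.nodup_append.2 ⟨h.nodup, List.nodup_singleton c, by
        intro a ha b hb; simp only [List.mem_singleton] at hb; rintro rfl; exact hcs (hb ▸ ha)⟩
    · exact h.pre.trans (List.prefix_append _ _)
    · simpa using hlen
    · intro x hx
      simp only [List.mem_append, List.mem_singleton] at hx
      rcases hx with hx | rfl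
      · exact h.lt x hx
      · exact hcn
    · intro x hx
      simp only [List.mem_append] at hx
      rcases hx with hx | hx
      · exact h.cand_lt x hx
      · exact hN.lt c hcn x hx
    · intro x hx hxA
      simp only [List.mem_append, List.mem_singleton] at hx
      rcases hx with hx | rfl
      · exact h.low x hx hxA
      · exact ⟨hF, hdeg⟩
    · exact h.cand_pre.trans (List.prefix_append _ _)
    · have := h.cand_len
      simp only [List.length_append, List.length_singleton, mul_add, mul_one]
      omega
    · intro x hx hxA u hu
      simp only [List.mem_append, List.mem_singleton] at hx ⊢
      rcases hx with hx | rfl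
      · exact .inl (h.nbr x hx hxA u hu)
      · exact .inr hu
    · intro x hx hxA
      simp only [List.mem_append, List.mem_singleton] at hx
      rcases hx with hx | rfl
      · obtain ⟨r, hr, hrm, hreach⟩ := h.conn x hx hxA
        exact ⟨r, hr, hsub hrm, hreach.mono hsub⟩
      -- A candidate is either a root, connected to itself, or a neighbour of an earlier non-heavy
      -- member, whose path from a root it extends.
      · rcases h.cand_conn x hc with hR | ⟨p, hp, hpA, hpx⟩
        · exact ⟨x, hR, hcmem, .refl⟩
        · obtain ⟨r, hr, hrm, hreach⟩ := h.conn p hp hpA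
          refine ⟨r, hr, hsub hrm, (hreach.mono hsub).tail ⟨hpx, ?_, hcmem⟩⟩
          exact hsub (by simp [hp, hpA])
    · intro u hu
      simp only [List.mem_append] at hu
      rcases hu with hu | hu
      · rcases h.cand_conn u hu with hR | ⟨p, hp, hpA, hpx⟩
        · exact .inl hR
        · exact .inr ⟨p, by simp [hp], hpA, hpx⟩
      · exact .inr ⟨c, by simp, hcA, hu⟩
  · exact h

theorem GenInv.pushDigit (hN : IsNet n N) (h : GenInv n k N F A R st) (d : ℕ) :
    GenInv n k N F A R (pushDigit k N F d st) := by
  unfold CriticalSet.pushDigit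
  split_ifs with hd
  · exact h.push hN (List.getElem_mem hd)
  · exact h

theorem GenInv.gen (hN : IsNet n N) {B : ℕ} (i x : ℕ) (h : GenInv n k N F A R st) :
    GenInv n k N F A R (gen k N F B i x st) := by
  induction i generalizing x st with
  | zero => exact h
  | succ i ih => exact ih _ (h.pushDigit hN _)

/-- This bound on the candidate list fixes the base of the digits: any larger base leaves a digit
that names no candidate. -/
theorem GenInv.cand_length (h : GenInv n k N F A R st) :
    st.2.length ≤ R.length + 2 * k * k := by
  have h₁ := h.cand_len
  have h₂ : 2 * k * st.1.length ≤ 2 * k * k := Nat.mul_le_mul_left _ h.len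
  omega

/-- Every set of low vertices each of which is reachable from a root is generated. -/
theorem GenInv.exists_gen (hN : IsNet n N) {B : ℕ} (hB : R.length + 2 * k * k < B)
    {S : Finset ℕ} (hS : S.card ≤ k)
    (hlow : ∀ v ∈ S, v ∉ A → Low k N F v)
    (hreach : ∀ v ∈ S, v ∉ A → ∃ r ∈ R, r ∈ S \ A.toFinset ∧ Reach N (S \ A.toFinset) r v)
    (i : ℕ) (h : GenInv n k N F A R st) (hsub : st.1.toFinset ⊆ S)
    (hi : S.card ≤ i + st.1.length) :
    ∃ x < B ^ i, (CriticalSet.gen k N F B i x st).1.toFinset = S := by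
  induction i generalizing st with
  | zero =>
    refine ⟨0, by simp, Finset.eq_of_subset_of_card_le hsub ?_⟩
    change S.card ≤ st.1.toFinset.card
    rw [List.toFinset_card_of_nodup h.nodup]
    simpa using hi
  | succ i ih =>
    have hcard := List.toFinset_card_of_nodup h.nodup
    have hcl := h.cand_length
    by_cases heq : st.1.toFinset = S
    · have hnone : CriticalSet.pushDigit k N F (B - 1) st = st := by
        unfold CriticalSet.pushDigit
        rw [dif_neg (by omega)]
      obtain ⟨x, hx, hxS⟩ := ih h hsub (by rw [← heq, hcard]; omega)
      refine ⟨(B - 1) + B * x, ?_, ?_⟩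
      · calc B - 1 + B * x < B + B * x := by omega
          _ = B * (x + 1) := by ring
          _ ≤ B * B ^ i := Nat.mul_le_mul_left _ hx
          _ = B ^ (i + 1) := by ring
      · rw [CriticalSet.gen, Nat.add_mul_mod_self_left, Nat.mod_eq_of_lt (by omega),
          Nat.add_mul_div_left _ _ (by omega), Nat.div_eq_of_lt (by omega), hnone, zero_add]
        exact hxS
    -- Follow a path from a root to a missing vertex. The first missing vertex on it is a candidate,
    -- being the root itself or a neighbour of a member already chosen.
    · obtain ⟨c, hcS, hcst, hcand⟩ : ∃ c ∈ S, c ∉ st.1 ∧ c ∈ st.2 := by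
        obtain ⟨v, hvS, hv⟩ : ∃ v ∈ S, v ∉ st.1 := by
          by_contra! hcon
          exact heq (hsub.antisymm fun v hv => List.mem_toFinset.2 (hcon v hv))
        obtain ⟨r, hrR, hrB, hr⟩ := hreach v hvS fun h' => hv (h.pre.subset h')
        induction hr with
        | refl => exact ⟨r, hvS, hv, h.cand_pre.subset hrR⟩
        | @tail y z hry hyz ihy =>
          rw [Finset.mem_sdiff, Finset.mem_sdiff, List.mem_toFinset, List.mem_toFinset] at hyz
          by_cases hy : y ∈ st.1
          · exact ⟨z, hvS, hv, h.nbr y hy hyz.2.1.2 z hyz.1⟩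
          · exact ihy hyz.2.1.1 hy
      obtain ⟨d, hd, hdc⟩ := List.getElem_of_mem hcand
      have hlt : st.1.length < S.card := by
        rw [← hcard]
        refine Finset.card_lt_card ⟨hsub, fun h' => hcst ?_⟩
        exact List.mem_toFinset.1 (h' hcS)
      have hcl' := hlow c hcS fun h' => hcst (h.pre.subset h')
      have hpush : CriticalSet.pushDigit k N F d st = (st.1 ++ [c], st.2 ++ N c) := by
        unfold CriticalSet.pushDigit CriticalSet.push
        rw [dif_pos hd, hdc, if_pos ⟨hcst, hcl'.1, by omega, hcl'.2⟩]
      have hinv := h.pushDigit hN d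
      rw [hpush] at hinv
      obtain ⟨x, hx, hxS⟩ := ih hinv (by
        intro y hy
        simp only [List.mem_toFinset, List.mem_append, List.mem_singleton] at hy
        rcases hy with hy | rfl
        · exact hsub (List.mem_toFinset.2 hy)
        · exact hcS) (by simp only [List.length_append, List.length_singleton]; omega)
      refine ⟨d + B * x, ?_, ?_⟩
      · calc d + B * x < B + B * x := by omega
          _ = B * (x + 1) := by ring
          _ ≤ B * B ^ i := Nat.mul_le_mul_left _ hx
          _ = B ^ (i + 1) := by ring
      · rw [CriticalSet.gen, Nat.add_mul_mod_self_left, Nat.mod_eq_of_lt (by omega),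
          Nat.add_mul_div_left _ _ (by omega), Nat.div_eq_of_lt (by omega), hpush, zero_add]
        exact hxS

end

section

variable {n k : ℕ} {N : ℕ → List ℕ} {F : ℕ → ℕ}

/-! #### Codes -/

/-- The number of elements of `Z` below `v`. -/
def rank (Z : Finset ℕ) (v : ℕ) : ℕ := (Z.filter (· < v)).card

/-- The elements of `Z` carry consecutive powers of `b` as weights. -/
def weight (b : ℕ) (Z : Finset ℕ) (v : ℕ) : ℕ := if v ∈ Z then b ^ (1 + rank Z v) else 0

theorem rank_zero (Z : Finset ℕ) : rank Z 0 = 0 := by simp [rank]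

theorem rank_succ (Z : Finset ℕ) (v : ℕ) :
    rank Z (v + 1) = rank Z v + if v ∈ Z then 1 else 0 := by
  have h : Z.filter (· < v + 1) = Z.filter (· < v) ∪ Z.filter (· = v) := by
    ext x; simp only [Finset.mem_filter, Finset.mem_union]; grind
  rw [rank, rank, h, Finset.card_union_of_disjoint, Finset.filter_eq']
  · split_ifs <;> simp
  · rw [Finset.disjoint_left]; intro x; simp only [Finset.mem_filter]; omega

theorem rank_le_card (Z : Finset ℕ) (v : ℕ) : rank Z v ≤ Z.card :=
  Finset.card_le_card (Finset.filter_subset _ _)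

/-- Positional notation: the units digit is `s`, and each element of `Z` owns one further position.
Vertices outside `Z` have weight 0 and do not show. -/
theorem weight_sum_lt {b : ℕ} {Z : Finset ℕ} {s : ℕ} {e : ℕ → ℕ} (hs : s < b) (n : ℕ)
    (he : ∀ v < n, e v < b) :
    s + ∑ v ∈ Finset.range n, weight b Z v * e v < b ^ (1 + rank Z n) := by
  induction n with
  | zero => simpa [rank_zero] using hs
  | succ n ih =>
    have h := ih fun v hv => he v (by omega)
    rw [Finset.sum_range_succ, rank_succ]
    by_cases hn : n ∈ Z
    · rw [weight, if_pos hn, if_pos hn]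
      have := he n (by omega)
      calc s + (∑ v ∈ Finset.range n, weight b Z v * e v + b ^ (1 + rank Z n) * e n)
          < b ^ (1 + rank Z n) * (e n + 1) := by linarith
        _ ≤ b ^ (1 + rank Z n) * b := Nat.mul_le_mul_left _ this
        _ = _ := by ring
    · simpa [weight, hn] using h

/-- Uniqueness of base-`b` digits, splitting off the leading one by division with remainder. -/
theorem weight_sum_inj {b : ℕ} {Z : Finset ℕ} {s s' : ℕ} {e e' : ℕ → ℕ} (hs : s < b)
    (hs' : s' < b) (n : ℕ) (he : ∀ v < n, e v < b) (he' : ∀ v < n, e' v < b)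
    (h : s + ∑ v ∈ Finset.range n, weight b Z v * e v =
      s' + ∑ v ∈ Finset.range n, weight b Z v * e' v) :
    s = s' ∧ ∀ v < n, v ∈ Z → e v = e' v := by
  induction n with
  | zero => simpa using h
  | succ n ih =>
    have l := weight_sum_lt (Z := Z) hs n fun v hv => he v (by omega)
    have l' := weight_sum_lt (Z := Z) hs' n fun v hv => he' v (by omega)
    rw [Finset.sum_range_succ, Finset.sum_range_succ, ← add_assoc, ← add_assoc] at h
    by_cases hn : n ∈ Z
    · simp only [weight, if_pos hn] at h l l'
      have h₁ := congrArg (· / b ^ (1 + rank Z n)) h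
      have h₂ := congrArg (· % b ^ (1 + rank Z n)) h
      simp only [Nat.add_mul_div_left _ _ (Nat.zero_lt_of_lt l), Nat.div_eq_of_lt l,
        Nat.div_eq_of_lt l', zero_add] at h₁
      simp only [Nat.add_mul_mod_self_left, Nat.mod_eq_of_lt l, Nat.mod_eq_of_lt l'] at h₂
      obtain ⟨r₁, r₂⟩ := ih (fun v hv => he v (by omega)) (fun v hv => he' v (by omega)) h₂
      refine ⟨r₁, fun v hv hvZ => ?_⟩
      rcases Nat.lt_succ_iff_lt_or_eq.1 hv with hv | rfl
      · exact r₂ v hv hvZ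
      · exact h₁
    · simp only [weight, if_neg hn, zero_mul, add_zero] at h
      obtain ⟨r₁, r₂⟩ := ih (fun v hv => he v (by omega)) (fun v hv => he' v (by omega)) h
      refine ⟨r₁, fun v hv hvZ => ?_⟩
      rcases Nat.lt_succ_iff_lt_or_eq.1 hv with hv | rfl
      · exact r₂ v hv hvZ
      · exact absurd hvZ hn

/-- The contribution of the vertex `c` to the code of a set. -/
def vertexCode (k : ℕ) (N : ℕ → List ℕ) (wt : ℕ → ℕ) (c : ℕ) : ℕ :=
  1 + (k + 1) * wt c + ((N c).map wt).sum

/-- Double counting along the symmetric adjacency: the weight of `v` is added once for each member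
of `C` having `v` in its list, that is, `cnt N C v` times. Hence a sum computed from the lists of
`C` alone records the effect of `C` on every vertex of positive weight. -/
theorem sum_vertexCode (hN : IsNet n N) (wt : ℕ → ℕ) {C : Finset ℕ} (hC : ∀ c ∈ C, c < n) :
    ∑ c ∈ C, vertexCode k N wt c =
      C.card + ∑ v ∈ Finset.range n, wt v * ((k + 1) * (if v ∈ C then 1 else 0) + cnt N C v) := by
  have hfil : (Finset.range n).filter (· ∈ C) = C := by
    ext x; simp only [Finset.mem_filter, Finset.mem_range]
    exact ⟨fun h => h.2, fun h => ⟨hC x h, h⟩⟩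
  have h₁ : ∑ c ∈ C, (k + 1) * wt c =
      ∑ v ∈ Finset.range n, wt v * ((k + 1) * if v ∈ C then 1 else 0) := by
    conv_lhs => rw [← hfil]
    rw [Finset.sum_filter]
    exact Finset.sum_congr rfl fun x _ => by split_ifs <;> ring
  have h₂ : ∑ c ∈ C, ((N c).map wt).sum = ∑ v ∈ Finset.range n, wt v * cnt N C v := by
    calc ∑ c ∈ C, ((N c).map wt).sum = ∑ c ∈ C, ∑ v ∈ (N c).toFinset, wt v :=
          Finset.sum_congr rfl fun c hc => (List.sum_toFinset wt (hN.nodup c (hC c hc))).symm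
      _ = ∑ v ∈ Finset.range n, ∑ _c ∈ (N v).toFinset ∩ C, wt v := by
          refine Finset.sum_comm' fun c v => ?_
          simp only [List.mem_toFinset, Finset.mem_inter, Finset.mem_range]
          constructor
          · rintro ⟨hc, hv⟩
            exact ⟨⟨hN.symm _ (hN.lt c (hC c hc) v hv) _ (hC c hc) hv, hc⟩,
              hN.lt c (hC c hc) v hv⟩
          · rintro ⟨⟨hv, hc⟩, hn⟩
            exact ⟨hc, hN.symm _ (hC c hc) _ hn hv⟩
      _ = _ := by
          refine Finset.sum_congr rfl fun v _ => ?_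
          rw [Finset.sum_const, smul_eq_mul, mul_comm, cnt]
  simp only [vertexCode, Finset.sum_add_distrib, mul_add, h₁, h₂]
  simp [add_assoc]

/-- A digit is at most `(k + 1) + k`, which is why the base is `2k + 2`. -/
theorem cnt_digit_lt {C : Finset ℕ} (hC : C.card ≤ k) (v : ℕ) :
    (k + 1) * (if v ∈ C then 1 else 0) + cnt N C v < 2 * k + 2 := by
  have := cnt_le_card (N := N) C v
  split_ifs <;> omega

/-! #### Exchange -/

/-- Exchange of a part `C` of a critical set, closed under adjacency, for an equivalent part. -/
theorem Crit.exchange (hN : IsNet n N) {S C C' : Finset ℕ} (h : Crit n N F S)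
    (hSn : ∀ v ∈ S, v < n) (hCS : C ⊆ S)
    (hA : (heavy n k F).toFinset ⊆ S \ C)
    (hC : ∀ u ∈ C, ∀ v ∈ S, v ∉ heavy n k F → v ∈ N u → v ∈ C)
    (hdisj : Disjoint C' S)
    (hC' : ∀ c ∈ C', (N c).length - cnt N ((heavy n k F).toFinset ∪ C') c < F c)
    (hmem : ∀ v < n, v ∈ critZone n k N F → v ∈ C → v ∈ C')
    (hcnt : ∀ v < n, v ∈ critZone n k N F → cnt N C v = cnt N C' v) :
    Crit n N F (S \ C ∪ C') := by
  have hd : Disjoint (S \ C) C' := (hdisj.mono_right Finset.sdiff_subset).symm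
  have hS : ∀ v, cnt N S v = cnt N (S \ C) v + cnt N C v := fun v => by
    conv_lhs => rw [← Finset.sdiff_union_of_subset hCS]
    exact cnt_union Finset.sdiff_disjoint v
  have hS' : ∀ v, cnt N (S \ C ∪ C') v = cnt N (S \ C) v + cnt N C' v := cnt_union hd
  intro v hv
  constructor
  · intro hvS
    rcases Finset.mem_union.1 hvS with hvS | hvC
    · have hvS' := (Finset.mem_sdiff.1 hvS).1
      have hvC := (Finset.mem_sdiff.1 hvS).2
      have h₁ := (h v hv).1 hvS'
      have h₂ := hS v
      have h₃ := hS' v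
      -- A heavy vertex lies in the zone, where `C` and `C'` give equal counts. A remaining
      -- non-heavy member is not adjacent to `C`, so it loses nothing.
      by_cases hvA : v ∈ heavy n k F
      · have := hcnt v hv (by simp [critZone, hv, hvA])
        omega
      · have : cnt N C v = 0 := by
          rw [cnt, Finset.card_eq_zero, Finset.eq_empty_iff_forall_notMem]
          intro u hu
          rw [Finset.mem_inter, List.mem_toFinset] at hu
          exact hvC (hC u hu.2 v hvS' hvA (hN.symm _ (hSn u (hCS hu.2)) _ hv hu.1))
        omega
    · have h₁ := hC' v hvC
      have h₂ : cnt N ((heavy n k F).toFinset ∪ C') v ≤ cnt N (S \ C ∪ C') v :=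
        cnt_mono (Finset.union_subset_union_left hA) v
      omega
  · intro hvS
    rw [Finset.mem_union, Finset.mem_sdiff, not_or, not_and, not_not] at hvS
    refine ⟨h.one_le hv, ?_⟩
    -- Inside the zone `v` was already outside `S`, since `C'` keeps the trace of `C`, and its count
    -- is unchanged. Outside the zone the heavy vertices suffice.
    by_cases hz : v ∈ critZone n k N F
    · have hvC : v ∉ C := fun h' => hvS.2 (hmem v hv hz h')
      have h₁ := ((h v hv).2 fun h' => hvC (hvS.1 h')).2
      have h₂ := hS v
      have h₃ := hS' v
      have := hcnt v hv hz
      omega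
    · have h₁ : ¬ cnt N (heavy n k F).toFinset v < F v := fun h' =>
        hz (by simp [critZone, hv, h'])
      have h₂ : cnt N (heavy n k F).toFinset v ≤ cnt N (S \ C ∪ C') v :=
        cnt_mono (hA.trans Finset.subset_union_left) v
      omega

theorem mem_drop_iff {A S : List ℕ} (hS : S.Nodup) (hA : A <+: S) {c : ℕ} :
    c ∈ S.drop A.length ↔ c ∈ S.toFinset \ A.toFinset := by
  obtain ⟨T, rfl⟩ := hA
  rw [List.drop_left]
  have := List.disjoint_of_nodup_append hS
  simp only [Finset.mem_sdiff, List.mem_toFinset, List.mem_append]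
  constructor
  · exact fun h => ⟨.inr h, fun h' => this h' h⟩
  · tauto

theorem sum_map_drop {A S : List ℕ} (hS : S.Nodup) (hA : A <+: S) (g : ℕ → ℕ) :
    ((S.drop A.length).map g).sum = ∑ c ∈ S.toFinset \ A.toFinset, g c := by
  rw [← List.sum_toFinset g (hS.sublist (List.drop_sublist _ _))]
  refine Finset.sum_congr ?_ fun _ _ => rfl
  ext c
  rw [List.mem_toFinset, mem_drop_iff hS hA]

/-! #### Representative roots -/

/-- Base of the digits for one root. -/
def rootBase (k : ℕ) : ℕ := 2 * k * k + 2

/-- Number of digit sequences for one root. -/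
def rootSeqs (k : ℕ) : ℕ := rootBase k ^ k

/-- Number of roots to keep for one code. -/
def rootCap (k : ℕ) : ℕ := k * k * rootSeqs k + 1

/-- Upper bound for the codes. -/
def codeBound (k : ℕ) : ℕ := (2 * k + 2) ^ (2 * k * (k + 1) + 1)

/-- The weights used for the codes. -/
def zoneWeight (n k : ℕ) (N : ℕ → List ℕ) (F : ℕ → ℕ) : ℕ → ℕ :=
  weight (2 * k + 2) (critZone n k N F)

/-- The set generated by the root `w` and the digits of `x`. -/
def rootSet (n k : ℕ) (N : ℕ → List ℕ) (F : ℕ → ℕ) (w x : ℕ) : List ℕ :=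
  (gen k N F (rootBase k) k x (heavy n k F, [w])).1

/-- The set `S` meets the demands of its members that are not heavy. -/
def LocallyOK (n k : ℕ) (N : ℕ → List ℕ) (F : ℕ → ℕ) (S : List ℕ) : Prop :=
  ∀ c ∈ S.drop (heavy n k F).length, (N c).length - cnt N S.toFinset c < F c

/-- The code of the members of `S` that are not heavy. -/
def setCode (n k : ℕ) (N : ℕ → List ℕ) (F : ℕ → ℕ) (S : List ℕ) : ℕ :=
  ((S.drop (heavy n k F).length).map (vertexCode k N (zoneWeight n k N F))).sum

/-- The root `w` generates a locally admissible set with code `τ`. -/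
def Hit (n k : ℕ) (N : ℕ → List ℕ) (F : ℕ → ℕ) (τ w : ℕ) : Prop :=
  ∃ x < rootSeqs k, LocallyOK n k N F (rootSet n k N F w x) ∧
    setCode n k N F (rootSet n k N F w x) = τ

open Classical in
/-- The representative roots for the code `τ`. -/
noncomputable def rootsOf (n k : ℕ) (N : ℕ → List ℕ) (F : ℕ → ℕ) (τ : ℕ) : List ℕ :=
  ((List.range n).filter fun w => Hit n k N F τ w).take (rootCap k)

/-- The representative roots for the codes below `m`. -/
noncomputable def rootsBelow (n k : ℕ) (N : ℕ → List ℕ) (F : ℕ → ℕ) (m : ℕ) : List ℕ :=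
  (List.range m).flatMap (rootsOf n k N F)

/-- The representative roots. -/
noncomputable def roots (n k : ℕ) (N : ℕ → List ℕ) (F : ℕ → ℕ) : List ℕ :=
  rootsBelow n k N F (codeBound k)

theorem rootsBelow_succ (m : ℕ) :
    rootsBelow n k N F (m + 1) = rootsBelow n k N F m ++ rootsOf n k N F m := by
  simp [rootsBelow, List.range_succ]

theorem length_rootsBelow (m : ℕ) : (rootsBelow n k N F m).length ≤ m * rootCap k := by
  induction m with
  | zero => simp [rootsBelow]
  | succ m ih =>
    rw [rootsBelow_succ, List.length_append, add_mul, one_mul]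
    exact Nat.add_le_add ih (List.length_take_le _ _)

theorem lt_of_mem_rootsOf {τ w : ℕ} (h : w ∈ rootsOf n k N F τ) : w < n ∧ Hit n k N F τ w := by
  have := List.mem_of_mem_take h
  simpa using this

theorem lt_of_mem_rootsBelow {m w : ℕ} (h : w ∈ rootsBelow n k N F m) : w < n := by
  obtain ⟨τ, _, h⟩ := List.mem_flatMap.1 h
  exact (lt_of_mem_rootsOf h).1

variable (F) in
theorem rootSet_inv (hN : IsNet n N) (hA : (heavy n k F).length ≤ k) {w : ℕ} (hw : w < n)
    (x : ℕ) : GenInv n k N F (heavy n k F) [w]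
      (gen k N F (rootBase k) k x (heavy n k F, [w])) :=
  (GenInv.init nodup_heavy hA (fun _ hc => (mem_heavy.1 hc).1) (by simpa using hw)).gen hN k x

/-- Connected sets of low vertices are generated by each of their elements. -/
theorem exists_rootSet (hN : IsNet n N) {C : Finset ℕ} {w : ℕ} (hw : w ∈ C)
    (hn : ∀ v ∈ C, v < n) (hlow : ∀ v ∈ C, Low k N F v) (hA : ∀ v ∈ C, v ∉ heavy n k F)
    (hk : (heavy n k F).length + C.card ≤ k) (hreach : ∀ v ∈ C, Reach N C w v) :
    ∃ x < rootSeqs k, (rootSet n k N F w x).toFinset = (heavy n k F).toFinset ∪ C := by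
  have hC : ((heavy n k F).toFinset ∪ C) \ (heavy n k F).toFinset = C := by
    ext v
    have := hA v
    simp only [Finset.mem_sdiff, Finset.mem_union, List.mem_toFinset]
    tauto
  have hcard := Finset.card_union_le (heavy n k F).toFinset C
  rw [List.toFinset_card_of_nodup nodup_heavy] at hcard
  -- There is one root and there are at most `2k * k` further candidates. A base above `2k * k + 1`
  -- leaves a padding digit, whence `rootBase`.
  refine GenInv.exists_gen (R := [w]) (A := heavy n k F) hN (by simp [rootBase]; omega)
    (hcard.trans hk) ?_ ?_ k
    (.init nodup_heavy (by omega) (fun _ hc => (mem_heavy.1 hc).1) (by simpa using hn w hw))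
    Finset.subset_union_left (by simp only; omega)
  · intro v hv hvA
    exact hlow v ((Finset.mem_union.1 hv).resolve_left fun h => hvA (List.mem_toFinset.1 h))
  · intro v hv hvA
    rw [hC]
    exact ⟨w, by simp, hw,
      hreach v ((Finset.mem_union.1 hv).resolve_left fun h => hvA (List.mem_toFinset.1 h))⟩

end

/-! ### Pieces, their codes, and the exchange of components without a kept root. -/

section

variable {n k : ℕ} {N : ℕ → List ℕ} {F : ℕ → ℕ}

/-- A connected set of low vertices around `w` that meets the demands of its members. -/
structure Piece (n k : ℕ) (N : ℕ → List ℕ) (F : ℕ → ℕ) (w : ℕ) (C : Finset ℕ) : Prop where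
  lt : ∀ c ∈ C, c < n
  low : ∀ c ∈ C, Low k N F c
  notMem : ∀ c ∈ C, c ∉ heavy n k F
  card : (heavy n k F).length + C.card ≤ k
  reach : ∀ c ∈ C, Reach N C w c
  ok : ∀ c ∈ C, (N c).length - cnt N ((heavy n k F).toFinset ∪ C) c < F c

theorem union_sdiff_heavy {C : Finset ℕ} (h : ∀ c ∈ C, c ∉ heavy n k F) :
    ((heavy n k F).toFinset ∪ C) \ (heavy n k F).toFinset = C := by
  ext v
  have := h v
  simp only [Finset.mem_sdiff, Finset.mem_union, List.mem_toFinset]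
  tauto

/-- This turns the test run by the machine into a statement about connected sets. Positivity of `τ`
excludes the empty set, which has code 0 and is generated from every root by padding digits. -/
theorem hit_iff (hN : IsNet n N) (hA : (heavy n k F).length ≤ k) {w : ℕ} (hw : w < n) {τ : ℕ}
    (hτ : 0 < τ) :
    Hit n k N F τ w ↔ ∃ C, w ∈ C ∧ Piece n k N F w C ∧
      ∑ c ∈ C, vertexCode k N (zoneWeight n k N F) c = τ := by
  constructor
  · rintro ⟨x, _, hok, hcode⟩
    have hinv := rootSet_inv F hN hA hw x
    change GenInv n k N F (heavy n k F) [w] (rootSet n k N F w x, _) at hinv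
    set S := rootSet n k N F w x
    rw [setCode, sum_map_drop hinv.nodup hinv.pre] at hcode
    have hU : (heavy n k F).toFinset ∪ (S.toFinset \ (heavy n k F).toFinset) = S.toFinset :=
      Finset.union_sdiff_of_subset fun a ha => by
        rw [List.mem_toFinset] at ha ⊢
        exact hinv.pre.subset ha
    have hroot : ∀ c ∈ S.toFinset \ (heavy n k F).toFinset,
        w ∈ S.toFinset \ (heavy n k F).toFinset ∧
          Reach N (S.toFinset \ (heavy n k F).toFinset) w c := by
      intro c hc
      simp only [Finset.mem_sdiff, List.mem_toFinset] at hc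
      obtain ⟨r, hr, h₁, h₂⟩ := hinv.conn c hc.1 hc.2
      rw [List.mem_singleton] at hr
      exact hr ▸ ⟨h₁, h₂⟩
    refine ⟨S.toFinset \ (heavy n k F).toFinset, ?_, ⟨?_, ?_, ?_, ?_,
      fun c hc => (hroot c hc).2, ?_⟩, hcode⟩
    · obtain ⟨c, hc⟩ : (S.toFinset \ (heavy n k F).toFinset).Nonempty := by
        by_contra h
        rw [Finset.not_nonempty_iff_eq_empty] at h
        rw [h, Finset.sum_empty] at hcode
        omega
      exact (hroot c hc).1
    · intro c hc
      simp only [Finset.mem_sdiff, List.mem_toFinset] at hc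
      exact hinv.lt c hc.1
    · intro c hc
      simp only [Finset.mem_sdiff, List.mem_toFinset] at hc
      exact hinv.low c hc.1 hc.2
    · intro c hc
      simp only [Finset.mem_sdiff, List.mem_toFinset] at hc
      exact hc.2
    · rw [← List.toFinset_card_of_nodup (nodup_heavy (n := n) (k := k) (F := F)),
        ← Finset.card_union_of_disjoint Finset.disjoint_sdiff, hU,
        List.toFinset_card_of_nodup hinv.nodup]
      exact hinv.len
    · intro c hc
      rw [hU]
      exact hok c ((mem_drop_iff hinv.nodup hinv.pre).2 hc)
  · rintro ⟨C, hwC, hC, hcode⟩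
    obtain ⟨x, hx, hS⟩ := exists_rootSet hN hwC hC.lt hC.low hC.notMem hC.card hC.reach
    have hinv := rootSet_inv F hN hA hw x
    change GenInv n k N F (heavy n k F) [w] (rootSet n k N F w x, _) at hinv
    refine ⟨x, hx, fun c hc => ?_, ?_⟩
    · rw [mem_drop_iff hinv.nodup hinv.pre, hS, union_sdiff_heavy hC.notMem] at hc
      rw [hS]
      exact hC.ok c hc
    · rw [setCode, sum_map_drop hinv.nodup hinv.pre, hS, union_sdiff_heavy hC.notMem]
      exact hcode

theorem Piece.code_lt (hN : IsNet n N) (hZ : (critZone n k N F).card ≤ 2 * k * (k + 1)) {w : ℕ}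
    {C : Finset ℕ} (h : Piece n k N F w C) :
    ∑ c ∈ C, vertexCode k N (zoneWeight n k N F) c < codeBound k := by
  have hc : C.card ≤ k := by have := h.card; omega
  rw [sum_vertexCode hN _ h.lt]
  refine (weight_sum_lt (by omega) n fun v _ => cnt_digit_lt hc v).trans_le ?_
  refine Nat.pow_le_pow_right (by omega) ?_
  have := rank_le_card (critZone n k N F) n
  omega

/-- Equal codes have equal digits. The units digit is the size. Since counts are at most `k`, a
digit reaches `k + 1` exactly when `v` belongs to the set, so membership and count can both be
recovered. -/
theorem Piece.eq_of_code_eq (hN : IsNet n N) {w w' : ℕ} {C C' : Finset ℕ}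
    (h : Piece n k N F w C) (h' : Piece n k N F w' C')
    (heq : ∑ c ∈ C, vertexCode k N (zoneWeight n k N F) c =
      ∑ c ∈ C', vertexCode k N (zoneWeight n k N F) c) :
    C.card = C'.card ∧ ∀ v < n, v ∈ critZone n k N F →
      (v ∈ C ↔ v ∈ C') ∧ cnt N C v = cnt N C' v := by
  have hc : C.card ≤ k := by have := h.card; omega
  have hc' : C'.card ≤ k := by have := h'.card; omega
  rw [sum_vertexCode hN _ h.lt, sum_vertexCode hN _ h'.lt] at heq
  obtain ⟨h₁, h₂⟩ := weight_sum_inj (by omega) (by omega) n (fun v _ => cnt_digit_lt hc v)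
    (fun v _ => cnt_digit_lt hc' v) heq
  refine ⟨h₁, fun v hv hvZ => ?_⟩
  have h₃ := h₂ v hv hvZ
  have h₄ := (cnt_le_card (N := N) C v).trans hc
  have h₅ := (cnt_le_card (N := N) C' v).trans hc'
  by_cases m : v ∈ C <;> by_cases m' : v ∈ C' <;> simp only [m, m', if_true, if_false] at h₃ <;>
    simp only [m, m', true_and, iff_self, iff_false, not_true, iff_true, false_and] <;> omega

/-- The pieces that meet a small set `B` have few roots. -/
theorem card_roots_le (hN : IsNet n N) {B : Finset ℕ} (hB : B.card ≤ k) (T : Finset ℕ)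
    (hT : ∀ w ∈ T, ∃ C, w ∈ C ∧ Piece n k N F w C ∧ ∃ y ∈ B, y ∈ C) :
    T.card ≤ k * k * rootSeqs k := by
  -- At most `k` choices of `y`, `rootSeqs k` digit sequences, and at most `k` members in each
  -- generated set. The constant filter carries the length bound needed for the last factor.
  have hsub : T ⊆ B.biUnion fun y => (Finset.range (rootSeqs k)).biUnion fun x =>
      ((rootSet n k N F y x).drop (heavy n k F).length).toFinset.filter
        (fun _ => (rootSet n k N F y x).length ≤ k) := by
    intro w hw
    obtain ⟨C, hwC, hC, y, hyB, hyC⟩ := hT w hw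
    have hA : (heavy n k F).length ≤ k := by have := hC.card; omega
    -- Connectedness is symmetric, so the piece can be regenerated from the vertex `y` it shares
    -- with `B`.
    obtain ⟨x, hx, hS⟩ := exists_rootSet (w := y) hN hyC hC.lt hC.low hC.notMem hC.card
      fun v hv => ((hC.reach y hyC).symm hN hC.lt).trans (hC.reach v hv)
    have hinv := rootSet_inv F hN hA (hC.lt y hyC) x
    change GenInv n k N F (heavy n k F) [y] (rootSet n k N F y x, _) at hinv
    simp only [Finset.mem_biUnion, Finset.mem_range, Finset.mem_filter, List.mem_toFinset]
    refine ⟨y, hyB, x, hx, ?_, hinv.len⟩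
    rw [mem_drop_iff hinv.nodup hinv.pre, hS, union_sdiff_heavy hC.notMem]
    exact hwC
  refine (Finset.card_le_card hsub).trans ?_
  calc _ ≤ B.card * (rootSeqs k * k) := by
        refine Finset.card_biUnion_le_card_mul _ _ _ fun y _ => ?_
        refine (Finset.card_biUnion_le_card_mul _ _ k fun x _ => ?_).trans_eq (by simp)
        rw [Finset.filter_const]
        split_ifs with h
        · refine (List.toFinset_card_le _).trans ?_
          rw [List.length_drop]
          omega
        · simp
    _ ≤ k * (rootSeqs k * k) := Nat.mul_le_mul_right _ hB
    _ = _ := by ring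

/-- A representative root of the code of a piece whose root was not kept. -/
theorem exists_root_disjoint (hN : IsNet n N) (hA : (heavy n k F).length ≤ k) {b τ : ℕ}
    (hb : b < n) (hhit : Hit n k N F τ b) (hτ : 0 < τ) (hnot : b ∉ rootsOf n k N F τ)
    {B : Finset ℕ} (hB : B.card ≤ k) :
    ∃ w ∈ rootsOf n k N F τ, ∃ C, w ∈ C ∧ Piece n k N F w C ∧
      ∑ c ∈ C, vertexCode k N (zoneWeight n k N F) c = τ ∧ Disjoint C B := by
  classical
  -- A hit is missing only if the list was truncated, so the list has its full length. This exceeds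
  -- by one the number of roots whose pieces can meet `B`.
  have hlen : (rootsOf n k N F τ).length = rootCap k := by
    rw [rootsOf] at hnot ⊢
    rw [List.length_take, min_eq_left]
    by_contra hlt
    refine hnot ?_
    rw [List.take_of_length_le (by omega)]
    simp [hb, hhit]
  have hnd : (rootsOf n k N F τ).Nodup :=
    (List.nodup_range.filter _).sublist (List.take_sublist _ _)
  by_contra! hcon
  have := card_roots_le (n := n) (F := F) hN hB (rootsOf n k N F τ).toFinset fun w hw => by
    rw [List.mem_toFinset] at hw
    obtain ⟨hwn, hw'⟩ := lt_of_mem_rootsOf hw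
    obtain ⟨C, hwC, hC, hcode⟩ := (hit_iff hN hA hwn hτ).1 hw'
    have hd := hcon w hw C hwC hC hcode
    rw [Finset.not_disjoint_iff] at hd
    obtain ⟨y, hyC, hyB⟩ := hd
    exact ⟨C, hwC, hC, y, hyB, hyC⟩
  rw [List.toFinset_card_of_nodup hnd, hlen, rootCap] at this
  omega

open Classical in
/-- The members of `S` that are not reachable from a representative root. -/
noncomputable def stray (n k : ℕ) (N : ℕ → List ℕ) (F : ℕ → ℕ) (S : Finset ℕ) : Finset ℕ :=
  (S \ (heavy n k F).toFinset).filter fun b =>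
    ¬ ∃ r ∈ roots n k N F, r ∈ S \ (heavy n k F).toFinset ∧
      Reach N (S \ (heavy n k F).toFinset) r b

/-- A path inside `B` cannot leave `C` once it has entered, so a path ending outside `C` never meets
it. -/
theorem Reach.avoid {B C : Finset ℕ}
    (hC : ∀ u ∈ C, ∀ v ∈ B, v ∈ N u → v ∈ C) {r b : ℕ} (h : Reach N B r b) (hb : b ∉ C) :
    r ∉ C ∧ Reach N (B \ C) r b := by
  induction h with
  | refl => exact ⟨hb, .refl⟩
  | @tail y z _ hyz ih =>
    have hy : y ∉ C := fun hy => hb (hC y hy z hyz.2.2 hyz.1)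
    exact ⟨(ih hy).1, (ih hy).2.tail ⟨hyz.1, Finset.mem_sdiff.2 ⟨hyz.2.1, hy⟩,
      Finset.mem_sdiff.2 ⟨hyz.2.2, hb⟩⟩⟩

/-- The component of a stray vertex is exchanged for a piece with the same code around a kept root.
The new piece contains no stray vertex, and the other components are unharmed. -/
theorem Crit.exists_stray_lt (hN : IsNet n N) {S : Finset ℕ} (h : Crit n N F S)
    (hk : S.card ≤ k) (hSn : ∀ v ∈ S, v < n) (hne : (stray n k N F S).Nonempty) :
    ∃ S', Crit n N F S' ∧ S'.card ≤ k ∧ (∀ v ∈ S', v < n) ∧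
      (stray n k N F S').card < (stray n k N F S).card := by
  classical
  obtain ⟨b, hb⟩ := hne
  set A := (heavy n k F).toFinset with hAdef
  set B := S \ A with hBdef
  have hmemB : ∀ {v}, v ∈ B ↔ v ∈ S ∧ v ∉ heavy n k F := by
    intro v; simp [hBdef, hAdef]
  simp only [stray, Finset.mem_filter] at hb
  obtain ⟨hbB, hbad⟩ := hb
  have hAS : A ⊆ S := h.heavy_subset hk
  have hBn : ∀ v ∈ B, v < n := fun v hv => hSn v (hmemB.1 hv).1
  have hcardA : A.card = (heavy n k F).length := List.toFinset_card_of_nodup nodup_heavy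
  have hcardB : A.card + B.card = S.card := by
    rw [hBdef, add_comm, Finset.card_sdiff_add_card_eq_card hAS]
  have hA : (heavy n k F).length ≤ k := by omega
  set C := B.filter (Reach N B b) with hCdef
  have hCB : C ⊆ B := Finset.filter_subset _ _
  have hCclosed : ∀ u ∈ C, ∀ v ∈ B, v ∈ N u → v ∈ C := by
    intro u hu v hv huv
    rw [hCdef, Finset.mem_filter] at hu ⊢
    exact ⟨hv, Relation.ReflTransGen.tail hu.2 ⟨huv, hu.1, hv⟩⟩
  have hbC : b ∈ C := Finset.mem_filter.2 ⟨hbB, .refl⟩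
  have hCreach : ∀ c ∈ C, Reach N C b c := by
    intro c hc
    have hr := (Finset.mem_filter.1 hc).2
    clear_value C
    induction hr with
    | refl => exact .refl
    | @tail y z hy hyz ih =>
      have hyC : y ∈ C := by
        rw [hCdef, Finset.mem_filter]
        exact ⟨hyz.2.1, hy⟩
      exact (ih hyC).tail ⟨hyz.1, hyC, hc⟩
  have hcardC := Finset.card_le_card hCB
  have hpiece : Piece n k N F b C :=
    { lt := fun c hc => hBn c (hCB hc)
      low := fun c hc => h.low hk (hBn c (hCB hc)) (hmemB.1 (hCB hc)).1 (hmemB.1 (hCB hc)).2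
      notMem := fun c hc => (hmemB.1 (hCB hc)).2
      card := by omega
      reach := hCreach
      ok := by
        intro c hc
        have h₁ := (h c (hBn c (hCB hc))).1 (hmemB.1 (hCB hc)).1
        have h₂ : cnt N S c ≤ cnt N (A ∪ C) c := by
          refine Finset.card_le_card fun u hu => ?_
          rw [Finset.mem_inter] at hu ⊢
          refine ⟨hu.1, ?_⟩
          by_cases huA : u ∈ A
          · exact Finset.mem_union_left _ huA
          · exact Finset.mem_union_right _ (hCclosed c hc u (Finset.mem_sdiff.2 ⟨hu.2, huA⟩)
              (List.mem_toFinset.1 hu.1))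
        change (N c).length - cnt N (A ∪ C) c < F c
        omega }
  set τ := ∑ c ∈ C, vertexCode k N (zoneWeight n k N F) c with hτ
  have hτpos : 0 < τ := by
    refine Finset.sum_pos (fun c _ => ?_) ⟨b, hbC⟩
    rw [vertexCode]; omega
  have hτlt : τ < codeBound k := hpiece.code_lt hN (h.card_zone hN hk hSn)
  have hroots : ∀ r ∈ rootsOf n k N F τ, r ∈ roots n k N F := fun r hr =>
    List.mem_flatMap.2 ⟨τ, List.mem_range.2 hτlt, hr⟩
  -- `b` was not kept as a root for `τ`, since otherwise it would reach itself from a kept root and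
  -- not be stray.
  obtain ⟨w, hw, C', hwC', hC', hcode, hdisj⟩ := exists_root_disjoint hN hA (hBn b hbB)
    ((hit_iff hN hA (hBn b hbB) hτpos).2 ⟨C, hbC, hpiece, hτ.symm⟩) hτpos
    (fun hbR => hbad ⟨b, hroots b hbR, hbB, .refl⟩) hk
  obtain ⟨hcc, hzone⟩ := hpiece.eq_of_code_eq hN hC' (hτ.symm.trans hcode.symm)
  have hCS : C ⊆ S := hCB.trans Finset.sdiff_subset
  have hAC : Disjoint A C := by
    rw [Finset.disjoint_left]
    intro a ha hc
    exact (hmemB.1 (hCB hc)).2 (List.mem_toFinset.1 ha)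
  refine ⟨S \ C ∪ C', ?_, ?_, ?_, ?_⟩
  · refine h.exchange hN hSn hCS (fun a ha => Finset.mem_sdiff.2
      ⟨hAS ha, Finset.disjoint_left.1 hAC ha⟩) ?_ hdisj hC'.ok
      (fun v hv hz => (hzone v hv hz).1.1) (fun v hv hz => (hzone v hv hz).2)
    exact fun u hu v hvS hvA huv => hCclosed u hu v (hmemB.2 ⟨hvS, hvA⟩) huv
  · have h₁ := Finset.card_union_le (S \ C) C'
    have h₂ := Finset.card_sdiff_add_card_eq_card hCS
    omega
  · intro v hv
    rcases Finset.mem_union.1 hv with hv | hv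
    · exact hSn v (Finset.mem_sdiff.1 hv).1
    · exact hC'.lt v hv
  · have hB' : (S \ C ∪ C') \ A = B \ C ∪ C' := by
      ext v
      have := hC'.notMem v
      simp only [Finset.mem_sdiff, Finset.mem_union, hBdef, hAdef, List.mem_toFinset]
      tauto
    -- The stray set strictly shrinks: old vertices keep their paths, which avoid `C`. All vertices
    -- of `C'` are reached from the kept root `w`. The vertex `b` itself is gone.
    refine Finset.card_lt_card (Finset.ssubset_iff_subset_ne.2 ⟨?_, ?_⟩)
    · intro v hv
      simp only [stray, Finset.mem_filter, ← hAdef, hB', ← hBdef] at hv ⊢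
      obtain ⟨hv, hno⟩ := hv
      rcases Finset.mem_union.1 hv with hv | hv
      · refine ⟨(Finset.mem_sdiff.1 hv).1, ?_⟩
        rintro ⟨r, hr, hrB, hrv⟩
        obtain ⟨hrC, hrv'⟩ := Reach.avoid hCclosed hrv (Finset.mem_sdiff.1 hv).2
        exact hno ⟨r, hr, Finset.mem_union_left _ (Finset.mem_sdiff.2 ⟨hrB, hrC⟩),
          hrv'.mono Finset.subset_union_left⟩
      · exact absurd ⟨w, hroots w hw, Finset.mem_union_right _ hwC',
          (hC'.reach v hv).mono Finset.subset_union_right⟩ hno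
    · intro heq
      have hbs : b ∈ stray n k N F S := by
        simp only [stray, Finset.mem_filter]
        exact ⟨hbB, hbad⟩
      rw [← heq] at hbs
      simp only [stray, Finset.mem_filter, ← hAdef, hB'] at hbs
      obtain ⟨hv, -⟩ := hbs
      rcases Finset.mem_union.1 hv with hv | hv
      · exact (Finset.mem_sdiff.1 hv).2 hbC
      · exact Finset.disjoint_left.1 hdisj hv (hCS hbC)

theorem Crit.exists_stray_empty (hN : IsNet n N) {S : Finset ℕ} (h : Crit n N F S)
    (hk : S.card ≤ k) (hSn : ∀ v ∈ S, v < n) :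
    ∃ S', Crit n N F S' ∧ S'.card ≤ k ∧ (∀ v ∈ S', v < n) ∧ stray n k N F S' = ∅ := by
  induction hm : (stray n k N F S).card using Nat.strong_induction_on generalizing S with
  | _ m ih =>
    rcases (stray n k N F S).eq_empty_or_nonempty with he | hne
    · exact ⟨S, h, hk, hSn, he⟩
    · obtain ⟨S', h', hk', hn', hlt⟩ := h.exists_stray_lt hN hk hSn hne
      exact ih _ (hm ▸ hlt) h' hk' hn' rfl

/-- Base of the digits for the representative roots. -/
noncomputable def fullBase (n k : ℕ) (N : ℕ → List ℕ) (F : ℕ → ℕ) : ℕ :=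
  (roots n k N F).length + (2 * k * k + 1)

/-- The set generated by the representative roots and the digits of `x`. -/
noncomputable def fullSet (n k : ℕ) (N : ℕ → List ℕ) (F : ℕ → ℕ) (x : ℕ) : List ℕ :=
  (gen k N F (fullBase n k N F) k x (heavy n k F, roots n k N F)).1

theorem fullSet_inv (hN : IsNet n N) (hA : (heavy n k F).length ≤ k) (x : ℕ) :
    GenInv n k N F (heavy n k F) (roots n k N F)
      (gen k N F (fullBase n k N F) k x (heavy n k F, roots n k N F)) :=
  (GenInv.init nodup_heavy hA (fun _ hc => (mem_heavy.1 hc).1)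
    fun _ hc => lt_of_mem_rootsBelow hc).gen hN k x

/-- Correctness of the exhaustive search. -/
theorem exists_crit_iff (hN : IsNet n N) :
    (∃ S : Finset ℕ, Crit n N F S ∧ S.card ≤ k ∧ ∀ v ∈ S, v < n) ↔
      (heavy n k F).length ≤ k ∧ (critZone n k N F).card ≤ 2 * k * (k + 1) ∧
      ∃ x < fullBase n k N F ^ k, Crit n N F (fullSet n k N F x).toFinset := by
  classical
  constructor
  · rintro ⟨S₀, h₀, hk₀, hn₀⟩
    obtain ⟨S, h, hk, hn, hstray⟩ := h₀.exists_stray_empty hN hk₀ hn₀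
    have hAS := h.heavy_subset hk
    have hA : (heavy n k F).length ≤ k := by
      rw [← List.toFinset_card_of_nodup nodup_heavy]
      exact (Finset.card_le_card hAS).trans hk
    refine ⟨hA, h.card_zone hN hk hn, ?_⟩
    have hinit : GenInv n k N F (heavy n k F) (roots n k N F) (heavy n k F, roots n k N F) :=
      .init nodup_heavy hA (fun _ hc => (mem_heavy.1 hc).1) fun _ hc => lt_of_mem_rootsBelow hc
    -- Having no stray vertex is precisely the reachability that lets the set be generated from the
    -- kept roots.
    obtain ⟨x, hx, hS⟩ := hinit.exists_gen hN (B := fullBase n k N F) (by rw [fullBase]; omega) hk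
      (fun v hv hvA => h.low hk (hn v hv) hv hvA) (fun v hv hvA => by
        by_contra hcon
        have : v ∈ stray n k N F S := by
          simp only [stray, Finset.mem_filter, Finset.mem_sdiff, List.mem_toFinset]
          simp only [Finset.mem_sdiff, List.mem_toFinset] at hcon
          exact ⟨⟨hv, hvA⟩, hcon⟩
        rw [hstray] at this
        simp at this) k hAS (by simp only; omega)
    refine ⟨x, hx, ?_⟩
    rw [fullSet, hS]
    exact h
  · rintro ⟨hA, -, x, -, h⟩
    have hinv := fullSet_inv hN hA x
    refine ⟨_, h, (List.toFinset_card_le _).trans hinv.len, fun v hv => ?_⟩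
    exact hinv.lt v (List.mem_toFinset.1 hv)

end

/-! ### Critical sets of a graph given by adjacency lists -/

section

variable {V : Type*} [Fintype V] [DecidableEq V] (G : SimpleGraph V) [DecidableRel G.Adj]
  (f : V → ℕ)

/-- The label at time 1 gives the two counting conditions. Once all labels are 1 there are no
opposite neighbours, so they stay 1 exactly if no threshold is 0. -/
theorem isCriticalSet_iff (S : Finset V) :
    IsCriticalSet G f S ↔ ∀ v,
      (v ∈ S → (G.neighborFinset v \ S).card < f v) ∧
      (v ∉ S → 1 ≤ f v ∧ f v ≤ (G.neighborFinset v ∩ S).card) := by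
  have hin : ∀ v ∈ S, (G.neighborFinset v).filter
      (fun u => decide (u ∈ S) ≠ decide (v ∈ S)) = G.neighborFinset v \ S := by
    intro v hv; ext u; simp [hv]
  have hout : ∀ v ∉ S, (G.neighborFinset v).filter
      (fun u => decide (u ∈ S) ≠ decide (v ∈ S)) = G.neighborFinset v ∩ S := by
    intro v hv; ext u; simp [hv]
  have hone : ∀ v, process G f S 1 v = true ↔
      (v ∈ S → (G.neighborFinset v \ S).card < f v) ∧
      (v ∉ S → f v ≤ (G.neighborFinset v ∩ S).card) := by
    intro v
    by_cases hv : v ∈ S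
    · simp only [process, Function.iterate_one, step, hin v hv]
      simp [hv]
    · simp only [process, Function.iterate_one, step, hout v hv]
      simp [hv]
  have hsucc : ∀ t, (∀ v, process G f S t v = true) →
      ∀ v, (process G f S (t + 1) v = true ↔ 1 ≤ f v) := by
    intro t ht v
    have ht' : process G f S t = fun _ => true := funext ht
    have : process G f S (t + 1) = step G f (process G f S t) := by
      simp only [process, Function.iterate_succ_apply']
    rw [this, ht']
    simp [step]
    omega
  constructor
  -- Since `t ≤ 1`, all labels are 1 at times 1 and 2. Time 2 yields positivity of the thresholds.
  · rintro ⟨t, ht, hc, -⟩ v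
    have h₁ := (hone v).1 (hc 1 ht v)
    have h₂ := (hsucc 1 (hc 1 ht) v).1 (hc 2 (by omega) v)
    exact ⟨h₁.1, fun hv => ⟨h₂, h₁.2 hv⟩⟩
  · intro h
    have hpos : ∀ v, 1 ≤ f v := by
      intro v
      by_cases hv : v ∈ S
      · exact Nat.one_le_of_lt ((h v).1 hv)
      · exact ((h v).2 hv).1
    have hall : ∀ t v, process G f S (t + 1) v = true := by
      intro t
      induction t with
      | zero => exact fun v => (hone v).2 ⟨(h v).1, fun hv => ((h v).2 hv).2⟩
      | succ t ih => exact fun v => (hsucc _ ih v).2 (hpos v)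
    -- The convergence time is 0 if `S` contains every vertex and 1 otherwise.
    by_cases hS : ∀ v, v ∈ S
    · refine ⟨0, by omega, fun t' _ v => ?_, fun t' ht' => absurd ht' (by omega)⟩
      cases t' with
      | zero => simp [process, hS v]
      | succ t' => exact hall t' v
    · push Not at hS
      obtain ⟨v, hv⟩ := hS
      refine ⟨1, le_rfl, fun t' ht' => ?_, fun t' ht' => ⟨v, ?_⟩⟩
      · obtain ⟨t', rfl⟩ := Nat.exists_eq_add_of_le' ht'
        exact hall t'
      · obtain rfl : t' = 0 := by omega
        simp [process, hv]

theorem criticalSetNumber_le_iff (k : ℕ) :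
    criticalSetNumber G f ≤ k ↔ ∃ S, IsCriticalSet G f S ∧ S.card ≤ k := by
  constructor
  · intro h
    by_contra! hcon
    have : ((k + 1 : ℕ) : ℕ∞) ≤ criticalSetNumber G f :=
      le_iInf₂ fun S hS => by exact_mod_cast hcon S hS
    have := this.trans h
    norm_cast at this
    omega
  · rintro ⟨S, hS, hk⟩
    exact (iInf₂_le S hS).trans (by exact_mod_cast hk)

end

/-- The adjacency list of `v`, for the offsets `O` and the concatenated lists `J`. -/
def adjList (O J : ℕ → ℕ) (v : ℕ) : List ℕ := (List.range' (O v) (O (v + 1) - O v)).map J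

theorem length_adjList (O J : ℕ → ℕ) (v : ℕ) : (adjList O J v).length = O (v + 1) - O v := by
  simp [adjList]

/-! ### The input format as a net on `{0, …, n - 1}`. -/

section

variable {n k : ℕ} {G : SimpleGraph (Fin n)} [DecidableRel G.Adj] {f : Fin n → ℕ} {s : State}

/-- Every neighbour occurs in a list with only `deg v` positions, so by cardinality nothing else
does. -/
theorem IsInput.toFinset_adjList (h : IsInput s G f k) (v : Fin n) :
    (adjList (s.arr 1) (s.arr 2) v).toFinset = (G.neighborFinset v).map Fin.valEmbedding := by
  have hsub : (G.neighborFinset v).map Fin.valEmbedding ⊆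
      (adjList (s.arr 1) (s.arr 2) v).toFinset := by
    intro u hu
    simp only [Finset.mem_map, SimpleGraph.mem_neighborFinset, Fin.valEmbedding_apply] at hu
    obtain ⟨u, hvu, rfl⟩ := hu
    obtain ⟨i, h₁, h₂, h₃⟩ := (h.adjacency v u).1 hvu
    simp only [adjList, List.mem_toFinset, List.mem_map, List.mem_range'_1]
    exact ⟨i, ⟨h₁, by omega⟩, h₃⟩
  refine (Finset.eq_of_subset_of_card_le hsub ?_).symm
  rw [Finset.card_map, SimpleGraph.card_neighborFinset_eq_degree]
  refine (List.toFinset_card_le _).trans ?_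
  rw [length_adjList, h.offset_succ v]
  omega

theorem IsInput.length_adjList (h : IsInput s G f k) (v : Fin n) :
    (adjList (s.arr 1) (s.arr 2) v).length = G.degree v := by
  rw [CriticalSet.length_adjList, h.offset_succ v]
  omega

theorem IsInput.mem_adjList (h : IsInput s G f k) (v : Fin n) (u : ℕ) :
    u ∈ adjList (s.arr 1) (s.arr 2) v ↔ ∃ hu : u < n, G.Adj v ⟨u, hu⟩ := by
  rw [← List.mem_toFinset, h.toFinset_adjList v]
  simp only [Finset.mem_map, SimpleGraph.mem_neighborFinset, Fin.valEmbedding_apply]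
  constructor
  · rintro ⟨u, hu, rfl⟩
    exact ⟨u.2, hu⟩
  · rintro ⟨hu, h⟩
    exact ⟨_, h, rfl⟩

theorem IsInput.isNet (h : IsInput s G f k) : IsNet n (adjList (s.arr 1) (s.arr 2)) where
  nodup v hv := by
    refine Multiset.coe_nodup.1 (Multiset.toFinset_card_eq_card_iff_nodup.1 ?_)
    rw [Multiset.coe_card, h.length_adjList ⟨v, hv⟩, ← G.card_neighborFinset_eq_degree,
      ← Finset.card_map Fin.valEmbedding, ← h.toFinset_adjList ⟨v, hv⟩]
    rfl
  lt v hv u hu := ((h.mem_adjList ⟨v, hv⟩ u).1 hu).1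
  symm u hu v hv huv := by
    obtain ⟨_, ha⟩ := (h.mem_adjList ⟨v, hv⟩ u).1 huv
    exact (h.mem_adjList ⟨u, hu⟩ v).2 ⟨hv, ha.symm⟩

theorem IsInput.crit_iff (h : IsInput s G f k) (S : Finset (Fin n)) :
    IsCriticalSet G f S ↔
      Crit n (adjList (s.arr 1) (s.arr 2)) (s.arr 0) (S.map Fin.valEmbedding) := by
  rw [isCriticalSet_iff]
  have key : ∀ v : Fin n, cnt (adjList (s.arr 1) (s.arr 2)) (S.map Fin.valEmbedding) v =
      (G.neighborFinset v ∩ S).card := by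
    intro v
    rw [cnt, h.toFinset_adjList, ← Finset.map_inter, Finset.card_map]
  have hd : ∀ v : Fin n, (G.neighborFinset v \ S).card =
      G.degree v - (G.neighborFinset v ∩ S).card := by
    intro v
    rw [← SimpleGraph.card_neighborFinset_eq_degree, Finset.card_sdiff, Finset.inter_comm]
  have hmem : ∀ v : Fin n, (v : ℕ) ∈ S.map Fin.valEmbedding ↔ v ∈ S := by
    exact fun v => Finset.mem_map' Fin.valEmbedding
  constructor
  · intro hc v hv
    have := hc ⟨v, hv⟩
    rw [hd, ← key, ← h.length_adjList, ← h.threshold, ← hmem] at this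
    exact this
  · intro hc v
    have := hc v v.2
    rw [hmem, h.length_adjList, key, h.threshold, ← hd] at this
    exact this

theorem IsInput.criticalSetNumber_le_iff (h : IsInput s G f k) :
    criticalSetNumber G f ≤ k ↔ ∃ S : Finset ℕ,
      Crit n (adjList (s.arr 1) (s.arr 2)) (s.arr 0) S ∧ S.card ≤ k ∧ ∀ v ∈ S, v < n := by
  rw [CriticalSet.criticalSetNumber_le_iff]
  constructor
  · rintro ⟨S, hS, hk⟩
    refine ⟨_, (h.crit_iff S).1 hS, by rwa [Finset.card_map], fun v hv => ?_⟩
    obtain ⟨u, _, rfl⟩ := Finset.mem_map.1 hv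
    exact u.2
  · rintro ⟨S, hS, hk, hn⟩
    have : (S.attachFin hn).map Fin.valEmbedding = S := Finset.map_valEmbedding_attachFin hn
    exact ⟨S.attachFin hn, (h.crit_iff _).2 (by rwa [this]), by rwa [Finset.card_attachFin]⟩

end

/-! ### Arithmetic subroutines

Registers 2 and 3 hold 1 and 0. -/

/-- Register 90 becomes the product of the registers 92 and 93. -/
def mulProg : Program := .seq (.const 90 0) (forLoop 91 3 93 (.add 90 90 92))

/-- The cost depends only on the factor in register 93, so callers put the smaller factor there, as
the other may be exponentially large. -/
theorem mulProg_spec {W x y : ℕ} {s : State} (h2 : s.reg 2 = 1) (h3 : s.reg 3 = 0)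
    (hx : s.reg 92 = x) (hy : s.reg 93 = y) (hxy : x * y ≤ W) (hyW : y ≤ W) :
    WP W mulProg s fun s' t => t ≤ 3 * y + 3 ∧ s'.reg 90 = x * y := by
  simp only [mulProg, WP.seq_iff, WP.const_iff, Nat.zero_le, true_and]
  refine WP.call (forLoop_spec (b := 1) (fun j s => s.reg 90 = x * j) (by decide) (by simp [h2])
    (by simp [h3]) (by simpa [hy]) (by simp [h3]) ?_) ?_
  · intro j s₁ _ hj _ hr _ hI
    have e : s₁.reg 92 = x := by rw [hr 92 (by decide) (by decide)]; simp [hx]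
    have hj' : j < y := by simpa [hy] using hj
    simp only [WP.add_iff, e, hI, State.setReg_reg]
    refine ⟨?_, le_rfl, by simp [mul_add]⟩
    calc x * j + x = x * (j + 1) := by ring
      _ ≤ x * y := Nat.mul_le_mul_left _ hj'
      _ ≤ W := hxy
  · intro s' t h _ _
    simp [h3, hy] at h ⊢
    exact ⟨by omega, h.2⟩

/-- Register 80 becomes the power of register 82 with exponent in register 83. -/
def powProg : Program :=
  .seq (.const 80 1) (forLoop 81 3 83
    (.seq (.copy 92 80) (.seq (.copy 93 82) (.seq mulProg (.copy 80 90)))))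

/-- The running power is the repeated summand and the base the number of repetitions, so each of the
`y` products costs only `O(x)`. -/
theorem powProg_spec {W x y : ℕ} {s : State} (h2 : s.reg 2 = 1) (h3 : s.reg 3 = 0)
    (hx : s.reg 82 = x) (hy : s.reg 83 = y) (hpos : 0 < x) (hxy : x ^ y ≤ W) (hyW : y ≤ W) :
    WP W powProg s fun s' t => t ≤ y * (3 * x + 6 + 2) + 3 ∧ s'.reg 80 = x ^ y := by
  have hW : 1 ≤ W := (Nat.one_le_pow _ _ hpos).trans hxy
  simp only [powProg, WP.seq_iff, WP.const_iff, hW, true_and]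
  refine WP.call (forLoop_spec (b := 3 * x + 6) (fun j s => s.reg 80 = x ^ j) (by decide)
    (by simp [h2]) (by simp [h3]) (by simpa [hy]) (by simp [h3]) ?_) ?_
  · intro j s₁ _ hj _ hr _ hI
    have e : s₁.reg 82 = x := by rw [hr 82 (by decide) (by decide)]; simp [hx]
    have e2 : s₁.reg 2 = 1 := by rw [hr 2 (by decide) (by decide)]; simp [h2]
    have e3 : s₁.reg 3 = 0 := by rw [hr 3 (by decide) (by decide)]; simp [h3]
    have hj' : j < y := by simpa [hy] using hj
    have hle : x ^ j * x ≤ W := by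
      rw [← pow_succ]
      exact (Nat.pow_le_pow_right hpos hj').trans hxy
    simp only [WP.seq_iff, WP.copy_iff]
    refine WP.call (mulProg_spec (x := x ^ j) (y := x) (by simp [e2]) (by simp [e3])
      (by simp [hI]) (by simp [e]) hle ?_) ?_
    · exact (Nat.le_mul_of_pos_left x (pow_pos hpos j)).trans hle
    · intro s' t h _ _
      simp [h.2, pow_succ]
      omega
  · intro s' t h _ _
    simp [h3, hy] at h ⊢
    exact ⟨by omega, h.2⟩

/-- Divide register 92 by register 93, with the quotient in register 90 and the remainder in
register 92. -/
def divProg : Program :=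
  .seq (.const 90 0) (.loop (.le 93 92) (.seq (.sub 92 92 93) (.add 90 90 2)))

theorem divProg_spec {W x y : ℕ} {s : State} (h2 : s.reg 2 = 1)
    (hx : s.reg 92 = x) (hy : s.reg 93 = y) (hpos : 0 < y) (hW : x ≤ W) :
    WP W divProg s fun s' t => t ≤ 3 * x + 2 ∧ s'.reg 90 = x / y ∧ s'.reg 92 = x % y := by
  have key : ∀ x s, s.reg 2 = 1 → s.reg 92 = x → s.reg 93 = y → s.reg 90 + x ≤ W →
      WP W (.loop (.le 93 92) (.seq (.sub 92 92 93) (.add 90 90 2))) s fun s' t =>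
        t ≤ 3 * x + 1 ∧ s'.reg 90 = s.reg 90 + x / y ∧ s'.reg 92 = x % y := by
    intro x
    induction x using Nat.strong_induction_on with
    | _ x ih =>
      intro s h2 hx hy hW
      by_cases hxy : y ≤ x
      · have hdiv : x / y = (x - y) / y + 1 := by
          rw [Nat.div_eq x y, if_pos ⟨hpos, hxy⟩]
        have hmod : x % y = (x - y) % y := Nat.mod_eq_sub_mod hxy
        have hstep : WP W (.seq (.sub 92 92 93) (.add 90 90 2)) s fun s' t => t = 2 ∧
            s' = (s.setReg 92 (x - y)).setReg 90 (s.reg 90 + 1) := by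
          simp [hx, hy, h2]
          omega
        obtain ⟨s₁, t₁, hr₁, rfl, rfl⟩ := hstep
        obtain ⟨s₂, t₂, hr₂, ht₂, hq, hm⟩ := ih (x - y) (by omega)
          ((s.setReg 92 (x - y)).setReg 90 (s.reg 90 + 1)) (by simp [h2]) (by simp)
          (by simp [hy]) (by simp; omega)
        refine ⟨s₂, _, .loopTrue (by simpa [hx, hy] using hxy) hr₁ hr₂, by omega, ?_, ?_⟩
        · rw [hq, hdiv]; simp; omega
        · rw [hm, hmod]
      · refine ⟨s, 1, .loopFalse (by simpa [hx, hy] using hxy), by omega, ?_, ?_⟩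
        · rw [Nat.div_eq_of_lt (by omega), add_zero]
        · rw [hx, Nat.mod_eq_of_lt (by omega)]
  simp only [divProg, WP.seq_iff, WP.const_iff, Nat.zero_le, true_and]
  refine WP.call (key x _ (by simp [h2]) (by simp [hx]) (by simp [hy]) (by simpa using hW)) ?_
  intro s' t h _ _
  simp at h
  exact ⟨by omega, h.2⟩

/-! ### Generating sets on the machine -/

/-- The array `a` starts with the entries of `l`. -/
def Holds (a : ℕ → ℕ) (l : List ℕ) : Prop := ∀ i (h : i < l.length), a i = l[i]

theorem Holds.push {a : ℕ → ℕ} {l : List ℕ} (h : Holds a l) (c : ℕ) :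
    Holds (Function.update a l.length c) (l ++ [c]) := by
  intro i hi
  rw [List.length_append, List.length_singleton] at hi
  rcases Nat.lt_succ_iff_lt_or_eq.1 hi with hi' | rfl
  · rw [Function.update_of_ne (by omega), List.getElem_append_left hi']
    exact h i hi'
  · simp

theorem Holds.of_prefix {a : ℕ → ℕ} {l l' : List ℕ} (h : Holds a l') (hl : l <+: l') :
    Holds a l := by
  obtain ⟨m, rfl⟩ := hl
  intro i hi
  rw [h i (by rw [List.length_append]; omega), List.getElem_append_left hi]

/-- The indicator function of a list. -/
def ind (l : List ℕ) (v : ℕ) : ℕ := if v ∈ l then 1 else 0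

theorem ind_append (l : List ℕ) (c : ℕ) : ind (l ++ [c]) = Function.update (ind l) c 1 := by
  funext v
  by_cases h : v = c
  · subst h; simp [ind]
  · simp [ind, h]

/-- The constants, in the registers 0 to 3, and the input arrays. -/
structure Env (n k : ℕ) (F O J : ℕ → ℕ) (s : State) : Prop where
  r0 : s.reg 0 = n
  r1 : s.reg 1 = k
  r2 : s.reg 2 = 1
  r3 : s.reg 3 = 0
  a0 : s.arr 0 = F
  a1 : s.arr 1 = O
  a2 : s.arr 2 = J

theorem Env.congr {n k : ℕ} {F O J : ℕ → ℕ} {s s' : State} (h : Env n k F O J s)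
    (h0 : s'.reg 0 = s.reg 0) (h1 : s'.reg 1 = s.reg 1) (h2 : s'.reg 2 = s.reg 2)
    (h3 : s'.reg 3 = s.reg 3) (a0 : s'.arr 0 = s.arr 0) (a1 : s'.arr 1 = s.arr 1)
    (a2 : s'.arr 2 = s.arr 2) : Env n k F O J s' :=
  ⟨h0.trans h.r0, h1.trans h.r1, h2.trans h.r2, h3.trans h.r3, a0.trans h.a0, a1.trans h.a1,
    a2.trans h.a2⟩

/-- What the program needs to know about the offsets `O` and the word size `W`. -/
structure Offsets (n W : ℕ) (O : ℕ → ℕ) : Prop where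
  mono : ∀ v < n, O v ≤ O (v + 1)
  le : ∀ v, O v ≤ W
  n_lt : n < W

/-- Load the bounds of the adjacency list of the vertex in register 70 into the registers
75 and 76. -/
def boundsProg : Program := .seq (.add 74 70 2) (.seq (.load 75 1 70) (.load 76 1 74))

/-- Arrays 3 and `ca` hold the lists `st.1` and `st.2`, with lengths in the registers 72 and 71.
Array 4 is the indicator function of `st.1`. -/
structure Rep (ca : ℕ) (st : List ℕ × List ℕ) (s : State) : Prop where
  set : Holds (s.arr 3) st.1
  len : s.reg 72 = st.1.length
  ind : s.arr 4 = ind st.1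
  cand : Holds (s.arr ca) st.2
  cand_len : s.reg 71 = st.2.length

theorem Rep.congr {ca : ℕ} {st : List ℕ × List ℕ} {s s' : State} (h : Rep ca st s)
    (h3 : s'.arr 3 = s.arr 3) (h72 : s'.reg 72 = s.reg 72) (h4 : s'.arr 4 = s.arr 4)
    (hca : s'.arr ca = s.arr ca) (h71 : s'.reg 71 = s.reg 71) : Rep ca st s' :=
  ⟨h3 ▸ h.set, h72.trans h.len, h4.trans h.ind, hca ▸ h.cand, h71.trans h.cand_len⟩

/-- Append the adjacency list delimited by the registers 75 and 76 to the candidates. -/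
def extendProg (ca : ℕ) : Program :=
  forLoop 78 75 76 (.seq (.load 79 2 78) (.seq (.store ca 71 79) (.add 71 71 2)))

/-- Add the vertex in register 70 to the set if it is admissible. -/
def pushProg (ca : ℕ) : Program :=
  .seq (.load 73 4 70) <| .ite (.eq 73 3)
    (.seq (.load 73 0 70) <| .ite (.le 73 1)
      (.ite (.lt 72 1)
        (.seq boundsProg <| .seq (.sub 77 76 75) <| .ite (.le 77 6)
          (.seq (.store 4 70 2) <| .seq (.store 3 72 70) <| .seq (.add 72 72 2) (extendProg ca))
          .skip)
        .skip)
      .skip)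
    .skip

section

variable {n k W ca : ℕ} {F O J : ℕ → ℕ} {s : State}

theorem extendProg_spec {l : List ℕ} (hca : 6 < ca) (h2 : s.reg 2 = 1) (hJ : s.arr 2 = J)
    {c : ℕ} (h75 : s.reg 75 = O c) (h76 : s.reg 76 = O (c + 1)) (hO : O c ≤ O (c + 1))
    (hOW : O (c + 1) ≤ W) (hl : Holds (s.arr ca) l) (hlen : s.reg 71 = l.length)
    (hW : l.length + (adjList O J c).length ≤ W) :
    WP W (extendProg ca) s fun s' t => t ≤ (adjList O J c).length * 5 + 2 ∧
      Holds (s'.arr ca) (l ++ adjList O J c) ∧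
      s'.reg 71 = (l ++ adjList O J c).length := by
  have c2 : (2 : ℕ) ≠ ca := by omega
  rw [length_adjList] at hW
  refine WP.call (forLoop_spec (b := 3) (fun j s =>
    Holds (s.arr ca) (l ++ (List.range' (O c) (j - O c)).map J) ∧
    s.reg 71 = l.length + (j - O c)) ⟨rfl, rfl, rfl, by decide, by decide⟩ h2 (by omega) (by omega) (by simpa [h75, hlen])
    ?_) ?_
  · intro j s₁ hj hj' hi hr ha hI
    have e2 : s₁.reg 2 = 1 := by rw [hr 2 rfl (by decide), h2]
    have eJ : s₁.arr 2 = J := by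
      rw [ha 2 (by simp [Program.writesArr, c2.symm]), hJ]
    rw [h75] at hj
    rw [h76] at hj'
    have hlen' : (l ++ (List.range' (O c) (j - O c)).map J).length = s₁.reg 71 := by
      simp [hI.2]
    have := hI.1.push (J j)
    rw [hlen'] at this
    have hrange : List.range' (O c) (j + 1 - O c) = List.range' (O c) (j - O c) ++ [j] := by
      rw [Nat.sub_add_comm hj, List.range'_concat]
      congr 2
      omega
    simp only [WP.seq_iff, WP.load_iff, WP.store_iff, WP.add_iff, State.setReg_reg,
      State.setArr_reg, State.setReg_arr, State.setArr_arr, eJ, e2, hi]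
    simp only [hrange, List.map_append, List.map_cons, List.map_nil, ← List.append_assoc]
    simp only [if_true]
    refine ⟨?_, by simp, this, ?_⟩
    · have h := hI.2
      simp only [Nat.reduceEqDiff, if_false]
      omega
    · have h := hI.2
      simp only [Nat.reduceEqDiff, if_false]
      omega
  · intro s' t h hr ha
    rw [length_adjList, ← h75, ← h76]
    refine ⟨h.1, ?_, ?_⟩
    · have := h.2.1
      rw [h76] at this
      exact this
    · rw [List.length_append, length_adjList]
      have := h.2.2
      rw [h76] at this
      exact this

/-- The degree is compared with `2k` through the offsets before the list is touched, so a list of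
high degree is never read. A list that is read costs at most five steps for each of its `2k`
entries. -/
theorem pushProg_spec {st : List ℕ × List ℕ} (hca : 6 < ca) (hE : Env n k F O J s)
    (hO : Offsets n W O) (h6 : s.reg 6 = 2 * k) {c : ℕ} (h70 : s.reg 70 = c) (hc : c < n)
    (hR : Rep ca st s) (hW : st.2.length + 2 * k ≤ W) :
    WP W (pushProg ca) s fun s' t => t ≤ 10 * k + 20 ∧
      Rep ca (push k (adjList O J) F c st) s' := by
  have hrep : ∀ x v, x ≠ 71 → x ≠ 72 → Rep ca st (s.setReg x v) := fun x v h1 h2 =>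
    hR.congr rfl (by simp [h2.symm]) rfl rfl (by simp [h1.symm])
  have hmono := hO.mono c hc
  have hle := hO.le (c + 1)
  have hn := hO.n_lt
  have hlen := length_adjList O J c
  simp only [pushProg, boundsProg, WP.seq_iff, WP.ite_iff, WP.load_iff, WP.skip_iff, WP.sub_iff,
    WP.add_iff, WP.store_iff, Test.holds_eq, Test.holds_le, Test.holds_lt, State.setReg_reg,
    State.setReg_arr, State.setArr_reg, h70, h6, hE.r1, hE.r2, hE.r3, hE.a0,
    hE.a1, hR.ind, hR.len]
  simp only [Nat.reduceEqDiff, if_true, if_false]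
  unfold push
  constructor
  · intro h₁
    have h₁' : c ∉ st.1 := by
      intro h; simp [CriticalSet.ind, h] at h₁
    constructor
    · intro h₂
      constructor
      · intro h₃
        refine ⟨by omega, ?_, ?_⟩
        · intro h₄
          rw [if_pos ⟨h₁', h₂, h₃, by omega⟩]
          refine ⟨by omega, ?_⟩
          refine WP.call (extendProg_spec (W := W) (O := O) (c := c) (l := st.2) (J := J) hca
            (by simp [hE.r2]) ?_ (by simp) (by simp) hmono hle ?_ ?_ (by omega)) ?_
          · simp [hE.a2]
          · have e3 : ca ≠ 3 := by omega
            have e4 : ca ≠ 4 := by omega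
            simpa [e3, e4] using hR.cand
          · simpa using hR.cand_len
          · intro s' t h hr ha
            have w3 : (extendProg ca).writesArr 3 = false := by
              simp [extendProg, Program.writesArr]; omega
            have w4 : (extendProg ca).writesArr 4 = false := by
              simp [extendProg, Program.writesArr]; omega
            have e3 := ha 3 w3
            have e4 := ha 4 w4
            have e72 := hr 72 rfl
            refine ⟨by omega, ?_, ?_, ?_, h.2.1, h.2.2⟩
            · rw [e3]
              simpa [hE.r2] using hR.set.push c
            · rw [e72]; simp
            · rw [e4, ind_append]; simp [hR.ind]
        · intro h₄
          rw [if_neg fun h => h₄ (by omega)]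
          refine ⟨by omega, hR.congr rfl ?_ rfl rfl ?_⟩ <;> simp
      · intro h₃
        rw [if_neg fun h => h₃ h.2.2.1]
        refine ⟨by omega, hR.congr rfl ?_ rfl rfl ?_⟩ <;> simp
    · intro h₂
      rw [if_neg fun h => h₂ h.2.1]
      refine ⟨by omega, hR.congr rfl ?_ rfl rfl ?_⟩ <;> simp
  · intro h₁
    have h₁' : c ∈ st.1 := by
      by_contra h; simp [CriticalSet.ind, h] at h₁
    rw [if_neg fun h => h.1 h₁']
    exact ⟨by omega, hrep _ _ (by decide) (by decide)⟩

/-- Generate the set given by the digits of register 60 in the base given by register 61. -/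
def genProg (ca : ℕ) : Program :=
  .seq (.copy 62 60) <| forLoop 63 3 1 <|
    .seq (.copy 92 62) <| .seq (.copy 93 61) <| .seq divProg <| .seq (.copy 62 90) <|
      .ite (.lt 92 71) (.seq (.load 70 ca 92) (pushProg ca)) .skip

theorem writesArr_pushProg {a : ℕ} (h3 : a ≠ 3) (h4 : a ≠ 4) (ha : a ≠ ca) :
    (pushProg ca).writesArr a = false := by
  simp [pushProg, extendProg, boundsProg, Program.writesArr, h3.symm, h4.symm, ha.symm]

theorem writesArr_genProg {a : ℕ} (h3 : a ≠ 3) (h4 : a ≠ 4) (ha : a ≠ ca) :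
    (genProg ca).writesArr a = false := by
  simp [genProg, divProg, Program.writesArr, writesArr_pushProg h3 h4 ha]

theorem genProg_spec {A R : List ℕ} {st : List ℕ × List ℕ} (hca : 6 < ca)
    (hE : Env n k F O J s) (hN : IsNet n (adjList O J)) (hO : Offsets n W O)
    (h6 : s.reg 6 = 2 * k) {x B : ℕ} (hx : s.reg 60 = x) (hB : s.reg 61 = B) (hBpos : 0 < B)
    (hxW : x ≤ W) (hinv : GenInv n k (adjList O J) F A R st) (hR : Rep ca st s) (hkW : k ≤ W)
    (hW : R.length + 2 * k * k + 2 * k ≤ W) :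
    WP W (genProg ca) s fun s' t => t ≤ k * (3 * x + 10 * k + 30 + 2) + 3 ∧
      Rep ca (gen k (adjList O J) F B k x st) s' := by
  simp only [genProg, WP.seq_iff, WP.copy_iff]
  -- The invariant says that the unread digits applied to the current lists give the final result.
  -- The bound on register 62 limits the cost of each division.
  refine WP.call (forLoop_spec (b := 3 * x + 10 * k + 30) (fun j s => ∃ st',
    GenInv n k (adjList O J) F A R st' ∧ Rep ca st' s ∧ s.reg 62 ≤ x ∧
    gen k (adjList O J) F B (k - j) (s.reg 62) st' = gen k (adjList O J) F B k x st)
    ⟨rfl, rfl, rfl, by decide, by decide⟩ (by simp [hE.r2]) (by simp [hE.r3])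
    (by simp [hE.r1, hkW])
    ⟨st, hinv, hR.congr rfl (by simp) rfl rfl (by simp), by simp [hx], by simp [hx, hE.r3]⟩ ?_) ?_
  · intro j s₁ _ hj hi hr ha hI
    obtain ⟨st', hinv', hR', h62, hgen⟩ := hI
    have hj : j < k := by simpa [hE.r1] using hj
    have e : ∀ y, (genProg ca).writesReg y = false → s₁.reg y = s.reg y := by
      intro y hy
      simp only [genProg, Program.writesReg, writesReg_forLoop, Bool.or_eq_false_iff,
        beq_eq_false_iff_ne] at hy
      rw [hr y (by simp [Program.writesReg, hy]) (Ne.symm hy.2.1)]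
      simp [Ne.symm hy.1]
    have ea : ∀ a, a < 3 → s₁.arr a = s.arr a := by
      intro a h
      rw [ha a (by simp [Program.writesArr, divProg,
        writesArr_pushProg (ca := ca) (show a ≠ 3 by omega) (by omega) (by omega)])]
      rfl
    have hE' : Env n k F O J s₁ := hE.congr (e 0 rfl) (e 1 rfl) (e 2 rfl) (e 3 rfl)
      (ea 0 (by omega)) (ea 1 (by omega)) (ea 2 (by omega))
    have e6 := (e 6 rfl).trans h6
    have e61 := (e 61 rfl).trans hB
    obtain ⟨i, hi'⟩ : ∃ i, k - j = i + 1 := ⟨k - j - 1, by omega⟩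
    rw [hi', gen] at hgen
    have hi'' : k - (j + 1) = i := by omega
    simp only [WP.seq_iff, WP.copy_iff, WP.ite_iff, WP.load_iff, WP.skip_iff, Test.holds_lt]
    refine WP.call (divProg_spec (x := s₁.reg 62) (y := B) (by simp [hE'.r2]) (by simp)
      (by simp [e61]) hBpos (by omega)) ?_
    intro s₂ t h hr₂ ha₂
    have e' : ∀ y, divProg.writesReg y = false → y ≠ 92 → y ≠ 93 → s₂.reg y = s₁.reg y := by
      intro y hy h92 h93
      rw [hr₂ y hy]; simp [h92, h93]
    have ea' : ∀ a, s₂.arr a = s₁.arr a := fun a => by rw [ha₂ a rfl]; rfl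
    have hE₂ : Env n k F O J s₂ := hE'.congr (e' 0 rfl (by decide) (by decide))
      (e' 1 rfl (by decide) (by decide)) (e' 2 rfl (by decide) (by decide))
      (e' 3 rfl (by decide) (by decide)) (ea' 0) (ea' 1) (ea' 2)
    have hR₂ : Rep ca st' s₂ := hR'.congr (ea' 3) (e' 72 rfl (by decide) (by decide)) (ea' 4)
      (ea' ca) (e' 71 rfl (by decide) (by decide))
    have hdiv : s₁.reg 62 / B ≤ s₁.reg 62 := Nat.div_le_self _ _
    simp only [State.setReg_reg, State.setReg_arr, Nat.reduceEqDiff, if_false, h.2.1, h.2.2,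
      hR₂.cand_len]
    unfold pushDigit at hgen
    constructor
    · intro hlt
      rw [dif_pos hlt] at hgen
      have h70 : s₂.arr ca (s₁.reg 62 % B) = st'.2[s₁.reg 62 % B] := hR₂.cand _ hlt
      have hcl := hinv'.cand_length
      refine WP.call (pushProg_spec (st := st') (W := W) hca (hE₂.congr (by simp) (by simp) (by simp)
        (by simp) (by rfl) (by rfl) (by rfl)) hO (by simp [e' 6 rfl (by decide) (by decide), e6])
        (c := st'.2[s₁.reg 62 % B]) (by simp [h70]) (hinv'.cand_lt _ (List.getElem_mem hlt))
        (hR₂.congr (by rfl) (by simp) (by rfl) (by rfl) (by simp)) (by omega)) ?_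
      · intro s₃ t' ⟨ht', hR₃⟩ hr₃ ha₃
        have e62 : s₃.reg 62 = s₁.reg 62 / B := by rw [hr₃ 62 rfl]; simp
        refine ⟨by omega, _, hinv'.push hN (List.getElem_mem hlt), hR₃.congr rfl ?_ rfl rfl ?_, ?_,
          ?_⟩
        · simp
        · simp
        · omega
        · rw [e62, hi'']; exact hgen
    · intro hlt
      rw [dif_neg hlt] at hgen
      refine ⟨by omega, st', hinv', hR₂.congr rfl ?_ rfl rfl ?_, ?_, ?_⟩
      · simp
      · simp
      · simp; omega
      · simpa [hi''] using hgen
  · intro s' t h _ _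
    simp only [State.setReg_reg, Nat.reduceEqDiff, if_false, hE.r1, hE.r3, Nat.sub_self,
      Nat.sub_zero, gen] at h
    obtain ⟨ht, st', _, hR', _, rfl⟩ := h
    exact ⟨by omega, hR'⟩

end

/-! ### Finding the representative roots -/

theorem sum_map_ind {l S : List ℕ} (hl : l.Nodup) :
    (l.map (ind S)).sum = (l.toFinset ∩ S.toFinset).card := by
  rw [← List.sum_toFinset _ hl]
  change ∑ v ∈ l.toFinset, (if v ∈ S then 1 else 0) = _
  rw [Finset.sum_boole, Nat.cast_id]
  congr 1
  ext; simp

theorem sum_map_le_of_prefix {l l' : List ℕ} (h : l <+: l') (g : ℕ → ℕ) :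
    (l.map g).sum ≤ (l'.map g).sum := by
  obtain ⟨m, rfl⟩ := h
  simp

/-- Over the adjacency list delimited by the registers 75 and 76, sum up the array 4 in register
67, and add the entries of the array 5 to register 65. -/
def nbrSumProg : Program :=
  .seq (.const 67 0) <| forLoop 78 75 76 <|
    .seq (.load 79 2 78) <| .seq (.load 80 4 79) <| .seq (.add 67 67 80) <|
      .seq (.load 80 5 79) (.add 65 65 80)

/-- Add to register 65 the part of the code of the vertex in register 70 that does not depend on
its neighbours. -/
def addCodeProg : Program :=
  .seq (.load 92 5 70) <| .seq (.copy 93 7) <| .seq mulProg <|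
    .seq (.add 65 65 90) (.add 65 65 2)

/-- Register 64 becomes 1 if the members of the set from the position in register 4 on have their
demands met, and register 65 becomes their code. -/
def localProg : Program :=
  .seq (.const 64 1) <| .seq (.const 65 0) <| forLoop 66 4 72 <|
    .seq (.load 70 3 66) <| .seq boundsProg <| .seq nbrSumProg <|
      .seq (.sub 77 76 75) <| .seq (.sub 77 77 67) <| .seq (.load 79 0 70) <|
      .seq (.ite (.lt 77 79) .skip (.const 64 0)) <|
      addCodeProg

/-- Cut the set back to the first members, as many as register 4 tells. -/
def undoProg : Program :=
  .seq (forLoop 66 4 72 (.seq (.load 70 3 66) (.store 4 70 3))) (.copy 72 4)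

section

variable {n k W : ℕ} {F O J : ℕ → ℕ} {s : State}

theorem nbrSumProg_spec {g wt : ℕ → ℕ} {c x : ℕ} (h2 : s.reg 2 = 1) (hJ : s.arr 2 = J)
    (hg : s.arr 4 = g) (hwt : s.arr 5 = wt) (h75 : s.reg 75 = O c) (h76 : s.reg 76 = O (c + 1))
    (hO : O c ≤ O (c + 1)) (hOW : O (c + 1) ≤ W) (hx : s.reg 65 = x)
    (hgW : ((adjList O J c).map g).sum ≤ W) (hwtW : x + ((adjList O J c).map wt).sum ≤ W) :
    WP W nbrSumProg s fun s' t => t ≤ (adjList O J c).length * 7 + 3 ∧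
      s'.reg 67 = ((adjList O J c).map g).sum ∧
      s'.reg 65 = x + ((adjList O J c).map wt).sum := by
  simp only [nbrSumProg, WP.seq_iff, WP.const_iff, Nat.zero_le, true_and]
  refine WP.call (forLoop_spec (b := 5) (fun j s =>
    s.reg 67 = (((List.range' (O c) (j - O c)).map J).map g).sum ∧
    s.reg 65 = x + (((List.range' (O c) (j - O c)).map J).map wt).sum)
    (by decide) (by simp [h2]) (by simp [h75, h76, hO]) (by simp [h76, hOW])
    (by simp [h75, hx]) ?_) ?_
  · intro j s₁ hj hj' hi hr ha hI
    have eJ : s₁.arr 2 = J := (ha 2 rfl).trans hJ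
    have eg : s₁.arr 4 = g := (ha 4 rfl).trans hg
    have ewt : s₁.arr 5 = wt := (ha 5 rfl).trans hwt
    simp only [State.setReg_reg, Nat.reduceEqDiff, if_false, h75, h76] at hj hj'
    have hrange : List.range' (O c) (j + 1 - O c) = List.range' (O c) (j - O c) ++ [j] := by
      rw [Nat.sub_add_comm hj, List.range'_concat]
      congr 2
      omega
    -- Partial sums are sums over a prefix of the list, so the bound on the complete sum excludes
    -- overflow at every stage.
    have hpre : (List.range' (O c) (j + 1 - O c)).map J <+: adjList O J c := by
      refine List.IsPrefix.map _ ⟨List.range' (j + 1) (O (c + 1) - (j + 1)), ?_⟩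
      have := List.range'_append (s := O c) (m := j + 1 - O c) (n := O (c + 1) - (j + 1)) (step := 1)
      rw [← show O (c + 1) - (j + 1) + (j + 1 - O c) = O (c + 1) - O c by omega]
      convert this using 2
      · congr 1; omega
      · omega
    have l₁ := sum_map_le_of_prefix hpre g
    have l₂ := sum_map_le_of_prefix hpre wt
    simp only [hrange, List.map_append, List.map_cons, List.map_nil, List.sum_append,
      List.sum_cons, List.sum_nil, add_zero] at l₁ l₂ ⊢
    simp only [WP.seq_iff, WP.load_iff, WP.add_iff, State.setReg_reg, State.setReg_arr, eJ, eg,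
      ewt, hi, Nat.reduceEqDiff, if_true, if_false]
    omega
  · intro s' t h _ _
    simp only [State.setReg_reg, Nat.reduceEqDiff, if_false, h75, h76] at h
    rw [length_adjList]
    exact ⟨by omega, h.2⟩

theorem addCodeProg_spec {wt : ℕ → ℕ} {c x : ℕ} (h2 : s.reg 2 = 1) (h3 : s.reg 3 = 0)
    (h7 : s.reg 7 = k + 1) (h70 : s.reg 70 = c) (hwt : s.arr 5 = wt) (hx : s.reg 65 = x)
    (hkW : k + 1 ≤ W) (hW : x + (k + 1) * wt c + 1 ≤ W) :
    WP W addCodeProg s fun s' t => t ≤ 3 * k + 10 ∧ s'.reg 65 = x + (k + 1) * wt c + 1 := by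
  have hcomm : wt c * (k + 1) = (k + 1) * wt c := mul_comm _ _
  simp only [addCodeProg, WP.seq_iff, WP.load_iff, WP.copy_iff, WP.add_iff, State.setReg_reg,
    hwt, h70, h7, Nat.reduceEqDiff, if_true, if_false]
  refine WP.call (mulProg_spec (x := wt c) (y := k + 1) (by simp [h2]) (by simp [h3])
    (by simp) (by simp) (by omega) hkW) ?_
  rintro s₄ t₄ ⟨ht₄, h90⟩ hr₄ _
  have g2 : s₄.reg 2 = 1 := by rw [hr₄ 2 rfl]; simp [h2]
  have g65 : s₄.reg 65 = x := by rw [hr₄ 65 rfl]; simp [hx]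
  simp only [h90, g2, g65, hcomm, and_true]
  omega

/-- Only non-heavy members are scanned. Their lists have length at most `2k`, which makes the cost
independent of `n`. -/
theorem localProg_spec {A S : List ℕ} {wt : ℕ → ℕ} (hE : Env n k F O J s)
    (hN : IsNet n (adjList O J)) (hO : Offsets n W O) (h4 : s.reg 4 = A.length)
    (h7 : s.reg 7 = k + 1) (hwt : s.arr 5 = wt) (hind : s.arr 4 = ind S)
    (hS : Holds (s.arr 3) S) (hlen : s.reg 72 = S.length) (hAS : A <+: S) (hSn : ∀ c ∈ S, c < n)
    (hlow : ∀ c ∈ S.drop A.length, (adjList O J c).length ≤ 2 * k) (hSk : S.length ≤ k)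
    (hkW : k + 1 ≤ W)
    (hW : ((S.drop A.length).map (vertexCode k (adjList O J) wt)).sum ≤ W) :
    WP W localProg s fun s' t => t ≤ k * (17 * k + 30 + 2) + 4 ∧
      s'.reg 65 = ((S.drop A.length).map (vertexCode k (adjList O J) wt)).sum ∧
      (s'.reg 64 = 1 ↔ ∀ c ∈ S.drop A.length,
        (adjList O J c).length - cnt (adjList O J) S.toFinset c < F c) := by
  have hAl := hAS.length_le
  set T := S.drop A.length with hT
  have hTl : T.length = S.length - A.length := by simp [hT]
  simp only [localProg, WP.seq_iff, WP.const_iff, Nat.zero_le, true_and]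
  refine ⟨by omega, ?_⟩
  refine WP.call (forLoop_spec (b := 17 * k + 30) (fun j s =>
    s.reg 65 = ((T.take (j - A.length)).map (vertexCode k (adjList O J) wt)).sum ∧
    (s.reg 64 = 1 ↔ ∀ c ∈ T.take (j - A.length),
        (adjList O J c).length - cnt (adjList O J) S.toFinset c < F c))
    ⟨rfl, rfl, rfl, by decide, by decide⟩ (by simp [hE.r2]) (by simp [h4, hlen, hAl])
    (by simp [hlen]; omega) (by simp [h4]) ?_) ?_
  · intro j s₁ hj hj' hi hr ha hI
    simp only [State.setReg_reg, Nat.reduceEqDiff, if_false, h4, hlen] at hj hj'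
    have e0 := (hr 0 rfl (by decide)).trans hE.r0
    have e2 := (hr 2 rfl (by decide)).trans hE.r2
    have e3 := (hr 3 rfl (by decide)).trans hE.r3
    have e7 := (hr 7 rfl (by decide)).trans h7
    have f0 : s₁.arr 0 = F := (ha 0 rfl).trans hE.a0
    have f1 : s₁.arr 1 = O := (ha 1 rfl).trans hE.a1
    have f2 : s₁.arr 2 = J := (ha 2 rfl).trans hE.a2
    have f3 : s₁.arr 3 = s.arr 3 := ha 3 rfl
    have f4 : s₁.arr 4 = ind S := (ha 4 rfl).trans hind
    have f5 : s₁.arr 5 = wt := (ha 5 rfl).trans hwt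
    obtain ⟨c, hc⟩ : ∃ c, c = S[j] := ⟨_, rfl⟩
    have f3j : s₁.arr 3 j = c := by rw [f3, hc]; exact hS j hj'
    have hcn : c < n := hSn c (hc ▸ List.getElem_mem hj')
    have htake : T.take (j + 1 - A.length) = T.take (j - A.length) ++ [c] := by
      rw [Nat.sub_add_comm hj, List.take_succ_eq_append_getElem (by omega)]
      congr 2
      rw [hc]
      simp only [hT, List.getElem_drop]
      congr 1; omega
    have hcT : c ∈ T := by
      refine List.mem_of_mem_take (i := j + 1 - A.length) ?_
      rw [htake]; simp
    have hdeg := hlow c hcT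
    have hmono := hO.mono c hcn
    have hle := hO.le (c + 1)
    have hnlt := hO.n_lt
    have hlen' := length_adjList O J c
    have hsum := sum_map_le_of_prefix (List.take_prefix (j + 1 - A.length) T)
      (vertexCode k (adjList O J) wt)
    rw [htake, List.map_append, List.sum_append] at hsum
    simp only [List.map_cons, List.map_nil, List.sum_cons, List.sum_nil, add_zero] at hsum
    have hcode : vertexCode k (adjList O J) wt c =
      1 + (k + 1) * wt c + ((adjList O J c).map wt).sum := rfl
    have hcnt : ((adjList O J c).map (ind S)).sum = cnt (adjList O J) S.toFinset c :=
      sum_map_ind (hN.nodup c hcn)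
    have hcntle : cnt (adjList O J) S.toFinset c ≤ S.length :=
      (cnt_le_card _ _).trans (List.toFinset_card_le _)
    simp only [WP.seq_iff, WP.load_iff, WP.add_iff, boundsProg, State.setReg_reg,
      State.setReg_arr, e2, f1, f3j, hi, Nat.reduceEqDiff, if_true, if_false]
    refine ⟨by omega, ?_⟩
    refine WP.call (nbrSumProg_spec (W := W) (g := ind S) (wt := wt) (c := c) (x := s₁.reg 65)
      (O := O) (J := J) (by simp [e2]) (by simp [f2]) (by simp [f4]) (by simp [f5]) (by simp)
      (by simp) hmono hle (by simp) (by omega) (by omega)) ?_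
    rintro s₂ t₂ ⟨ht₂, h67, h65⟩ hr₂ ha₂
    have e2 : s₂.reg 2 = 1 := by rw [hr₂ 2 rfl]; simp [e2]
    have e3 : s₂.reg 3 = 0 := by rw [hr₂ 3 rfl]; simp [e3]
    have e7 : s₂.reg 7 = k + 1 := by rw [hr₂ 7 rfl]; simp [e7]
    have e70 : s₂.reg 70 = c := by rw [hr₂ 70 rfl]; simp
    have e75 : s₂.reg 75 = O c := by rw [hr₂ 75 rfl]; simp
    have e76 : s₂.reg 76 = O (c + 1) := by rw [hr₂ 76 rfl]; simp
    have e64 : s₂.reg 64 = s₁.reg 64 := by rw [hr₂ 64 rfl]; simp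
    have f0 : s₂.arr 0 = F := by rw [ha₂ 0 rfl]; simp [f0]
    have f5 : s₂.arr 5 = wt := by rw [ha₂ 5 rfl]; simp [f5]
    rw [hcnt] at h67
    simp only [htake, List.map_append, List.sum_append, List.map_cons, List.map_nil,
      List.sum_cons, List.sum_nil, add_zero, List.forall_mem_append, List.forall_mem_singleton]
    simp only [WP.sub_iff, WP.ite_iff, WP.skip_iff, WP.const_iff, Test.holds_lt, State.setReg_reg,
      State.setReg_arr, e70, e75, e76, f0, h67, ← hlen', Nat.reduceEqDiff, if_true, if_false]
    constructor
    · intro hok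
      refine WP.call (addCodeProg_spec (W := W) (wt := wt) (c := c) (x := s₂.reg 65) (by simp [e2])
        (by simp [e3]) (by simp [e7]) (by simp [e70]) (by simp [f5]) (by simp) hkW (by omega)) ?_
      rintro s₄ t₄ ⟨ht₄, g65⟩ hr₄ _
      have g64 := hr₄ 64 rfl
      simp only [State.setReg_reg, Nat.reduceEqDiff, if_false] at g64
      refine ⟨by omega, by omega, ?_⟩
      rw [g64, e64, hI.2]
      exact ⟨fun h => ⟨h, hok⟩, fun h => h.1⟩
    · intro hok
      refine ⟨Nat.zero_le _, ?_⟩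
      refine WP.call (addCodeProg_spec (W := W) (wt := wt) (c := c) (x := s₂.reg 65) (by simp [e2])
        (by simp [e3]) (by simp [e7]) (by simp [e70]) (by simp [f5]) (by simp) hkW (by omega)) ?_
      rintro s₄ t₄ ⟨ht₄, g65⟩ hr₄ _
      have g64 := hr₄ 64 rfl
      simp only [State.setReg_reg, if_true] at g64
      refine ⟨by omega, by omega, ?_⟩
      rw [g64]
      exact ⟨fun h => by omega, fun h => absurd h.2 hok⟩
  · intro s' t h _ _
    simp only [State.setReg_reg, Nat.reduceEqDiff, if_false, h4, hlen, ← hTl,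
      List.take_length] at h
    refine ⟨?_, h.2⟩
    have : T.length * (17 * k + 30 + 2) ≤ k * (17 * k + 30 + 2) :=
      Nat.mul_le_mul_right _ (by omega)
    omega

/-- Resetting only the entries that were set restores the indicator array in `O(k)` steps. Clearing
the whole array would cost a factor `n` in each root test. -/
theorem undoProg_spec {A S : List ℕ} (h2 : s.reg 2 = 1) (h3 : s.reg 3 = 0)
    (h4 : s.reg 4 = A.length) (hind : s.arr 4 = ind S) (hS : Holds (s.arr 3) S)
    (hlen : s.reg 72 = S.length) (hAS : A <+: S) (hnd : S.Nodup) (hSk : S.length ≤ k)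
    (hkW : k + 1 ≤ W) :
    WP W undoProg s fun s' t => t ≤ k * 4 + 3 ∧ s'.reg 72 = A.length ∧ s'.arr 4 = ind A := by
  have hAl := hAS.length_le
  set T := S.drop A.length with hT
  have hTl : T.length = S.length - A.length := by simp [hT]
  simp only [undoProg, WP.seq_iff]
  refine WP.call (forLoop_spec (b := 2) (fun j s => ∀ v, s.arr 4 v =
    if v ∈ S ∧ v ∉ T.take (j - A.length) then 1 else 0)
    (by decide) h2 (by omega) (by omega) (by simp [h4, hind, ind]) ?_) ?_
  · intro j s₁ hj hj' hi hr ha hI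
    rw [h4] at hj
    rw [hlen] at hj'
    have e3 := (hr 3 rfl (by decide)).trans h3
    have f3 : s₁.arr 3 = s.arr 3 := ha 3 rfl
    have f3j : s₁.arr 3 j = S[j] := by rw [f3]; exact hS j hj'
    have htake : T.take (j + 1 - A.length) = T.take (j - A.length) ++ [S[j]] := by
      rw [Nat.sub_add_comm hj, List.take_succ_eq_append_getElem (by omega)]
      congr 2
      simp only [hT, List.getElem_drop]
      congr 1; omega
    simp only [WP.seq_iff, WP.load_iff, WP.store_iff, State.setReg_reg, State.setReg_arr,
      State.setArr_arr, hi, f3j, e3, htake, Nat.reduceEqDiff, if_true, if_false]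
    refine ⟨by omega, fun v => ?_⟩
    by_cases hv : v = S[j]
    · subst hv; simp
    · rw [Function.update_of_ne hv, hI v]
      simp [hv]
  · intro s' t h hr _
    have e4 := (hr 4 rfl).trans h4
    simp only [h4, hlen, ← hTl, List.take_length] at h
    simp only [WP.copy_iff, State.setReg_reg, if_true, State.setReg_arr, e4, true_and]
    refine ⟨by omega, funext fun v => ?_⟩
    rw [h.2 v, ind, hT]
    refine if_congr ?_ rfl rfl
    rw [mem_drop_iff hnd hAS]
    have := hAS.subset (a := v)
    simp only [Finset.mem_sdiff, List.mem_toFinset]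
    tauto

end

/-- The constants and weights that the search works with. -/
structure Consts (n k : ℕ) (F O J : ℕ → ℕ) (s : State) : Prop extends Env n k F O J s where
  r4 : s.reg 4 = (heavy n k F).length
  r6 : s.reg 6 = 2 * k
  r7 : s.reg 7 = k + 1
  r8 : s.reg 8 = rootSeqs k
  r9 : s.reg 9 = rootBase k
  r10 : s.reg 10 = rootCap k
  r11 : s.reg 11 = codeBound k
  wt : s.arr 5 = zoneWeight n k (adjList O J) F

/-- The current set consists of the members of `A`. -/
structure Idle (A : List ℕ) (s : State) : Prop where
  set : Holds (s.arr 3) A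
  len : s.reg 72 = A.length
  ind : s.arr 4 = ind A

/-- The words are large enough for the search. -/
structure Words (k W : ℕ) : Prop where
  seqs : rootSeqs k ≤ W
  code : codeBound k ≤ W
  base : codeBound k * rootCap k + 2 * k * k + 2 * k + 2 ≤ W

theorem Consts.congr {n k : ℕ} {F O J : ℕ → ℕ} {s s' : State} (h : Consts n k F O J s)
    (hr : ∀ x < 12, s'.reg x = s.reg x) (a0 : s'.arr 0 = s.arr 0) (a1 : s'.arr 1 = s.arr 1)
    (a2 : s'.arr 2 = s.arr 2) (a5 : s'.arr 5 = s.arr 5) : Consts n k F O J s' :=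
  ⟨h.toEnv.congr (hr 0 (by omega)) (hr 1 (by omega)) (hr 2 (by omega)) (hr 3 (by omega)) a0 a1 a2,
    (hr 4 (by omega)).trans h.r4, (hr 6 (by omega)).trans h.r6, (hr 7 (by omega)).trans h.r7,
    (hr 8 (by omega)).trans h.r8, (hr 9 (by omega)).trans h.r9, (hr 10 (by omega)).trans h.r10,
    (hr 11 (by omega)).trans h.r11, a5.trans h.wt⟩

theorem Idle.congr {A : List ℕ} {s s' : State} (h : Idle A s) (h3 : s'.arr 3 = s.arr 3)
    (h72 : s'.reg 72 = s.reg 72) (h4 : s'.arr 4 = s.arr 4) : Idle A s' :=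
  ⟨h3 ▸ h.set, h72.trans h.len, h4.trans h.ind⟩

/-- Set register 18 to 1 if the root in register 15 and the digits of register 16 give a locally
admissible set with the code in register 14. -/
def rootTestProg : Program :=
  .seq (.copy 71 3) <| .seq (.store 7 71 15) <| .seq (.copy 71 2) <| .seq (.copy 60 16) <|
    .seq (.copy 61 9) <| .seq (genProg 7) <| .seq localProg <|
    .seq (.ite (.eq 64 2) (.ite (.eq 65 14) (.copy 18 2) .skip) .skip) undoProg

/-- Append the representative roots for the code in register 14 to the array 8, whose length is in
register 13. -/
def rootsOfProg : Program :=
  .seq (.copy 17 3) <| forLoop 15 3 0 <| .seq (.copy 18 3) <| .seq (forLoop 16 3 8 rootTestProg) <|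
    .ite (.eq 18 2)
      (.ite (.lt 17 10)
        (.seq (.store 8 13 15) <| .seq (.add 13 13 2) (.add 17 17 2)) .skip) .skip

/-- Write the representative roots into the array 8, and their number into register 13. -/
def rootsProg : Program := .seq (.copy 13 3) (forLoop 14 3 11 rootsOfProg)

/-- The time bound of `rootTestProg`. -/
def rootTestTime (k : ℕ) : ℕ := k * (3 * rootSeqs k + 27 * k + 70) + 25

section

variable {n k W : ℕ} {F O J : ℕ → ℕ} {s : State}

theorem rootBase_le (hW : Words k W) : rootBase k + 2 * k ≤ W := by
  have := hW.base
  rw [rootBase]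
  omega

/-- The code is computed for inadmissible sets too, so its size bound, needed against overflow, must
hold for every generated set. -/
theorem GenInv.setCode_lt {N : ℕ → List ℕ} {R : List ℕ} {st : List ℕ × List ℕ} (hN : IsNet n N)
    (hZ : (critZone n k N F).card ≤ 2 * k * (k + 1))
    (h : GenInv n k N F (heavy n k F) R st) : setCode n k N F st.1 < codeBound k := by
  have hc : (st.1.toFinset \ (heavy n k F).toFinset).card ≤ k :=
    (Finset.card_le_card Finset.sdiff_subset).trans ((List.toFinset_card_le _).trans h.len)
  rw [setCode, sum_map_drop h.nodup h.pre, zoneWeight, sum_vertexCode hN _ fun c hc => by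
    simp only [Finset.mem_sdiff, List.mem_toFinset] at hc
    exact h.lt c hc.1]
  refine (weight_sum_lt (by omega) n fun v _ => cnt_digit_lt hc v).trans_le ?_
  refine Nat.pow_le_pow_right (by omega) ?_
  have := rank_le_card (critZone n k N F) n
  omega

theorem rootTestProg_spec (hN : IsNet n (adjList O J)) (hO : Offsets n W O) (hW : Words k W)
    (hA : (heavy n k F).length ≤ k)
    (hZ : (critZone n k (adjList O J) F).card ≤ 2 * k * (k + 1))
    (hC : Consts n k F O J s) (hI : Idle (heavy n k F) s) {w x τ : ℕ}
    (hw : s.reg 15 = w) (hx : s.reg 16 = x) (hτ : s.reg 14 = τ) (hwn : w < n)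
    (hxlt : x < rootSeqs k) :
    WP W rootTestProg s fun s' t => t ≤ rootTestTime k ∧ Idle (heavy n k F) s' ∧
      (s'.reg 18 = 1 ↔ s.reg 18 = 1 ∨ LocallyOK n k (adjList O J) F
          (rootSet n k (adjList O J) F w x) ∧
        setCode n k (adjList O J) F (rootSet n k (adjList O J) F w x) = τ) := by
  have hinit : GenInv n k (adjList O J) F (heavy n k F) [w] (heavy n k F, [w]) :=
    GenInv.init nodup_heavy hA (fun _ hc => (mem_heavy.1 hc).1) (by simpa using hwn)
  have hinv := hinit.gen hN (B := rootBase k) k x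
  have hbase := rootBase_le hW
  have hseqs := hW.seqs
  have hcode := hinv.setCode_lt hN hZ
  have hcodeW := hW.code
  have hk : k + 1 ≤ W := by have := hW.base; omega
  simp only [rootTestProg, WP.seq_iff, WP.copy_iff, WP.store_iff]
  refine WP.call (genProg_spec (ca := 7) (st := (heavy n k F, [w])) (A := heavy n k F) (R := [w])
    (by decide) (hC.toEnv.congr (by simp) (by simp) (by simp) (by simp) (by simp) (by simp)
      (by simp)) hN hO (by simp [hC.r6]) (x := x) (B := rootBase k) (by simp [hx])
      (by simp [hC.r9]) (by rw [rootBase]; omega) (by omega) hinit ⟨?_, ?_, ?_, ?_, ?_⟩ (by omega)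
      (by rw [rootBase] at hbase; simp only [List.length_singleton]; omega)) ?_
  · simpa using hI.set
  · simpa using hI.len
  · simpa using hI.ind
  · intro i hi
    obtain rfl : i = 0 := by simpa using hi
    simp [hC.r3, hw]
  · simp [hC.r2]
  rintro s₁ t₁ ⟨ht₁, hR₁⟩ hr₁ ha₁
  set st := gen k (adjList O J) F (rootBase k) k x (heavy n k F, [w]) with hst
  -- The low registers hold constants and loop variables. That none is written is decided over the
  -- finite range.
  have e1 : ∀ y < 20, s₁.reg y = s.reg y := fun y hy => by
    rw [hr₁ y (by clear * - hy; revert y; decide)]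
    have h60 : y ≠ 60 := by omega
    have h61 : y ≠ 61 := by omega
    have h71 : y ≠ 71 := by omega
    simp [h60, h61, h71]
  have b1 : ∀ a, a ≠ 3 → a ≠ 4 → a ≠ 7 → s₁.arr a = s.arr a := fun a h3 h4 h7 => by
    rw [ha₁ a (writesArr_genProg h3 h4 h7)]
    simp [h7]
  have hC₁ : Consts n k F O J s₁ := hC.congr (fun y hy => e1 y (by omega))
    (b1 0 (by decide) (by decide) (by decide)) (b1 1 (by decide) (by decide) (by decide))
    (b1 2 (by decide) (by decide) (by decide)) (b1 5 (by decide) (by decide) (by decide))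
  refine WP.call (localProg_spec (A := heavy n k F) (S := st.1) hC₁.toEnv hN hO hC₁.r4 hC₁.r7
    hC₁.wt hR₁.ind hR₁.set hR₁.len hinv.pre hinv.lt (fun c hc => ?_) hinv.len hk
    (by rw [setCode] at hcode; omega)) ?_
  · rw [mem_drop_iff hinv.nodup hinv.pre, Finset.mem_sdiff, List.mem_toFinset,
      List.mem_toFinset] at hc
    exact (hinv.low c hc.1 hc.2).2
  rintro s₂ t₂ ⟨ht₂, h65, h64⟩ hr₂ ha₂
  have e2 : ∀ y < 20, s₂.reg y = s.reg y := fun y hy => by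
    rw [hr₂ y (by clear * - hy; revert y; decide), e1 y hy]
  -- All three branches end with the same clean-up, from states that differ at most in the flag
  -- register 18.
  have hundo : ∀ s₃ : State, (∀ y, y ≠ 18 → s₃.reg y = s₂.reg y) → (s₃.arr = s₂.arr) →
      WP W undoProg s₃ fun s' t => t ≤ k * 4 + 3 ∧ Idle (heavy n k F) s' ∧
        s'.reg 18 = s₃.reg 18 := by
    intro s₃ g g'
    have hlen : s₃.reg 72 = st.1.length := by
      rw [g 72 (by decide), hr₂ 72 rfl, hR₁.len]
    have hind : s₃.arr 4 = ind st.1 := by rw [g', ha₂ 4 rfl, hR₁.ind]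
    have hset : Holds (s₃.arr 3) st.1 := by rw [g', ha₂ 3 rfl]; exact hR₁.set
    refine WP.call (undoProg_spec (A := heavy n k F) (S := st.1) (k := k)
      (by rw [g 2 (by decide), e2 2 (by decide), hC.r2])
      (by rw [g 3 (by decide), e2 3 (by decide), hC.r3])
      (by rw [g 4 (by decide), e2 4 (by decide), hC.r4])
      hind hset hlen hinv.pre hinv.nodup hinv.len hk) ?_
    rintro s₄ t₄ ⟨ht₄, h72, h4⟩ hr₄ ha₄
    refine ⟨ht₄, ⟨?_, h72, h4⟩, hr₄ 18 rfl⟩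
    rw [ha₄ 3 rfl]
    exact hset.of_prefix hinv.pre
  have htime : k * (3 * x + 10 * k + 30 + 2) + k * (17 * k + 30 + 2) + k * 4 ≤
      k * (3 * rootSeqs k + 27 * k + 70) := by
    rw [← mul_add, ← mul_add]
    exact Nat.mul_le_mul_left _ (by omega)
  have e2' := (e2 2 (by decide)).trans hC.r2
  have e14 := (e2 14 (by decide)).trans hτ
  have e18 := e2 18 (by decide)
  have hok : s₂.reg 64 = 1 ↔ LocallyOK n k (adjList O J) F (rootSet n k (adjList O J) F w x) := h64
  have hcd : s₂.reg 65 = setCode n k (adjList O J) F (rootSet n k (adjList O J) F w x) := h65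
  simp only [WP.ite_iff, WP.copy_iff, WP.skip_iff, Test.holds_eq, e2', e14, hok, hcd]
  unfold rootTestTime
  refine ⟨fun h => ⟨fun h' => ?_, fun h' => ?_⟩, fun h => ?_⟩
  · refine WP.call (hundo _ (fun y hy => by simp [hy]) rfl) ?_
    rintro s₄ t₄ ⟨ht₄, hI₄, h18⟩ _ _
    refine ⟨by omega, hI₄, ?_⟩
    simp [h18, h, h']
  · refine WP.call (hundo _ (fun y hy => rfl) rfl) ?_
    rintro s₄ t₄ ⟨ht₄, hI₄, h18⟩ _ _
    refine ⟨by omega, hI₄, ?_⟩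
    simp [h18, h', e18]
  · refine WP.call (hundo _ (fun y hy => rfl) rfl) ?_
    rintro s₄ t₄ ⟨ht₄, hI₄, h18⟩ _ _
    refine ⟨by omega, hI₄, ?_⟩
    simp [h18, h, e18]

theorem take_append_singleton {l : List ℕ} {m w : ℕ} :
    (l ++ [w]).take m = if l.length < m then l.take m ++ [w] else l.take m := by
  split_ifs with h
  · rw [List.take_of_length_le (by simp; omega), List.take_of_length_le (by omega)]
  · rw [List.take_append_of_le_length (by omega)]

/-- Vertices are tried in increasing order, so after `j` of them the list found is the truncated
filter of `List.range j`, which becomes `rootsOf` at `j = n`. -/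
theorem rootsOfProg_spec (hN : IsNet n (adjList O J)) (hO : Offsets n W O) (hW : Words k W)
    (hA : (heavy n k F).length ≤ k)
    (hZ : (critZone n k (adjList O J) F).card ≤ 2 * k * (k + 1))
    (hC : Consts n k F O J s) (hI : Idle (heavy n k F) s) {τ : ℕ} (hτ : s.reg 14 = τ)
    {R : List ℕ} (hR : Holds (s.arr 8) R) (hlen : s.reg 13 = R.length)
    (hRW : R.length + rootCap k ≤ W) :
    WP W rootsOfProg s fun s' t =>
      t ≤ n * (rootSeqs k * (rootTestTime k + 2) + 8 + 2) + 3 ∧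
      Idle (heavy n k F) s' ∧ Holds (s'.arr 8) (R ++ rootsOf n k (adjList O J) F τ) ∧
      s'.reg 13 = (R ++ rootsOf n k (adjList O J) F τ).length := by
  classical
  simp only [rootsOfProg, WP.seq_iff, WP.copy_iff]
  have hnW := hO.n_lt
  refine WP.call (forLoop_spec (b := rootSeqs k * (rootTestTime k + 2) + 8) (fun j s =>
    Idle (heavy n k F) s ∧
    Holds (s.arr 8) (R ++ ((List.range j).filter
      fun w => Hit n k (adjList O J) F τ w).take (rootCap k)) ∧
    s.reg 13 = R.length + (((List.range j).filter
      fun w => Hit n k (adjList O J) F τ w).take (rootCap k)).length ∧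
    s.reg 17 = (((List.range j).filter
      fun w => Hit n k (adjList O J) F τ w).take (rootCap k)).length)
    (by decide) (by simp [hC.r2]) (by simp [hC.r3]) (by simp [hC.r0]; omega)
    ⟨hI.congr rfl (by simp) rfl, by simpa [hC.r3] using hR, by simp [hC.r3, hlen],
      by simp [hC.r3]⟩ ?_) ?_
  · intro w s₁ _ hj hi hr ha hI
    obtain ⟨hI₁, hR₁, h13, h17⟩ := hI
    set L := (List.range w).filter fun w => Hit n k (adjList O J) F τ w with hL
    have hwn : w < n := by simpa [hC.r0] using hj
    have e1 : ∀ y < 15, y ≠ 13 → s₁.reg y = s.reg y := fun y hy hy' => by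
      rw [hr y (by clear * - hy hy'; revert y; decide) (by omega)]
      have h17 : y ≠ 17 := by omega
      simp [h17]
    have hC₁ : Consts n k F O J s₁ := hC.congr (fun y hy => e1 y (by omega) (by omega))
      (ha 0 rfl) (ha 1 rfl) (ha 2 rfl) (ha 5 rfl)
    have e14 := (e1 14 (by decide) (by decide)).trans hτ
    simp only [WP.seq_iff, WP.copy_iff]
    refine WP.call (forLoop_spec (b := rootTestTime k) (fun j s =>
      Idle (heavy n k F) s ∧ (s.reg 18 = 1 ↔ ∃ x < j, LocallyOK n k (adjList O J) F
          (rootSet n k (adjList O J) F w x) ∧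
        setCode n k (adjList O J) F (rootSet n k (adjList O J) F w x) = τ))
      (by decide) (by simp [hC₁.r2]) (by simp [hC₁.r3]) (by simp [hC₁.r8, hW.seqs])
      ⟨hI₁.congr rfl (by simp) rfl, by simp [hC₁.r3]⟩ ?_) ?_
    · intro x s₂ _ hxlt hx hr₂ ha₂ hI₂
      have hxlt : x < rootSeqs k := by simpa [hC₁.r8] using hxlt
      have e2 : ∀ y < 16, s₂.reg y = s₁.reg y := fun y hy => by
        rw [hr₂ y (by clear * - hy; revert y; decide) (by omega)]
        have h18 : y ≠ 18 := by omega
        simp [h18]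
      have hC₂ : Consts n k F O J s₂ := hC₁.congr (fun y hy => e2 y (by omega))
        (ha₂ 0 rfl) (ha₂ 1 rfl) (ha₂ 2 rfl) (ha₂ 5 rfl)
      refine WP.call (rootTestProg_spec hN hO hW hA hZ hC₂ hI₂.1 (w := w) (x := x) (τ := τ)
        (by rw [e2 15 (by decide), hi]) hx (by rw [e2 14 (by decide), e14]) hwn hxlt) ?_
      rintro s₃ t₃ ⟨ht₃, hI₃, h18⟩ _ _
      refine ⟨ht₃, hI₃.congr rfl (by simp) rfl, ?_⟩
      simp only [State.setReg_reg, Nat.reduceEqDiff, if_false, h18, hI₂.2]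
      constructor
      · rintro (⟨y, hy, h⟩ | h)
        · exact ⟨y, by omega, h⟩
        · exact ⟨x, by omega, h⟩
      · rintro ⟨y, hy, h⟩
        rcases Nat.lt_succ_iff_lt_or_eq.1 hy with hy | rfl
        · exact .inl ⟨y, hy, h⟩
        · exact .inr h
    · rintro s₂ t₂ ⟨ht₂, hI₂, h18⟩ hr₂ ha₂
      simp only [State.setReg_reg, Nat.reduceEqDiff, if_false, hC₁.r8, hC₁.r3,
        Nat.sub_zero] at ht₂ h18
      have hhit : s₂.reg 18 = 1 ↔ Hit n k (adjList O J) F τ w := h18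
      have e2 : ∀ y < 18, y ≠ 16 → s₂.reg y = s₁.reg y := fun y hy hy' => by
        rw [hr₂ y (by clear * - hy hy'; revert y; decide)]
        have h18 : y ≠ 18 := by omega
        simp [h18]
      have g2 := (e2 2 (by decide) (by decide)).trans hC₁.r2
      have g10 := (e2 10 (by decide) (by decide)).trans hC₁.r10
      have g13 := (e2 13 (by decide) (by decide)).trans h13
      have g15 := (e2 15 (by decide) (by decide)).trans hi
      have g17 := (e2 17 (by decide) (by decide)).trans h17
      have f8 : s₂.arr 8 = s₁.arr 8 := by rw [ha₂ 8 rfl]; rfl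
      have hlentake := List.length_take_le (rootCap k) L
      have hsucc : (List.range (w + 1)).filter (fun w => Hit n k (adjList O J) F τ w) =
          if Hit n k (adjList O J) F τ w then L ++ [w] else L := by
        rw [List.range_succ, List.filter_append, ← hL]
        split_ifs with h <;> simp [h]
      simp only [WP.ite_iff, WP.seq_iff, WP.skip_iff, WP.store_iff, WP.add_iff, Test.holds_eq,
        Test.holds_lt, g2, g10, g13, g15, g17, hhit, hsucc, State.setReg_reg, State.setReg_arr,
        State.setArr_reg, Nat.reduceEqDiff, if_true, if_false]
      -- Register 17 holds the truncated length, which is below the cap exactly when the untruncated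
      -- one is.
      have hlt : (L.take (rootCap k)).length < rootCap k ↔ L.length < rootCap k := by
        rw [List.length_take]; omega
      have hRL : (R ++ L.take (rootCap k)).length = R.length + (L.take (rootCap k)).length :=
        List.length_append
      refine ⟨fun h => ⟨fun h' => ?_, fun h' => ?_⟩, fun h => ?_⟩
      · have htake : (L ++ [w]).take (rootCap k) = L.take (rootCap k) ++ [w] := by
          rw [take_append_singleton, if_pos (hlt.1 h')]
        rw [if_pos h, htake, List.length_append, List.length_singleton, ← List.append_assoc]
        refine ⟨by omega, by omega, by omega, hI₂.congr (by simp) (by simp) (by simp), ?_,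
          by omega, rfl⟩
        rw [← hRL, State.setArr_arr, if_pos rfl, f8]
        exact hR₁.push w
      · have htake : (L ++ [w]).take (rootCap k) = L.take (rootCap k) := by
          rw [take_append_singleton, if_neg fun h => h' (hlt.2 h)]
        rw [if_pos h, htake, f8]
        exact ⟨by omega, hI₂.congr rfl (by simp) rfl, hR₁, rfl, rfl⟩
      · rw [if_neg h, f8]
        exact ⟨by omega, hI₂.congr rfl (by simp) rfl, hR₁, rfl, rfl⟩
  · rintro s' t ⟨ht, hI', hR', h13, -⟩ _ _
    simp only [State.setReg_reg, Nat.reduceEqDiff, if_false, hC.r0, hC.r3, Nat.sub_zero] at ht h13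
    simp only [State.setReg_reg, Nat.reduceEqDiff, if_false, hC.r0] at hR'
    refine ⟨by omega, hI', hR', ?_⟩
    rw [h13, List.length_append]
    rfl

theorem rootsProg_spec (hN : IsNet n (adjList O J)) (hO : Offsets n W O) (hW : Words k W)
    (hA : (heavy n k F).length ≤ k)
    (hZ : (critZone n k (adjList O J) F).card ≤ 2 * k * (k + 1))
    (hC : Consts n k F O J s) (hI : Idle (heavy n k F) s) :
    WP W rootsProg s fun s' t =>
      t ≤ codeBound k * (n * (rootSeqs k * (rootTestTime k + 2) + 8 + 2) + 3 + 2) + 3 ∧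
      Idle (heavy n k F) s' ∧ Holds (s'.arr 8) (roots n k (adjList O J) F) ∧
      s'.reg 13 = (roots n k (adjList O J) F).length := by
  simp only [rootsProg, WP.seq_iff, WP.copy_iff]
  refine WP.call (forLoop_spec (b := n * (rootSeqs k * (rootTestTime k + 2) + 8 + 2) + 3)
    (fun j s => Idle (heavy n k F) s ∧ Holds (s.arr 8) (rootsBelow n k (adjList O J) F j) ∧
      s.reg 13 = (rootsBelow n k (adjList O J) F j).length)
    (by decide) (by simp [hC.r2]) (by simp [hC.r3]) (by simp [hC.r11, hW.code])
    ⟨hI.congr rfl (by simp) rfl, by simp [Holds, hC.r3, rootsBelow],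
      by simp [hC.r3, rootsBelow]⟩ ?_) ?_
  · rintro τ s₁ _ hj hi hr ha ⟨hI₁, hR₁, h13⟩
    have hτ : τ < codeBound k := by simpa [hC.r11] using hj
    have e1 : ∀ y < 13, s₁.reg y = s.reg y := fun y hy => by
      rw [hr y (by clear * - hy; revert y; decide) (by omega)]
      have h13 : y ≠ 13 := by omega
      simp [h13]
    have hC₁ : Consts n k F O J s₁ := hC.congr (fun y hy => e1 y (by omega))
      (ha 0 rfl) (ha 1 rfl) (ha 2 rfl) (ha 5 rfl)
    have hlen := length_rootsBelow (n := n) (k := k) (N := adjList O J) (F := F) τ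
    have hle : τ * rootCap k + rootCap k ≤ W := by
      have := hW.base
      have : (τ + 1) * rootCap k ≤ codeBound k * rootCap k := Nat.mul_le_mul_right _ hτ
      rw [add_mul, one_mul] at this
      omega
    refine WP.call (rootsOfProg_spec hN hO hW hA hZ hC₁ hI₁ hi hR₁ h13 (by omega)) ?_
    rintro s₂ t₂ ⟨ht₂, hI₂, hR₂, h13⟩ _ _
    rw [← rootsBelow_succ] at hR₂ h13
    exact ⟨ht₂, hI₂.congr rfl (by simp) rfl, hR₂, by simpa using h13⟩
  · rintro s' t ⟨ht, hI', hR', h13⟩ _ _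
    simp only [State.setReg_reg, Nat.reduceEqDiff, if_false, hC.r11, hC.r3, Nat.sub_zero]
      at ht h13
    simp only [State.setReg_reg, Nat.reduceEqDiff, if_false, hC.r11] at hR'
    exact ⟨by omega, hI', hR', h13⟩

end

/-! ### The exhaustive search -/

/-- Write the number of neighbours in the current set into the array 6, for all vertices. -/
def countsProg : Program :=
  .seq (forLoop 66 3 0 (.store 6 66 3)) <| forLoop 66 3 72 <|
    .seq (.load 70 3 66) <| .seq boundsProg <| forLoop 78 75 76 <|
      .seq (.load 79 2 78) <| .seq (.load 80 6 79) <| .seq (.add 80 80 2) (.store 6 79 80)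

/-- Register 64 becomes 1 if the current set is critical. -/
def fullProg : Program :=
  .seq (.const 64 1) <| forLoop 66 3 0 <|
    .seq (.load 70 4 66) <| .seq (.load 73 6 66) <| .seq (.load 79 0 66) <|
      .ite (.eq 70 2)
        (.seq (.add 74 66 2) <| .seq (.load 75 1 66) <| .seq (.load 76 1 74) <|
          .seq (.sub 77 76 75) <| .seq (.sub 77 77 73) <| .ite (.lt 77 79) .skip (.const 64 0))
        (.ite (.le 2 79) (.ite (.le 79 73) .skip (.const 64 0)) (.const 64 0))

/-- Give the next power as weight to the vertex in register 66. -/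
def zoneStepProg : Program :=
  .seq (.ite (.lt 22 23)
      (.seq (.store 5 66 24) <| .seq (.copy 92 24) <| .seq (.copy 93 12) <|
        .seq mulProg (.copy 24 90)) .skip)
    (.add 22 22 2)

/-- Count the critical zone in register 22, and write its weights into the array 5. -/
def zoneProg : Program :=
  forLoop 66 3 0 <|
    .seq (.load 70 4 66) <| .seq (.load 73 6 66) <| .seq (.load 79 0 66) <|
      .ite (.eq 70 2) zoneStepProg (.ite (.lt 73 79) zoneStepProg .skip)

/-- Set register 19 to 1 if some sequence of digits gives a critical set. -/
def searchProg : Program :=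
  forLoop 16 3 21 <| .seq (.copy 71 13) <| .seq (.copy 60 16) <| .seq (.copy 61 20) <|
    .seq (genProg 8) <| .seq countsProg <| .seq fullProg <|
      .seq (.ite (.eq 64 2) (.copy 19 2) .skip) undoProg

section

variable {n k W : ℕ} {F O J : ℕ → ℕ} {s : State}

/-- By symmetry the neighbours of `v` in `S` are counted by the occurrences of `v` in the lists of
members. Hence the lists of the other vertices need not be read. -/
theorem sum_count_eq_cnt {N : ℕ → List ℕ} (hN : IsNet n N) {S : List ℕ} (hS : S.Nodup)
    (hSn : ∀ c ∈ S, c < n) {v : ℕ} (hv : v < n) :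
    (S.map fun c => (N c).count v).sum = cnt N S.toFinset v := by
  rw [← List.sum_toFinset _ hS]
  have : ∀ c ∈ S.toFinset, (N c).count v = if c ∈ (N v).toFinset then 1 else 0 := by
    intro c hc
    have hcn := hSn c (List.mem_toFinset.1 hc)
    rw [(hN.nodup c hcn).count]
    refine if_congr ?_ rfl rfl
    rw [List.mem_toFinset]
    exact ⟨hN.symm v hv c hcn, hN.symm c hcn v hv⟩
  rw [Finset.sum_congr rfl this, Finset.sum_boole, Nat.cast_id, cnt, Finset.filter_mem_eq_inter,
    Finset.inter_comm]

theorem IsNet.length_le {N : ℕ → List ℕ} (hN : IsNet n N) {v : ℕ} (hv : v < n) :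
    (N v).length ≤ n := by
  rw [← List.toFinset_card_of_nodup (hN.nodup v hv)]
  conv_rhs => rw [← Finset.card_range n]
  refine Finset.card_le_card fun u hu => ?_
  exact Finset.mem_range.2 (hN.lt v hv u (List.mem_toFinset.1 hu))

/-- At most `k` lists of length at most `n` are read, so the cost is `O(nk)` whatever the number of
edges. -/
theorem countsProg_spec {S : List ℕ} (hE : Env n k F O J s) (hN : IsNet n (adjList O J))
    (hO : Offsets n W O) (hS : Holds (s.arr 3) S) (hlen : s.reg 72 = S.length) (hnd : S.Nodup)
    (hSn : ∀ c ∈ S, c < n) (hSk : S.length ≤ k) (hkW : k ≤ W) :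
    WP W countsProg s fun s' t => t ≤ 3 * n + k * (6 * n + 6 + 2) + 4 ∧
      ∀ v < n, s'.arr 6 v = cnt (adjList O J) S.toFinset v := by
  have hnW := hO.n_lt
  simp only [countsProg, WP.seq_iff]
  refine WP.call (forLoop_spec (b := 1) (fun j s => ∀ v < j, s.arr 6 v = 0) (by decide)
    hE.r2 (by rw [hE.r3]; omega) (by rw [hE.r0]; omega) (by simp [hE.r3]) ?_) ?_
  · intro j s₁ _ hj hi hr ha hI
    have e3 : s₁.reg 3 = 0 := (hr 3 rfl (by decide)).trans hE.r3
    simp only [WP.store_iff, State.setReg_arr, State.setArr_arr, if_true, hi, e3]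
    refine ⟨le_rfl, fun v hv => ?_⟩
    by_cases hvj : v = j
    · simp [hvj]
    · rw [Function.update_of_ne hvj]
      exact hI v (by omega)
  rintro s₁ t₁ ⟨ht₁, hz⟩ hr₁ ha₁
  rw [hE.r0, hE.r3] at ht₁
  rw [hE.r0] at hz
  have hE₁ : Env n k F O J s₁ := hE.congr (hr₁ 0 rfl) (hr₁ 1 rfl) (hr₁ 2 rfl) (hr₁ 3 rfl)
    (ha₁ 0 rfl) (ha₁ 1 rfl) (ha₁ 2 rfl)
  have hS₁ : Holds (s₁.arr 3) S := by rw [ha₁ 3 rfl]; exact hS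
  have hlen₁ := (hr₁ 72 rfl).trans hlen
  refine WP.call (forLoop_spec (b := 6 * n + 6) (fun j s => ∀ v < n, s.arr 6 v =
      ((S.take j).map fun c => (adjList O J c).count v).sum) (by decide)
    hE₁.r2 (by rw [hE₁.r3]; omega) (by omega) (by simpa [hE₁.r3] using hz) ?_) ?_
  · intro i s₂ _ hi hj hr₂ ha₂ hI₂
    rw [hlen₁] at hi
    have e2 := (hr₂ 2 rfl (by decide)).trans hE₁.r2
    have f1 : s₂.arr 1 = O := (ha₂ 1 rfl).trans hE₁.a1
    have f2 : s₂.arr 2 = J := (ha₂ 2 rfl).trans hE₁.a2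
    obtain ⟨c, hc⟩ : ∃ c, c = S[i] := ⟨_, rfl⟩
    have f3 : s₂.arr 3 i = c := by rw [ha₂ 3 rfl, hS₁ i hi, hc]
    have hcn : c < n := hSn c (hc ▸ List.getElem_mem hi)
    have hmono := hO.mono c hcn
    have hle := hO.le (c + 1)
    have hdeg := hN.length_le hcn
    rw [length_adjList] at hdeg
    have hbound : ∀ v, ((S.take i).map fun c => (adjList O J c).count v).sum ≤ i := by
      intro v
      refine (List.sum_le_card_nsmul _ 1 ?_).trans (by simp)
      intro m hm
      obtain ⟨c, hc, rfl⟩ := List.mem_map.1 hm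
      exact (List.nodup_iff_count_le_one.1 (hN.nodup c (hSn c (List.mem_of_mem_take hc)))) v
    simp only [WP.seq_iff, WP.load_iff, WP.add_iff, boundsProg, State.setReg_reg,
      State.setReg_arr, e2, f1, f3, hj, Nat.reduceEqDiff, if_true, if_false]
    refine ⟨by omega, ?_⟩
    refine WP.call (forLoop_spec (b := 4) (fun j s => ∀ v < n, s.arr 6 v =
      ((S.take i).map fun c => (adjList O J c).count v).sum +
        ((List.range' (O c) (j - O c)).map J).count v) (by decide)
      (by simp [e2]) (by simpa using hmono) (by simpa using hle) (by simpa using hI₂) ?_) ?_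
    · intro j s₃ hj hj' hi₃ hr₃ ha₃ hI₃
      simp only [State.setReg_reg, Nat.reduceEqDiff, if_false, if_true] at hj hj'
      have e2 : s₃.reg 2 = 1 := by rw [hr₃ 2 rfl (by decide)]; simp [e2]
      have f2 : s₃.arr 2 = J := by rw [ha₃ 2 rfl]; simp [f2]
      have hrange : List.range' (O c) (j + 1 - O c) = List.range' (O c) (j - O c) ++ [j] := by
        rw [Nat.sub_add_comm hj, List.range'_concat]
        congr 2
        omega
      have hsub : ((List.range' (O c) (j + 1 - O c)).map J).Sublist (adjList O J c) :=
        (List.range'_sublist_right.2 (by omega)).map J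
      have hJn : J j < n := hN.lt c hcn _ (hsub.subset (by rw [hrange]; simp))
      -- Lists have no repetitions, so this is the first occurrence of `J j` in the list of `c`. The
      -- updated entry is at most `i + 1 ≤ k` and does not overflow.
      have hone := (hsub.count_le (J j)).trans
        (List.nodup_iff_count_le_one.1 (hN.nodup c hcn) (J j))
      rw [hrange, List.map_append, List.count_append] at hone
      have hb := hbound (J j)
      have hv := hI₃ (J j) hJn
      simp only [List.map_cons, List.map_nil, List.count_cons_self, List.count_nil] at hone
      simp only [WP.seq_iff, WP.load_iff, WP.add_iff, WP.store_iff, State.setReg_reg,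
        State.setReg_arr, State.setArr_arr, e2, f2, hi₃, hrange, List.map_append,
        List.count_append, List.map_cons, List.map_nil, Nat.reduceEqDiff, if_true, if_false]
      refine ⟨by omega, le_rfl, fun v hvn => ?_⟩
      by_cases hvJ : v = J j
      · subst hvJ
        rw [Function.update_self, List.count_singleton_self]
        omega
      · rw [Function.update_of_ne hvJ, hI₃ v hvn, List.count_singleton, if_neg, add_zero]
        simpa using Ne.symm hvJ
    · rintro s₃ t₃ ⟨ht₃, hI₃⟩ _ _
      simp only [State.setReg_reg, Nat.reduceEqDiff, if_false, if_true] at ht₃ hI₃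
      refine ⟨by omega, fun v hv => ?_⟩
      rw [hI₃ v hv, List.take_succ_eq_append_getElem hi, List.map_append,
        List.sum_append, ← hc]
      simp [adjList]
  · rintro s₂ t₂ ⟨ht₂, hI₂⟩ _ _
    rw [hlen₁, hE₁.r3, Nat.sub_zero] at ht₂
    have := Nat.mul_le_mul_right (6 * n + 6 + 2) hSk
    refine ⟨by omega, fun v hv => ?_⟩
    rw [hI₂ v hv, hlen₁, List.take_length]
    exact sum_count_eq_cnt hN hnd hSn hv

/-- With all counts in array 6 and degrees given by offsets, the criterion takes constant time per
vertex. -/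
theorem fullProg_spec {S : List ℕ} (hE : Env n k F O J s)
    (hO : Offsets n W O) (hind : s.arr 4 = ind S)
    (hcnt : ∀ v < n, s.arr 6 v = cnt (adjList O J) S.toFinset v) :
    WP W fullProg s fun s' t => t ≤ n * (12 + 2) + 3 ∧
      (s'.reg 64 = 1 ↔ Crit n (adjList O J) F S.toFinset) := by
  have hnW := hO.n_lt
  simp only [fullProg, WP.seq_iff, WP.const_iff]
  refine ⟨by omega, ?_⟩
  refine WP.call (forLoop_spec (b := 12) (fun j s => s.reg 64 = 1 ↔ ∀ v < j,
    (v ∈ S.toFinset → (adjList O J v).length - cnt (adjList O J) S.toFinset v < F v) ∧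
    (v ∉ S.toFinset → 1 ≤ F v ∧ F v ≤ cnt (adjList O J) S.toFinset v)) (by decide)
    (by simp [hE.r2]) (by simp [hE.r3]) (by simp [hE.r0]; omega) (by simp [hE.r3]) ?_) ?_
  · intro v s₁ _ hv hi hr ha hI
    have hv : v < n := by simpa [hE.r0] using hv
    have e2 : s₁.reg 2 = 1 := by rw [hr 2 rfl (by decide)]; simp [hE.r2]
    have f0 : s₁.arr 0 = F := (ha 0 rfl).trans hE.a0
    have f1 : s₁.arr 1 = O := (ha 1 rfl).trans hE.a1
    have f4 : s₁.arr 4 = ind S := (ha 4 rfl).trans hind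
    have f6 : s₁.arr 6 v = cnt (adjList O J) S.toFinset v := by
      rw [ha 6 rfl]; exact hcnt v hv
    have hmem : ind S v = 1 ↔ v ∈ S.toFinset := by simp [ind]
    have hstep : ∀ P : ℕ → Prop, (∀ u < v + 1, P u) ↔ (∀ u < v, P u) ∧ P v := fun P =>
      Nat.forall_lt_succ_right
    simp only [WP.seq_iff, WP.load_iff, WP.add_iff, WP.sub_iff, WP.ite_iff, WP.skip_iff,
      WP.const_iff, Test.holds_eq, Test.holds_lt, Test.holds_le, State.setReg_reg,
      State.setReg_arr, e2, f0, f1, f4, f6, hi, hstep, hmem, length_adjList,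
      Nat.reduceEqDiff, if_true, if_false]
    rw [hI]
    simp only [length_adjList]
    refine ⟨fun h₁ => ⟨by omega, fun h₂ => ?_, fun h₂ => ?_⟩,
      fun h₁ => ⟨fun h₂ => ⟨fun h₃ => ?_, fun h₃ => ?_⟩, fun h₂ => ?_⟩⟩
    · simp [h₁, h₂]
    · simp only [h₁, h₂]; simp
    · simp [h₁, h₂, h₃]
    · simp [h₁, h₂, h₃]
    · simp only [h₁, h₂]; simp
  · rintro s' t ⟨ht, h⟩ _ _
    simp only [State.setReg_reg, Nat.reduceEqDiff, if_false, hE.r0, hE.r3, Nat.sub_zero] at ht h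
    exact ⟨by omega, h⟩

theorem zoneStepProg_spec {v r p m b : ℕ} (h2 : s.reg 2 = 1) (h3 : s.reg 3 = 0)
    (h66 : s.reg 66 = v) (h22 : s.reg 22 = r) (h23 : s.reg 23 = m) (h24 : s.reg 24 = p)
    (h12 : s.reg 12 = b) (hrW : r + 1 ≤ W) (hbW : b ≤ W) (hW : r < m → p * b ≤ W) :
    WP W zoneStepProg s fun s' t => t ≤ 3 * b + 10 ∧ s'.reg 22 = r + 1 ∧
      s'.reg 24 = (if r < m then p * b else p) ∧
      s'.arr 5 = if r < m then Function.update (s.arr 5) v p else s.arr 5 := by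
  simp only [zoneStepProg, WP.seq_iff, WP.ite_iff, WP.store_iff, WP.copy_iff, WP.skip_iff,
    WP.add_iff, Test.holds_lt, h22, h23]
  refine ⟨fun hlt => ?_, fun hlt => ?_⟩
  · refine WP.call (mulProg_spec (x := p) (y := b) (by simp [h2]) (by simp [h3]) (by simp [h24])
      (by simp [h12]) (hW hlt) hbW) ?_
    rintro s₁ t₁ ⟨ht₁, h90⟩ hr₁ ha₁
    have e2 : s₁.reg 2 = 1 := by rw [hr₁ 2 rfl]; simp [h2]
    have e22 : s₁.reg 22 = r := by rw [hr₁ 22 rfl]; simp [h22]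
    have f5 : s₁.arr 5 = Function.update (s.arr 5) v p := by rw [ha₁ 5 rfl]; simp [h66, h24]
    simp only [State.setReg_reg, State.setReg_arr, Nat.reduceEqDiff, if_true, if_false, h90, e2,
      e22, f5, hlt, and_true]
    omega
  · simp only [State.setReg_reg, State.setReg_arr, Nat.reduceEqDiff, if_true, if_false, h2, h24,
      hlt, and_true]
    omega

/-- An oversized zone is still counted, so that the instance can be rejected, but weights stop after
`2k(k+1)` elements, as higher powers might overflow. The largest power computed is `codeBound k`.
This cap is the `min` in the invariant. -/
theorem zoneProg_spec (hE : Env n k F O J s) (hO : Offsets n W O) (hW : codeBound k ≤ W)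
    (hI : Idle (heavy n k F) s)
    (hcnt : ∀ v < n, s.arr 6 v = cnt (adjList O J) (heavy n k F).toFinset v)
    (h5 : ∀ v, s.arr 5 v = 0) (h12 : s.reg 12 = 2 * k + 2) (h22 : s.reg 22 = 0)
    (h23 : s.reg 23 = 2 * k * (k + 1)) (h24 : s.reg 24 = 2 * k + 2) :
    WP W zoneProg s fun s' t => t ≤ n * (3 * (2 * k + 2) + 20 + 2) + 2 ∧
      s'.reg 22 = (critZone n k (adjList O J) F).card ∧
      ((critZone n k (adjList O J) F).card ≤ 2 * k * (k + 1) →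
        s'.arr 5 = zoneWeight n k (adjList O J) F) := by
  have hnW := hO.n_lt
  set Z := critZone n k (adjList O J) F with hZ
  set b := 2 * k + 2 with hb
  set m := 2 * k * (k + 1) with hm
  have hbW : b ≤ W := by
    refine le_trans ?_ hW
    rw [codeBound]
    exact Nat.le_self_pow (by omega) _
  have hZn : ∀ j, Z.filter (· < j) ⊆ Finset.range j := fun j u hu => by
    rw [Finset.mem_filter] at hu
    exact Finset.mem_range.2 hu.2
  have hrank : ∀ j, rank Z j ≤ j := fun j =>
    (Finset.card_le_card (hZn j)).trans_eq (Finset.card_range j)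
  have hrankn : rank Z n = Z.card := by
    rw [rank, Finset.filter_true_of_mem fun v hv => ?_]
    simp only [hZ, critZone, Finset.mem_filter, Finset.mem_range] at hv
    exact hv.1
  rw [zoneProg]
  refine WP.call (forLoop_spec (b := 3 * b + 20) (fun j s => s.reg 22 = rank Z j ∧
    s.reg 24 = b ^ (1 + min (rank Z j) m) ∧
    ∀ v, s.arr 5 v = if v < j ∧ v ∈ Z ∧ rank Z v < m then b ^ (1 + rank Z v) else 0)
    (by decide) hE.r2 (by rw [hE.r3]; omega) (by rw [hE.r0]; omega)
    (by simp [hE.r3, h5, h22, h24, rank_zero]) ?_) ?_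
  · intro v s₁ _ hv hi hr ha hI₁
    rw [hE.r0] at hv
    obtain ⟨I22, I24, I5⟩ := hI₁
    have e2 : s₁.reg 2 = 1 := (hr 2 rfl (by decide)).trans hE.r2
    have e3 : s₁.reg 3 = 0 := (hr 3 rfl (by decide)).trans hE.r3
    have e12 := (hr 12 rfl (by decide)).trans h12
    have e23 := (hr 23 rfl (by decide)).trans h23
    have f0 : s₁.arr 0 = F := (ha 0 rfl).trans hE.a0
    have f4 : s₁.arr 4 = ind (heavy n k F) := (ha 4 rfl).trans hI.ind
    have f6 : s₁.arr 6 v = cnt (adjList O J) (heavy n k F).toFinset v := by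
      rw [ha 6 rfl]; exact hcnt v hv
    have hmem : ind (heavy n k F) v = 1 ↔ v ∈ heavy n k F := by simp [ind]
    have hvZ : v ∈ Z ↔ v ∈ heavy n k F ∨ cnt (adjList O J) (heavy n k F).toFinset v < F v := by
      simp [hZ, critZone, hv]
    have hrv := hrank v
    have hstep : v ∈ Z → ∀ s₂ : State, s₂.reg 2 = 1 → s₂.reg 3 = 0 → s₂.reg 66 = v →
        s₂.reg 22 = s₁.reg 22 → s₂.reg 23 = m → s₂.reg 24 = s₁.reg 24 → s₂.reg 12 = b →
        s₂.arr 5 = s₁.arr 5 →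
        WP W zoneStepProg s₂ fun s' t => t ≤ 3 * b + 10 ∧ s'.reg 22 = rank Z (v + 1) ∧
          s'.reg 24 = b ^ (1 + min (rank Z (v + 1)) m) ∧
          ∀ u, s'.arr 5 u = if u < v + 1 ∧ u ∈ Z ∧ rank Z u < m then b ^ (1 + rank Z u) else 0 := by
      intro hvZ s₂ g2 g3 g66 g22 g23 g24 g12 g5
      refine WP.call (zoneStepProg_spec (W := W) g2 g3 g66 (g22.trans I22) g23 (g24.trans I24) g12
        (by omega) hbW ?_) ?_
      · intro hlt
        rw [← pow_succ, min_eq_left hlt.le]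
        refine le_trans (Nat.pow_le_pow_right (by omega) ?_) hW
        omega
      · rintro s₃ t₃ ⟨ht₃, k22, k24, k5⟩ _ _
        rw [rank_succ, if_pos hvZ]
        refine ⟨ht₃, k22, ?_, fun u => ?_⟩
        · rw [k24]
          split_ifs with hlt
          · rw [← pow_succ, min_eq_left hlt.le, min_eq_left hlt, add_assoc]
          · rw [min_eq_right (by omega), min_eq_right (by omega)]
        · rw [k5]
          by_cases huv : u = v
          · subst huv
            split_ifs with hlt hcond hcond
            · rw [Function.update_self, min_eq_left hlt.le]
            · exact absurd ⟨by omega, hvZ, hlt⟩ hcond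
            · exact absurd hcond.2.2 hlt
            · rw [g5, I5, if_neg]; omega
          · have : (u < v + 1 ∧ u ∈ Z ∧ rank Z u < m) ↔ (u < v ∧ u ∈ Z ∧ rank Z u < m) := by
              constructor
              · exact fun h => ⟨by omega, h.2⟩
              · exact fun h => ⟨by omega, h.2⟩
            rw [if_congr this rfl rfl, ← I5, ← g5]
            split_ifs
            · rw [Function.update_of_ne huv]
            · rfl
    simp only [WP.seq_iff, WP.load_iff, WP.ite_iff, WP.skip_iff, Test.holds_eq, Test.holds_lt,
      State.setReg_reg, State.setReg_arr, e2, f0, f4, f6, hi, hmem, Nat.reduceEqDiff, if_true,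
      if_false]
    refine ⟨fun h₁ => ?_, fun h₁ => ⟨fun h₂ => ?_, fun h₂ => ?_⟩⟩
    · refine WP.call (hstep (hvZ.2 (.inl h₁)) _ (by simp [e2]) (by simp [e3]) (by simp [hi])
        (by simp) (by simp [e23]) (by simp) (by simp [e12]) rfl) ?_
      rintro s₃ t₃ ⟨ht₃, h⟩ _ _
      exact ⟨by omega, h⟩
    · refine WP.call (hstep (hvZ.2 (.inr h₂)) _ (by simp [e2]) (by simp [e3]) (by simp [hi])
        (by simp) (by simp [e23]) (by simp) (by simp [e12]) rfl) ?_
      rintro s₃ t₃ ⟨ht₃, h⟩ _ _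
      exact ⟨by omega, h⟩
    · have hnZ : v ∉ Z := fun h => (hvZ.1 h).elim h₁ h₂
      rw [rank_succ, if_neg hnZ]
      refine ⟨by omega, I22, I24, fun u => ?_⟩
      rw [I5]
      refine if_congr ?_ rfl rfl
      constructor
      · exact fun h => ⟨by omega, h.2⟩
      · refine fun h => ⟨?_, h.2⟩
        have : u ≠ v := fun huv => hnZ (huv ▸ h.2.1)
        omega
  · rintro s' t ⟨ht, g22, -, g5⟩ _ _
    rw [hE.r0, hE.r3, Nat.sub_zero] at ht
    rw [hE.r0, hrankn] at g22
    rw [hE.r0] at g5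
    refine ⟨ht, g22, fun hcard => funext fun v => ?_⟩
    rw [g5, zoneWeight, weight]
    refine if_congr ?_ rfl rfl
    constructor
    · exact fun h => h.2.1
    · intro h
      have hvn : v < n := by
        simp only [critZone, Finset.mem_filter, Finset.mem_range] at h
        exact h.1
      have h₁ : rank Z v + 1 ≤ rank Z (v + 1) := by rw [rank_succ, if_pos h]
      have h₂ := rank_le_card Z (v + 1)
      exact ⟨hvn, h, by omega⟩

theorem searchProg_spec (hN : IsNet n (adjList O J)) (hO : Offsets n W O) (hW : Words k W)
    (hA : (heavy n k F).length ≤ k) (hC : Consts n k F O J s) (hI : Idle (heavy n k F) s)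
    (hR : Holds (s.arr 8) (roots n k (adjList O J) F))
    (h13 : s.reg 13 = (roots n k (adjList O J) F).length)
    (h19 : s.reg 19 = 0) (h20 : s.reg 20 = fullBase n k (adjList O J) F) {E : ℕ}
    (h21 : s.reg 21 = E) (hE : E ≤ W) :
    WP W searchProg s fun s' t =>
      t ≤ E * (k * (3 * E + 10 * k + 6 * n + 44) + 17 * n + 24 + 2) + 2 ∧
      ((∃ x < E, Crit n (adjList O J) F (fullSet n k (adjList O J) F x).toFinset) →
        s'.reg 19 = 1) ∧
      ((¬ ∃ x < E, Crit n (adjList O J) F (fullSet n k (adjList O J) F x).toFinset) →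
        s'.reg 19 = 0) := by
  set R := roots n k (adjList O J) F with hRdef
  have hRn : ∀ c ∈ R, c < n := fun _ hc => lt_of_mem_rootsBelow hc
  have hRlen : R.length ≤ codeBound k * rootCap k := length_rootsBelow _
  have hbase := hW.base
  have hk : k + 1 ≤ W := by omega
  have hinit : GenInv n k (adjList O J) F (heavy n k F) R (heavy n k F, R) :=
    GenInv.init nodup_heavy hA (fun _ hc => (mem_heavy.1 hc).1) hRn
  rw [searchProg]
  refine WP.call (forLoop_spec (b := k * (3 * E + 10 * k + 6 * n + 44) + 17 * n + 24)
    (fun j s => Idle (heavy n k F) s ∧ Holds (s.arr 8) R ∧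
      ((∃ x < j, Crit n (adjList O J) F (fullSet n k (adjList O J) F x).toFinset) →
        s.reg 19 = 1) ∧
      ((¬ ∃ x < j, Crit n (adjList O J) F (fullSet n k (adjList O J) F x).toFinset) →
        s.reg 19 = 0))
    (by decide) hC.r2 (by rw [hC.r3]; omega) (by omega)
    ⟨hI.congr rfl (by simp) rfl, hR, by simp [hC.r3], by simp [h19]⟩ ?_) ?_
  · rintro x s₁ _ hxE hi hr ha ⟨hI₁, hR₁, hyes, hno⟩
    rw [h21] at hxE
    have e1 : ∀ y < 22, y ≠ 16 → y ≠ 19 → s₁.reg y = s.reg y := fun y hy h16 h19 =>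
      hr y (by clear * - hy h16 h19; revert y; decide) h16
    have hC₁ : Consts n k F O J s₁ := hC.congr
      (fun y hy => e1 y (by omega) (by omega) (by omega)) (ha 0 rfl) (ha 1 rfl) (ha 2 rfl) (ha 5 rfl)
    have hinv := hinit.gen hN (B := fullBase n k (adjList O J) F) k x
    simp only [WP.seq_iff, WP.copy_iff]
    refine WP.call (genProg_spec (ca := 8) (st := (heavy n k F, R)) (A := heavy n k F) (R := R)
      (by decide) (hC₁.toEnv.congr (by simp) (by simp) (by simp) (by simp) (by rfl) (by rfl)
        (by rfl)) hN hO (by simp [hC₁.r6]) (x := x) (B := fullBase n k (adjList O J) F)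
        (by simp [hi]) (by simp [e1 20, h20]) (by rw [fullBase]; omega) (by omega) hinit
        ⟨?_, ?_, ?_, ?_, ?_⟩ (by omega) (by omega)) ?_
    · exact hI₁.set
    · simpa using hI₁.len
    · exact hI₁.ind
    · exact hR₁
    · simp [e1 13, h13]
    rintro s₂ t₂ ⟨ht₂, hR₂⟩ hr₂ ha₂
    set st := gen k (adjList O J) F (fullBase n k (adjList O J) F) k x (heavy n k F, R) with hst
    have hS : st.1 = fullSet n k (adjList O J) F x := rfl
    have e2 : ∀ y < 20, s₂.reg y = s₁.reg y := fun y hy => by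
      rw [hr₂ y (by clear * - hy; revert y; decide)]
      have h60 : y ≠ 60 := by omega
      have h61 : y ≠ 61 := by omega
      have h71 : y ≠ 71 := by omega
      simp [h60, h61, h71]
    have b2 : ∀ a, a ≠ 3 → a ≠ 4 → a ≠ 8 → s₂.arr a = s₁.arr a := fun a h3 h4 h8 => by
      rw [ha₂ a (writesArr_genProg h3 h4 h8)]
      rfl
    have hC₂ : Consts n k F O J s₂ := hC₁.congr (fun y hy => e2 y (by omega))
      (b2 0 (by decide) (by decide) (by decide)) (b2 1 (by decide) (by decide) (by decide))
      (b2 2 (by decide) (by decide) (by decide)) (b2 5 (by decide) (by decide) (by decide))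
    refine WP.call (countsProg_spec hC₂.toEnv hN hO hR₂.set hR₂.len hinv.nodup hinv.lt hinv.len
      (by omega)) ?_
    rintro s₃ t₃ ⟨ht₃, h6⟩ hr₃ ha₃
    have hE₃ : Env n k F O J s₃ := hC₂.toEnv.congr (hr₃ 0 rfl) (hr₃ 1 rfl) (hr₃ 2 rfl) (hr₃ 3 rfl)
      (ha₃ 0 rfl) (ha₃ 1 rfl) (ha₃ 2 rfl)
    refine WP.call (fullProg_spec (S := st.1) hE₃ hO ((ha₃ 4 rfl).trans hR₂.ind) h6) ?_
    rintro s₄ t₄ ⟨ht₄, h64⟩ hr₄ ha₄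
    rw [hS] at h64
    have e4 : ∀ y < 20, s₄.reg y = s₁.reg y := fun y hy => by
      rw [hr₄ y (by clear * - hy; revert y; decide), hr₃ y (by clear * - hy; revert y; decide),
        e2 y hy]
    have hundo : ∀ s₅ : State, (∀ y, y ≠ 19 → s₅.reg y = s₄.reg y) → (s₅.arr = s₄.arr) →
        WP W undoProg s₅ fun s' t => t ≤ k * 4 + 3 ∧ Idle (heavy n k F) (s'.setReg 16 (x + 1)) ∧
          Holds ((s'.setReg 16 (x + 1)).arr 8) R ∧ s'.reg 19 = s₅.reg 19 := by
      intro s₅ g g'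
      have hlen : s₅.reg 72 = st.1.length := by
        rw [g 72 (by decide), hr₄ 72 rfl, hr₃ 72 rfl, hR₂.len]
      have hind : s₅.arr 4 = ind st.1 := by rw [g', ha₄ 4 rfl, ha₃ 4 rfl, hR₂.ind]
      have hset : Holds (s₅.arr 3) st.1 := by rw [g', ha₄ 3 rfl, ha₃ 3 rfl]; exact hR₂.set
      refine WP.call (undoProg_spec (A := heavy n k F) (S := st.1) (k := k)
        (by rw [g 2 (by decide), e4 2 (by decide), hC₁.r2])
        (by rw [g 3 (by decide), e4 3 (by decide), hC₁.r3])
        (by rw [g 4 (by decide), e4 4 (by decide), hC₁.r4])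
        hind hset hlen hinv.pre hinv.nodup hinv.len hk) ?_
      rintro s₆ t₆ ⟨ht₆, h72, h4⟩ hr₆ ha₆
      refine ⟨ht₆, ⟨?_, by simpa using h72, h4⟩, ?_, hr₆ 19 rfl⟩
      · rw [State.setReg_arr, ha₆ 3 rfl]
        exact hset.of_prefix hinv.pre
      -- Candidates appended after the roots need not be erased. The roots remain a prefix of the
      -- array, and the next round resets its length.
      · rw [State.setReg_arr, ha₆ 8 rfl, g', ha₄ 8 rfl, ha₃ 8 rfl]
        exact hR₂.cand.of_prefix hinv.cand_pre
    have htime : k * (3 * x + 10 * k + 30 + 2) + k * (6 * n + 6 + 2) + k * 4 ≤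
        k * (3 * E + 10 * k + 6 * n + 44) := by
      rw [← mul_add, ← mul_add]
      exact Nat.mul_le_mul_left _ (by omega)
    have g2 := (e4 2 (by decide)).trans hC₁.r2
    have g19 := e4 19 (by decide)
    simp only [WP.ite_iff, WP.copy_iff, WP.skip_iff, Test.holds_eq, g2, h64]
    refine ⟨fun h => ?_, fun h => ?_⟩
    · refine WP.call (hundo _ (fun y hy => by simp [hy]) rfl) ?_
      rintro s₆ t₆ ⟨ht₆, hI₆, hR₆, h19⟩ _ _
      refine ⟨by omega, hI₆, hR₆, fun _ => by simp [h19], fun hcon => ?_⟩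
      exact absurd ⟨x, by omega, h⟩ hcon
    · refine WP.call (hundo _ (fun y hy => rfl) rfl) ?_
      rintro s₆ t₆ ⟨ht₆, hI₆, hR₆, h19⟩ _ _
      have hiff : (∃ y < x + 1, Crit n (adjList O J) F
          (fullSet n k (adjList O J) F y).toFinset) ↔
          ∃ y < x, Crit n (adjList O J) F (fullSet n k (adjList O J) F y).toFinset := by
        constructor
        · rintro ⟨y, hy, hc⟩
          rcases Nat.lt_succ_iff_lt_or_eq.1 hy with hy | rfl
          · exact ⟨y, hy, hc⟩
          · exact absurd hc h
        · exact fun ⟨y, hy, hc⟩ => ⟨y, by omega, hc⟩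
      rw [hiff]
      simp only [State.setReg_reg, Nat.reduceEqDiff, if_false, h19, g19]
      exact ⟨by omega, hI₆, hR₆, hyes, hno⟩
  · rintro s' t ⟨ht, -, -, h⟩ _ _
    rw [h21, hC.r3, Nat.sub_zero] at ht
    rw [h21] at h
    exact ⟨ht, h⟩

end

/-! ### The whole program -/

/-- `x := y * z` -/
def setMul (x y z : ℕ) : Program :=
  .seq (.copy 92 y) <| .seq (.copy 93 z) <| .seq mulProg (.copy x 90)

/-- `x := y ^ z` -/
def setPow (x y z : ℕ) : Program :=
  .seq (.copy 82 y) <| .seq (.copy 83 z) <| .seq powProg (.copy x 80)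

/-- Collect the heavy vertices. -/
def heavyProg : Program :=
  .seq (forLoop 66 3 0
    (.seq (.load 70 0 66) <| .ite (.lt 1 70)
      (.seq (.store 4 66 2) <| .seq (.store 3 72 66) (.add 72 72 2)) .skip))
    (.copy 4 72)

/-- Compute the constants of the search. -/
def constsProg : Program :=
  .seq (.add 6 1 1) <| .seq (.add 7 1 2) <| .seq (.add 12 7 7) <| .seq (.copy 24 12) <|
  .seq (setMul 23 6 7) <| .seq (setMul 25 6 1) <| .seq (.add 25 25 2) <| .seq (.add 9 25 2) <|
  .seq (setPow 8 9 1) <| .seq (setMul 10 1 1) <| .seq (setMul 10 10 8) <| .seq (.add 10 10 2) <|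
  .seq (.add 26 23 2) (setPow 11 12 26)

/-- The decision procedure. -/
def decideProg : Program :=
  .seq (.const 2 1) <| .seq heavyProg <| .ite (.le 4 1)
    (.seq constsProg <| .seq countsProg <| .seq zoneProg <| .ite (.le 22 23)
      (.seq rootsProg <| .seq (.add 20 13 25) <| .seq (setPow 21 20 1) <|
        .seq searchProg (.copy 0 19))
      (.const 0 0))
    (.const 0 0)

section

variable {n k W : ℕ} {F O J : ℕ → ℕ} {s : State}

/-- The bound on `z` ensures that the first copy, into register 92, does not destroy the second
factor. -/
theorem setMul_spec {x y z : ℕ} (hz : z < 80) (h2 : s.reg 2 = 1)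
    (h3 : s.reg 3 = 0) (hyz : s.reg y * s.reg z ≤ W) (hzW : s.reg z ≤ W) :
    WP W (setMul x y z) s fun s' t => t ≤ 3 * s.reg z + 6 ∧ s'.reg x = s.reg y * s.reg z ∧
      (∀ w < 80, w ≠ x → s'.reg w = s.reg w) ∧ s'.arr = s.arr := by
  have z92 : z ≠ 92 := by omega
  simp only [setMul, WP.seq_iff, WP.copy_iff]
  refine WP.call (mulProg_spec (x := s.reg y) (y := s.reg z) (by simp [h2]) (by simp [h3])
    (by simp) (by simp [z92]) hyz hzW) ?_
  rintro s₁ t₁ ⟨ht₁, h90⟩ hr₁ ha₁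
  refine ⟨by omega, by simp [h90], fun w hw hwx => ?_, funext fun a => ha₁ a rfl⟩
  have h92 : w ≠ 92 := by omega
  have h93 : w ≠ 93 := by omega
  rw [State.setReg_reg, if_neg hwx, hr₁ w (by clear * - hw; revert w; decide)]
  simp [h92, h93]

theorem setPow_spec {x y z : ℕ} (hz : z < 80) (h2 : s.reg 2 = 1)
    (h3 : s.reg 3 = 0) (hpos : 0 < s.reg y) (hyz : s.reg y ^ s.reg z ≤ W) (hzW : s.reg z ≤ W) :
    WP W (setPow x y z) s fun s' t => t ≤ s.reg z * (3 * s.reg y + 6 + 2) + 6 ∧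
      s'.reg x = s.reg y ^ s.reg z ∧
      (∀ w < 80, w ≠ x → s'.reg w = s.reg w) ∧ s'.arr = s.arr := by
  have z82 : z ≠ 82 := by omega
  simp only [setPow, WP.seq_iff, WP.copy_iff]
  refine WP.call (powProg_spec (x := s.reg y) (y := s.reg z) (by simp [h2]) (by simp [h3])
    (by simp) (by simp [z82]) hpos hyz hzW) ?_
  rintro s₁ t₁ ⟨ht₁, h80⟩ hr₁ ha₁
  refine ⟨by omega, by simp [h80], fun w hw hwx => ?_, funext fun a => ha₁ a rfl⟩
  have h82 : w ≠ 82 := by omega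
  have h83 : w ≠ 83 := by omega
  rw [State.setReg_reg, if_neg hwx, hr₁ w (by clear * - hw; revert w; decide)]
  simp [h82, h83]

/-- The bound on vertices in `heavy` serves as the progress of the scan: after `j` steps the set is
`heavy j k F`. -/
theorem heavyProg_spec (hE : Env n k F O J s) (hnW : n ≤ W) (h72 : s.reg 72 = 0)
    (h4 : ∀ v, s.arr 4 v = 0) :
    WP W heavyProg s fun s' t => t ≤ n * (5 + 2) + 3 ∧ Idle (heavy n k F) s' ∧
      s'.reg 4 = (heavy n k F).length := by
  simp only [heavyProg, WP.seq_iff]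
  refine WP.call (forLoop_spec (b := 5) (fun j s => Idle (heavy j k F) s) (by decide) hE.r2
    (by rw [hE.r3]; omega) (by rw [hE.r0]; omega)
    ⟨by simp [Holds, heavy, hE.r3], by simp [heavy, hE.r3, h72], ?_⟩ ?_) ?_
  · funext v
    simp [ind, heavy, hE.r3, h4]
  · intro v s₁ _ hv hi hr ha hI
    rw [hE.r0] at hv
    have e1 := (hr 1 rfl (by decide)).trans hE.r1
    have e2 := (hr 2 rfl (by decide)).trans hE.r2
    have f0 : s₁.arr 0 = F := (ha 0 rfl).trans hE.a0
    have hsucc : heavy (v + 1) k F = heavy v k F ++ if k < F v then [v] else [] := by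
      rw [heavy, List.range_succ, List.filter_append, ← heavy]
      split_ifs with h <;> simp [h]
    have hlen : (heavy v k F).length ≤ v :=
      (List.length_filter_le _ _).trans_eq List.length_range
    simp only [WP.seq_iff, WP.load_iff, WP.ite_iff, WP.store_iff, WP.add_iff, WP.skip_iff,
      Test.holds_lt, State.setReg_reg, State.setArr_reg, e1, e2, f0, hi,
      hI.len, hsucc, Nat.reduceEqDiff, if_true, if_false]
    refine ⟨fun h => ⟨by omega, by omega, ?_, ?_, ?_⟩, fun h => ⟨by omega, ?_⟩⟩
    · simpa [h, hI.len, hi] using hI.set.push v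
    · simp [h]
    · simp only [if_pos h, ind_append]
      simp [hI.ind]
    · rw [if_neg h, List.append_nil]
      exact hI.congr rfl (by simp) rfl
  · rintro s₁ t₁ ⟨ht₁, hI⟩ _ _
    rw [hE.r0, hE.r3, Nat.sub_zero] at ht₁
    rw [hE.r0] at hI
    simp only [WP.copy_iff]
    refine ⟨by omega, hI.congr rfl (by simp) rfl, by simp [hI.len]⟩

theorem constsProg_spec (hE : Env n k F O J s) (hW : Words k W) :
    WP W constsProg s fun s' t =>
      t ≤ 9 * k + 60 + k * (3 * rootBase k + 6 + 2) + 3 * rootSeqs k +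
        (2 * k * (k + 1) + 1) * (3 * (2 * k + 2) + 6 + 2) ∧
      s'.reg 6 = 2 * k ∧ s'.reg 7 = k + 1 ∧ s'.reg 8 = rootSeqs k ∧ s'.reg 9 = rootBase k ∧
      s'.reg 10 = rootCap k ∧ s'.reg 11 = codeBound k ∧ s'.reg 12 = 2 * k + 2 ∧
      s'.reg 23 = 2 * k * (k + 1) ∧ s'.reg 24 = 2 * k + 2 ∧ s'.reg 25 = 2 * k * k + 1 := by
  have hbase := hW.base
  have hseqs := hW.seqs
  have hcode := hW.code
  have hpos : 1 ≤ codeBound k := Nat.one_le_pow _ _ (by omega)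
  have hspos : 1 ≤ rootSeqs k := Nat.one_le_pow _ _ (by rw [rootBase]; omega)
  have hcap : rootCap k ≤ codeBound k * rootCap k := Nat.le_mul_of_pos_left _ hpos
  have hcapdef : rootCap k = k * k * rootSeqs k + 1 := rfl
  have hkk : k * k ≤ k * k * rootSeqs k := Nat.le_mul_of_pos_right _ hspos
  have hdist : 2 * k * (k + 1) = 2 * k * k + 2 * k := by ring
  have h2k : k + k = 2 * k := by ring
  have h2k2 : k + 1 + (k + 1) = 2 * k + 2 := by ring
  simp only [constsProg, WP.seq_iff, WP.add_iff, WP.copy_iff, State.setReg_reg,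
    hE.r1, hE.r2, h2k, h2k2, Nat.reduceEqDiff, if_true, if_false]
  refine ⟨by omega, by omega, by omega, ?_⟩
  refine WP.call (setMul_spec (by decide) (by simp [hE.r2])
    (by simp [hE.r3]) (by simp; omega) (by simp; omega)) ?_
  rintro s₁ t₁ ⟨ht₁, v₁, f₁, -⟩ _ _
  simp at ht₁ v₁ f₁
  refine WP.call (setMul_spec (by decide) (by simp [f₁, hE.r2])
    (by simp [f₁, hE.r3]) (by simp [f₁, hE.r1]; omega) (by simp [f₁, hE.r1]; omega)) ?_
  rintro s₂ t₂ ⟨ht₂, v₂, f₂, -⟩ _ _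
  simp [f₁, hE.r1] at ht₂ v₂
  simp only [f₂, f₁, v₂, hE.r2, Nat.reduceEqDiff, Nat.reduceLT, ne_eq, not_false_eq_true,
    if_false]
  refine ⟨by omega, by omega, ?_⟩
  refine WP.call (setPow_spec (by decide) (by simp [f₂, f₁, hE.r2])
    (by simp [f₂, f₁, hE.r3]) (by simp) ?_ (by simp [f₂, f₁, hE.r1]; omega)) ?_
  · simp [f₂, f₁, hE.r1]; exact hseqs
  rintro s₃ t₃ ⟨ht₃, v₃, f₃, -⟩ _ _
  have v₃' : s₃.reg 8 = rootSeqs k := by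
    rw [v₃]; simp [f₂, f₁, hE.r1, rootSeqs, rootBase]
  simp [f₂, f₁, hE.r1] at ht₃ f₃
  refine WP.call (setMul_spec (by decide) (by simp [f₃, f₂, f₁, hE.r2])
    (by simp [f₃, f₂, f₁, hE.r3]) (by simp [f₃, f₂, f₁, hE.r1]; omega)
    (by simp [f₃, f₂, f₁, hE.r1]; omega)) ?_
  rintro s₄ t₄ ⟨ht₄, v₄, f₄, -⟩ _ _
  simp [f₃, f₂, f₁, hE.r1] at ht₄ v₄
  refine WP.call (setMul_spec (by decide) (by simp [f₄, f₃, f₂, f₁, hE.r2])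
    (by simp [f₄, f₃, f₂, f₁, hE.r3]) (by simp [v₄, f₄, v₃']; omega)
    (by simp [f₄, v₃', hseqs])) ?_
  rintro s₅ t₅ ⟨ht₅, v₅, f₅, -⟩ _ _
  simp [v₄, f₄, v₃'] at ht₅ v₅
  simp only [f₅, f₄, f₃, f₂, f₁, v₁, v₅, hE.r2, Nat.reduceEqDiff, Nat.reduceLT, ne_eq,
    not_false_eq_true, if_false]
  refine ⟨by omega, by omega, ?_⟩
  refine WP.call (setPow_spec (by decide) (by simp [f₅, f₄, f₃, f₂, f₁, hE.r2])
    (by simp [f₅, f₄, f₃, f₂, f₁, hE.r3]) (by simp [f₅, f₄, f₃, f₂, f₁]) ?_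
    (by simp; omega)) ?_
  · simp [f₅, f₄, f₃, f₂, f₁]; exact hcode
  rintro s₆ t₆ ⟨ht₆, v₆, f₆, -⟩ _ _
  have v₆' : s₆.reg 11 = codeBound k := by
    rw [v₆]; simp [f₅, f₄, f₃, f₂, f₁, codeBound]
  simp [f₅, f₄, f₃, f₂, f₁] at ht₆ f₆
  refine ⟨?_, ?_, ?_, ?_, ?_, ?_, v₆', ?_, ?_, ?_, ?_⟩
  · rw [show 2 * k * k + 2 = rootBase k from rfl] at ht₃
    omega
  all_goals simp [f₆, f₅, f₄, f₃, f₂, f₁, v₁, v₃', hcapdef, rootBase]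

end

section

variable {n k W : ℕ} {s : State}

/-- Summation of the running times of the parts of `decideProg`. -/
theorem time_sum_le {Y b e c B E : ℕ} (hn : 1 ≤ n) (hk1 : 1 ≤ k) (hk : k ≤ Y) (hb : b ≤ Y)
    (he : e ≤ Y) (hc : c ≤ Y) (hB : B ≤ Y) (hE : E ≤ Y) :
    n * 7 + (9 * k + 60 + k * (3 * b + 6 + 2) + 3 * e +
      (2 * k * (k + 1) + 1) * (3 * (2 * k + 2) + 6 + 2)) +
    (3 * n + k * (6 * n + 6 + 2)) + (n * (3 * (2 * k + 2) + 20 + 2)) +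
    (c * (n * (e * (k * (3 * e + 27 * k + 70) + 25 + 2) + 8 + 2) + 3 + 2)) +
    (k * (3 * B + 6 + 2)) +
    (E * (k * (3 * E + 10 * k + 6 * n + 44) + 17 * n + 24 + 2)) + 50 ≤ 1000 * (n * Y ^ 4) := by
  have hY : 1 ≤ Y := hk1.trans hk
  -- After all parameters are replaced by `Y`, every monomial has degree at most 1 in `n` and at
  -- most 4 in `Y`. The 4 comes from the codes, the digit sequences, the members, and the division
  -- inside a root test.
  have m : ∀ a i, a ≤ 1 → i ≤ 4 → n ^ a * Y ^ i ≤ n * Y ^ 4 := fun a i ha hi =>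
    Nat.mul_le_mul ((Nat.pow_le_pow_right hn ha).trans_eq (pow_one n)) (Nat.pow_le_pow_right hY hi)
  have m00 := m 0 0 (by omega) (by omega)
  have m01 := m 0 1 (by omega) (by omega)
  have m02 := m 0 2 (by omega) (by omega)
  have m03 := m 0 3 (by omega) (by omega)
  have m04 := m 0 4 (by omega) (by omega)
  have m10 := m 1 0 (by omega) (by omega)
  have m11 := m 1 1 (by omega) (by omega)
  have m12 := m 1 2 (by omega) (by omega)
  have m13 := m 1 3 (by omega) (by omega)
  simp only [pow_zero, pow_one, one_mul, mul_one] at m00 m01 m02 m03 m04 m10 m11 m12 m13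
  calc _ ≤ n * 7 + (9 * Y + 60 + Y * (3 * Y + 6 + 2) + 3 * Y +
      (2 * Y * (Y + 1) + 1) * (3 * (2 * Y + 2) + 6 + 2)) +
    (3 * n + Y * (6 * n + 6 + 2)) + (n * (3 * (2 * Y + 2) + 20 + 2)) +
    (Y * (n * (Y * (Y * (3 * Y + 27 * Y + 70) + 25 + 2) + 8 + 2) + 3 + 2)) +
    (Y * (3 * Y + 6 + 2)) +
    (Y * (Y * (3 * Y + 10 * Y + 6 * n + 44) + 17 * n + 24 + 2)) + 50 := by gcongr
    _ ≤ _ := by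
      ring_nf at m00 m01 m02 m03 m04 m10 m11 m12 m13 ⊢
      linarith

/-- `decideProg` decides the existence of small critical sets. -/
theorem decideProg_spec {Y : ℕ} (h0 : s.reg 0 = n) (h1 : s.reg 1 = k)
    (hreg : ∀ x, 2 ≤ x → s.reg x = 0) (harr : ∀ a, 3 ≤ a → ∀ i, s.arr a i = 0)
    (hN : IsNet n (adjList (s.arr 1) (s.arr 2))) (hO : Offsets n W (s.arr 1)) (hn : 1 ≤ n)
    (hk : 1 ≤ k) (hkY : k ≤ Y) (hseqs : rootSeqs k ≤ Y) (hcode : codeBound k ≤ Y)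
    (hbase : codeBound k * rootCap k + 2 * k * k + 2 * k + 2 ≤ Y)
    (hfull : (codeBound k * rootCap k + (2 * k * k + 1)) ^ k ≤ Y)
    (hYW : Y ≤ W) :
    WP W decideProg s fun s' t => t ≤ 1000 * (n * Y ^ 4) ∧
      ((∃ S : Finset ℕ, Crit n (adjList (s.arr 1) (s.arr 2)) (s.arr 0) S ∧ S.card ≤ k ∧
        ∀ v ∈ S, v < n) → s'.reg 0 = 1) ∧
      ((¬ ∃ S : Finset ℕ, Crit n (adjList (s.arr 1) (s.arr 2)) (s.arr 0) S ∧ S.card ≤ k ∧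
        ∀ v ∈ S, v < n) → s'.reg 0 = 0) := by
  obtain ⟨F, hF⟩ : ∃ F, F = s.arr 0 := ⟨_, rfl⟩
  obtain ⟨O, hOdef⟩ : ∃ O, O = s.arr 1 := ⟨_, rfl⟩
  obtain ⟨J, hJ⟩ : ∃ J, J = s.arr 2 := ⟨_, rfl⟩
  rw [← hOdef, ← hJ] at hN
  rw [← hOdef] at hO
  rw [← hF, ← hOdef, ← hJ]
  rw [exists_crit_iff hN]
  have hW : Words k W := ⟨by omega, by omega, by omega⟩
  have hroots : (roots n k (adjList O J) F).length ≤ codeBound k * rootCap k :=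
    length_rootsBelow _
  have hfb : fullBase n k (adjList O J) F ≤ codeBound k * rootCap k + (2 * k * k + 1) := by
    rw [fullBase]; omega
  have hE : fullBase n k (adjList O J) F ^ k ≤ Y := (Nat.pow_le_pow_left hfb k).trans hfull
  have htime := time_sum_le (Y := Y) (b := rootBase k) (e := rootSeqs k) (c := codeBound k)
    (B := fullBase n k (adjList O J) F) (E := fullBase n k (adjList O J) F ^ k) hn hk hkY
    (by rw [rootBase]; omega) hseqs hcode (by omega) hE
  have hnW := hO.n_lt
  simp only [decideProg, WP.seq_iff, WP.const_iff]
  refine ⟨by omega, ?_⟩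
  have hE₀ : Env n k F O J (s.setReg 2 1) :=
    ⟨by simp [h0], by simp [h1], by simp, by simp [hreg], hF.symm, hOdef.symm, hJ.symm⟩
  refine WP.call (heavyProg_spec hE₀ hnW.le (by simp [hreg]) (by simp [harr])) ?_
  rintro s₁ t₁ ⟨ht₁, hI₁, h4⟩ hr₁ ha₁
  have hE₁ : Env n k F O J s₁ := hE₀.congr (hr₁ 0 rfl) (hr₁ 1 rfl) (hr₁ 2 rfl) (hr₁ 3 rfl)
    (ha₁ 0 rfl) (ha₁ 1 rfl) (ha₁ 2 rfl)
  have z22 : s₁.reg 22 = 0 := by rw [hr₁ 22 rfl]; simp [hreg]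
  have z19 : s₁.reg 19 = 0 := by rw [hr₁ 19 rfl]; simp [hreg]
  have z5 : s₁.arr 5 = s.arr 5 := ha₁ 5 rfl
  simp only [WP.ite_iff, WP.const_iff, Test.holds_le, h4, hE₁.r1]
  -- More than `k` heavy vertices cannot fit into a critical set of size at most `k`, so the answer
  -- is no.
  refine ⟨fun hA => ?_, fun hA => ⟨Nat.zero_le _, by omega, fun h => absurd h.1 hA, by simp⟩⟩
  simp only [WP.seq_iff]
  refine WP.call (constsProg_spec hE₁ hW) ?_
  rintro s₂ t₂ ⟨ht₂, c6, c7, c8, c9, c10, c11, c12, c23, c24, c25⟩ hr₂ ha₂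
  have hE₂ : Env n k F O J s₂ := hE₁.congr (hr₂ 0 rfl) (hr₂ 1 rfl) (hr₂ 2 rfl) (hr₂ 3 rfl)
    (ha₂ 0 rfl) (ha₂ 1 rfl) (ha₂ 2 rfl)
  have hI₂ : Idle (heavy n k F) s₂ := hI₁.congr (ha₂ 3 rfl) (hr₂ 72 rfl) (ha₂ 4 rfl)
  refine WP.call (countsProg_spec hE₂ hN hO hI₂.set hI₂.len nodup_heavy
    (fun _ hc => (mem_heavy.1 hc).1) hA (by omega)) ?_
  rintro s₃ t₃ ⟨ht₃, hcnt⟩ hr₃ ha₃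
  have hE₃ : Env n k F O J s₃ := hE₂.congr (hr₃ 0 rfl) (hr₃ 1 rfl) (hr₃ 2 rfl) (hr₃ 3 rfl)
    (ha₃ 0 rfl) (ha₃ 1 rfl) (ha₃ 2 rfl)
  have hI₃ : Idle (heavy n k F) s₃ := hI₂.congr (ha₃ 3 rfl) (hr₃ 72 rfl) (ha₃ 4 rfl)
  refine WP.call (zoneProg_spec hE₃ hO hW.code hI₃ hcnt
    (fun v => by rw [ha₃ 5 rfl, ha₂ 5 rfl, z5, harr 5 (by omega)])
    ((hr₃ 12 rfl).trans c12) ((hr₃ 22 rfl).trans ((hr₂ 22 rfl).trans z22))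
    ((hr₃ 23 rfl).trans c23) ((hr₃ 24 rfl).trans c24)) ?_
  rintro s₄ t₄ ⟨ht₄, g22, g5⟩ hr₄ ha₄
  have e4 : ∀ y, zoneProg.writesReg y = false → countsProg.writesReg y = false →
      s₄.reg y = s₂.reg y := fun y h h' => (hr₄ y h).trans (hr₃ y h')
  simp only [WP.ite_iff, WP.const_iff, Test.holds_le, g22, e4 23 rfl rfl, c23]
  -- A zone that is too large also rules out a solution, and otherwise the stored weights are
  -- correct.
  refine ⟨fun hZ => ?_, fun hZ => ⟨Nat.zero_le _, by omega, fun h => absurd h.2.1 hZ, by simp⟩⟩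
  have hC₄ : Consts n k F O J s₄ :=
    ⟨hE₃.congr (hr₄ 0 rfl) (hr₄ 1 rfl) (hr₄ 2 rfl) (hr₄ 3 rfl) (ha₄ 0 rfl) (ha₄ 1 rfl) (ha₄ 2 rfl),
      by rw [e4 4 rfl rfl, hr₂ 4 rfl, h4], by rw [e4 6 rfl rfl, c6], by rw [e4 7 rfl rfl, c7],
      by rw [e4 8 rfl rfl, c8], by rw [e4 9 rfl rfl, c9], by rw [e4 10 rfl rfl, c10],
      by rw [e4 11 rfl rfl, c11], g5 hZ⟩
  have hI₄ : Idle (heavy n k F) s₄ := hI₃.congr (ha₄ 3 rfl) (hr₄ 72 rfl) (ha₄ 4 rfl)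
  simp only [WP.seq_iff]
  refine WP.call (rootsProg_spec hN hO hW hA hZ hC₄ hI₄) ?_
  rintro s₅ t₅ ⟨ht₅, hI₅, hR₅, g13⟩ hr₅ ha₅
  have e5 : ∀ y < 12, s₅.reg y = s₄.reg y := fun y hy => hr₅ y (by clear * - hy; revert y; decide)
  have hC₅ : Consts n k F O J s₅ := hC₄.congr e5 (ha₅ 0 rfl) (ha₅ 1 rfl) (ha₅ 2 rfl) (ha₅ 5 rfl)
  have g25 : s₅.reg 25 = 2 * k * k + 1 := by rw [hr₅ 25 rfl, e4 25 rfl rfl, c25]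
  have g19 : s₅.reg 19 = 0 := by rw [hr₅ 19 rfl, e4 19 rfl rfl, hr₂ 19 rfl, z19]
  have hsum : s₅.reg 13 + s₅.reg 25 = fullBase n k (adjList O J) F := by
    rw [g13, g25, fullBase]
  simp only [WP.add_iff, hsum]
  refine ⟨by omega, ?_⟩
  refine WP.call (setPow_spec (by decide) (by simp [hC₅.r2]) (by simp [hC₅.r3])
    (by simp [fullBase]) ?_ (by simp [hC₅.r1]; omega)) ?_
  · simp [hC₅.r1]; omega
  rintro s₆ t₆ ⟨ht₆, g21, f₆, fa₆⟩ _ _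
  simp only [State.setReg_reg, Nat.reduceEqDiff, if_true, if_false, hC₅.r1] at ht₆ g21
  have e6 : ∀ y < 80, y ≠ 20 → y ≠ 21 → s₆.reg y = s₅.reg y := fun y hy h20 h21 => by
    rw [f₆ y hy h21]; simp [h20]
  have g20 : s₆.reg 20 = fullBase n k (adjList O J) F := by
    rw [f₆ 20 (by decide) (by decide)]; simp
  have hC₆ : Consts n k F O J s₆ := hC₅.congr
    (fun y hy => e6 y (by omega) (by omega) (by omega)) (by rw [fa₆]; rfl) (by rw [fa₆]; rfl)
    (by rw [fa₆]; rfl) (by rw [fa₆]; rfl)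
  have hI₆ : Idle (heavy n k F) s₆ := hI₅.congr (by rw [fa₆]; rfl)
    (e6 72 (by decide) (by decide) (by decide)) (by rw [fa₆]; rfl)
  refine WP.call (searchProg_spec hN hO hW hA hC₆ hI₆ (by rw [fa₆]; exact hR₅)
    ((e6 13 (by decide) (by decide) (by decide)).trans g13)
    ((e6 19 (by decide) (by decide) (by decide)).trans g19) g20 g21 (by omega)) ?_
  rintro s₇ t₇ ⟨ht₇, hyes, hno⟩ _ _
  simp only [WP.copy_iff, State.setReg_reg, if_true]
  rw [rootTestTime] at ht₅
  refine ⟨by omega, fun h => hyes h.2.2, fun h => hno fun h' => h ⟨hA, hZ, h'⟩⟩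

/-! ### The time bound -/

/-- Powers of `2k` are used because powers of `k` do not grow when `k = 1`. Codes and roots number
`(2k)^O(k^2)`. Raising the number of candidates to the power `k` is what makes the exponent cubic.
-/
theorem pow_bounds (hk : 1 ≤ k) :
    k ≤ (2 * k) ^ (16 * k ^ 3) ∧ rootSeqs k ≤ (2 * k) ^ (16 * k ^ 3) ∧
    codeBound k ≤ (2 * k) ^ (16 * k ^ 3) ∧
    codeBound k * rootCap k + 2 * k * k + 2 * k + 2 ≤ (2 * k) ^ (16 * k ^ 3) ∧
    (codeBound k * rootCap k + (2 * k * k + 1)) ^ k ≤ (2 * k) ^ (16 * k ^ 3) := by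
  have hb : 1 ≤ 2 * k := by omega
  have mono : ∀ {i j}, i ≤ j → (2 * k) ^ i ≤ (2 * k) ^ j := fun h => Nat.pow_le_pow_right hb h
  have k2 : k ≤ k ^ 2 := Nat.le_self_pow (by decide) k
  have k3 : k ^ 2 ≤ k ^ 3 := Nat.pow_le_pow_right hk (by decide)
  have hbase : rootBase k ≤ (2 * k) ^ 3 := by
    rw [rootBase]
    nlinarith [Nat.mul_le_mul hk hk, Nat.mul_le_mul (Nat.mul_le_mul hk hk) (le_refl k)]
  have hseqs : rootSeqs k ≤ (2 * k) ^ (3 * k) := by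
    rw [rootSeqs, pow_mul]
    exact Nat.pow_le_pow_left hbase k
  have hseqs1 : 1 ≤ rootSeqs k := Nat.one_le_pow _ _ (by rw [rootBase]; omega)
  have hcap : rootCap k ≤ (2 * k) ^ (3 * k + 2) := by
    rw [rootCap, pow_add]
    nlinarith [Nat.mul_le_mul hk hk, Nat.mul_le_mul hseqs (le_refl ((2 * k) ^ 2)),
      Nat.mul_le_mul (Nat.mul_le_mul hk hk) hseqs1]
  have hcode : codeBound k ≤ (2 * k) ^ (10 * k ^ 2) := by
    rw [codeBound]
    calc (2 * k + 2) ^ (2 * k * (k + 1) + 1) ≤ ((2 * k) ^ 2) ^ (2 * k * (k + 1) + 1) :=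
          Nat.pow_le_pow_left (by nlinarith) _
      _ = (2 * k) ^ (2 * (2 * k * (k + 1) + 1)) := by rw [← pow_mul]
      _ ≤ _ := mono (by nlinarith)
  have hprod : codeBound k * rootCap k ≤ (2 * k) ^ (15 * k ^ 2) := by
    calc codeBound k * rootCap k ≤ (2 * k) ^ (10 * k ^ 2) * (2 * k) ^ (3 * k + 2) :=
          Nat.mul_le_mul hcode hcap
      _ = (2 * k) ^ (10 * k ^ 2 + (3 * k + 2)) := (pow_add _ _ _).symm
      _ ≤ _ := mono (by nlinarith)
  have hsum : codeBound k * rootCap k + 2 * k * k + 2 * k + 2 ≤ (2 * k) ^ (16 * k ^ 2) := by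
    have h₁ : 2 * k * k + 2 * k + 2 ≤ (2 * k) ^ (15 * k ^ 2) := by
      calc 2 * k * k + 2 * k + 2 ≤ (2 * k) ^ 3 := by
            nlinarith [Nat.mul_le_mul hk hk, Nat.mul_le_mul (Nat.mul_le_mul hk hk) (le_refl k)]
        _ ≤ _ := mono (by nlinarith)
    calc codeBound k * rootCap k + 2 * k * k + 2 * k + 2 ≤ 2 * k * (2 * k) ^ (15 * k ^ 2) := by
          nlinarith
      _ = (2 * k) ^ (15 * k ^ 2 + 1) := (pow_succ' _ _).symm
      _ ≤ _ := mono (by nlinarith)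
  refine ⟨?_, ?_, ?_, ?_, ?_⟩
  · calc k ≤ (2 * k) ^ 1 := by rw [pow_one]; omega
      _ ≤ _ := mono (by nlinarith)
  · exact hseqs.trans (mono (by nlinarith))
  · exact hcode.trans (mono (by nlinarith))
  · exact hsum.trans (mono (by nlinarith))
  · calc (codeBound k * rootCap k + (2 * k * k + 1)) ^ k ≤ ((2 * k) ^ (16 * k ^ 2)) ^ k :=
          Nat.pow_le_pow_left (by omega) k
      _ = (2 * k) ^ (16 * k ^ 3) := by rw [← pow_mul]; ring_nf

/-- For `k ≥ 2` the factor 2 is absorbed by `2k ≤ k^2`. For `k = 1` it has to go into the constant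
`2^m`. -/
theorem two_mul_pow_le (hk : 1 ≤ k) (m : ℕ) : (2 * k) ^ (m * k ^ 3) ≤ 2 ^ m * k ^ (2 * m * k ^ 3) := by
  rcases Nat.lt_or_ge k 2 with h | h
  · obtain rfl : k = 1 := by omega
    simp
  · calc (2 * k) ^ (m * k ^ 3) ≤ (k ^ 2) ^ (m * k ^ 3) := Nat.pow_le_pow_left (by nlinarith) _
      _ = k ^ (2 * m * k ^ 3) := by rw [← pow_mul]; ring_nf
      _ ≤ _ := Nat.le_mul_of_pos_left _ (by positivity)

theorem decides_decideProg :
    DecidesCriticalSetInTime decideProg fun n _ k => 1000 * 2 ^ 64 * (n * k ^ (128 * k ^ 3)) := by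
  -- The first power of the time bound suffices as word size: apart from the input, all numbers
  -- produced are bounded by `n` or `Y`, hence by the time bound. The exponent 128 arises from `Y ^
  -- 4 = (2k)^(64 k^3)` on replacing `2k` by `k^2`.
  refine ⟨1, fun n k hn hk G _ f s hin W hT hregW harrW => ?_⟩
  obtain ⟨b₁, b₂, b₃, b₄, b₅⟩ := pow_bounds hk
  set Y := (2 * k) ^ (16 * k ^ 3) with hY
  have hY4 : Y ^ 4 ≤ 2 ^ 64 * k ^ (128 * k ^ 3) := by
    rw [hY, ← pow_mul]
    calc (2 * k) ^ (16 * k ^ 3 * 4) = (2 * k) ^ (64 * k ^ 3) := by ring_nf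
      _ ≤ _ := two_mul_pow_le hk 64
  have htime : 1000 * (n * Y ^ 4) ≤ 1000 * 2 ^ 64 * (n * k ^ (128 * k ^ 3)) := by
    calc 1000 * (n * Y ^ 4) ≤ 1000 * (n * (2 ^ 64 * k ^ (128 * k ^ 3))) := by gcongr
      _ = _ := by ring
  have hY1 : 1 ≤ Y := Nat.le_trans hk b₁
  have hYY : Y ≤ Y ^ 4 := Nat.le_self_pow (by decide) Y
  have h₁ : n ≤ n * Y ^ 4 := Nat.le_mul_of_pos_right _ (by omega)
  have h₂ : Y ^ 4 ≤ n * Y ^ 4 := Nat.le_mul_of_pos_left _ hn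
  rw [pow_one] at hT
  have hTW : 1000 * 2 ^ 64 * (n * k ^ (128 * k ^ 3)) ≤ W := hT
  have hYW := htime.trans hTW
  have hO : Offsets n W (s.arr 1) :=
    ⟨fun v hv => by have := hin.offset_succ ⟨v, hv⟩; simp only at this; omega, harrW 1, by omega⟩
  obtain ⟨s', t, hrun, ht, hyes, hno⟩ := decideProg_spec hin.vertices hin.parameter hin.reg_zero
    hin.arr_zero hin.isNet hO hn hk b₁ b₂ b₃ b₄ b₅ (by omega)
  rw [hin.criticalSetNumber_le_iff]
  exact ⟨s', t, hrun, ht.trans htime, hyes, hno⟩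

/-- A larger time bound also asks for larger words, so fewer word sizes have to be handled. -/
theorem DecidesCriticalSetInTime.mono {P : Program} {T T' : ℕ → ℕ → ℕ → ℕ}
    (h : DecidesCriticalSetInTime P T) (hT : ∀ n m k, T n m k ≤ T' n m k) :
    DecidesCriticalSetInTime P T' := by
  obtain ⟨q, hq⟩ := h
  refine ⟨q, fun n k hn hk G _ f s hin W hW hreg harr => ?_⟩
  obtain ⟨s', t, hrun, ht, hyn⟩ := hq n k hn hk G f s hin W
    ((Nat.pow_le_pow_left (hT _ _ _) q).trans hW) hreg harr
  exact ⟨s', t, hrun, ht.trans (hT _ _ _), hyn⟩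

theorem primrec_pow : Primrec₂ fun a b : ℕ => a ^ b := by
  refine (Primrec.nat_rec (f := fun _ : ℕ => 1) (g := fun (a : ℕ) (p : ℕ × ℕ) => p.2 * a)
    (Primrec.const 1) ?_).of_eq fun a b => ?_
  · exact Primrec.nat_mul.comp (Primrec.snd.comp Primrec.snd) Primrec.fst
  · induction b with
    | zero => simp
    | succ b ih => simp only [ih, pow_succ]

end

end CriticalSet

/-- One program serves both statements. The parameterized bound follows with `c = 1` from `n ≤ n +
m`, and the factor depending on `k` is primitive recursive. -/
theorem theorem4 :
    ∃ P : CriticalSet.Program,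
      (∃ (g : ℕ → ℕ) (C : ℕ),
        (fun k => (g k : ℝ)) =Θ[atTop] (fun k : ℕ => (k : ℝ) ^ 3) ∧
        CriticalSet.DecidesCriticalSetInTime P (fun n _ k => C * (n * k ^ g k))) ∧
      (∃ (h : ℕ → ℕ) (c : ℕ), Computable h ∧
        CriticalSet.DecidesCriticalSetInTime P (fun n m k => h k * (n + m) ^ c)) := by
  refine ⟨CriticalSet.decideProg, ⟨fun k => 128 * k ^ 3, 1000 * 2 ^ 64, ?_,
    CriticalSet.decides_decideProg⟩, fun k => 1000 * 2 ^ 64 * k ^ (128 * k ^ 3), 1, ?_, ?_⟩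
  · push_cast
    exact (isTheta_refl _ _).const_mul_left (by norm_num)
  · refine Primrec.to_comp (Primrec.nat_mul.comp (Primrec.const _) ?_)
    exact CriticalSet.primrec_pow.comp Primrec.id (Primrec.nat_mul.comp (Primrec.const _)
      (CriticalSet.primrec_pow.comp Primrec.id (Primrec.const _)))
  · refine CriticalSet.decides_decideProg.mono fun n m k => ?_
    rw [pow_one, mul_left_comm, mul_comm n]
    exact Nat.mul_le_mul_left _ (Nat.le_add_right n m)
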